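/- Let $d\ge 3$, $p_d=\frac{d}{d-1}$ and $E\subset(0,\infty)$. For $f:\mathbb R^d\to\mathbb C$ let $A_tf(x)=\int_{S^{d-1}}f(x-ty')\,d\sigma(y')$, where $\sigma$ is the rotationally invariant measure on the unit sphere $S^{d-1}$ with $\sigma(S^{d-1})=1$, and $\mathcal M_Ef(x)=\sup_{t\in E}|A_tf(x)|$, where $|A_tf(x)|$ is read as $\infty$ if the integral does not converge absolutely. For $k\in\mathbb Z$ let $E^k=[2^k,2^{k+1}]\cap E$, and for $a>0$ let $N(E^k,a)$ be the minimal number of intervals of length $a$ needed to cover $E^k$. For $1<p<\infty$ and $0<q<\infty$ let $$\|g\|_{L^{p,q}}=\Big(\frac qp\int_0^\infty[t^{1/p}g^*(t)]^q\,\frac{dt}{t}\Big)^{1/q},\qquad g^*(t)=\inf\{\alpha:|\{x:|g(x)|>\alpha\}|\le t\},$$ be the Lorentz quasinorm on $\mathbb R^d$ with Lebesgue measure $|\cdot|$. (i) There is a constant $C$ such that $$|\{x\in\mathbb R^d:\mathcal M_Ef(x)>\alpha\}|\le C\,\frac{\|f\|_{L^{p_d}(\mathbb R^d)}^{p_d}}{\alpha^{p_d}}$$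 for all $\alpha>0$ and all radial $f\in L^{p_d}(\mathbb R^d)$ (that is, $\mathcal M_E$ is of weak type $(p_d,p_d)$ on radial functions) if and only if there is a constant $C$ such that for all $\delta\in(0,1/2)$ $$\sup_{k\in\mathbb Z}N(E^k,2^k\delta)\le C\,\delta^{-1}[\log(1/\delta)]^{-1/(d-1)}.$$ (ii) Let $p_d<q<\infty$. There is a constant $C$ such that $\|\mathcal M_Ef\|_{L^{p_d,q}(\mathbb R^d)}\le C\|f\|_{L^{p_d}(\mathbb R^d)}$ for all radial $f\in L^{p_d}(\mathbb R^d)$ if and only if there is a constant $C$ such that for all $\delta\in(0,1/2)$ $$\sup_{|I|=\log\delta^{-1}}\Big(\sum_{k\in I\cap\mathbb Z}[N(E^k,2^k\delta)]^{q/p_d}\Big)^{p_d/q}\le C\,\delta^{-1}[\log(1/\delta)]^{-1/(d-1)},$$ where the supremum is taken over all intervals $I\subset\mathbb R$ of length $\log\delta^{-1}$. -/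

import Mathlib

open MeasureTheory Set
open scoped ENNReal NNReal

noncomputable section

namespace SphericalMaximal

/-- The rotationally invariant measure on the unit sphere of `ℝ^d`, normalized to total mass one. -/
def sphereMeasure (d : ℕ) : Measure (Metric.sphere (0 : EuclideanSpace ℝ (Fin d)) 1) :=
  ((volume : Measure (EuclideanSpace ℝ (Fin d))).toSphere univ)⁻¹ •
    (volume : Measure (EuclideanSpace ℝ (Fin d))).toSphere

/-- The spherical mean `A_t f(x) = ∫ f(x - t y) dσ(y)`. -/
def sphericalMean {d : ℕ} (t : ℝ) (f : EuclideanSpace ℝ (Fin d) → ℂ)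
    (x : EuclideanSpace ℝ (Fin d)) : ℂ :=
  ∫ y : Metric.sphere (0 : EuclideanSpace ℝ (Fin d)) 1,
    f (x - t • (y : EuclideanSpace ℝ (Fin d))) ∂(sphereMeasure d)

/-- The modulus `|A_t f(x)|` of the spherical mean, with the value `∞` where the integral defining
the mean does not converge absolutely (for radial `f ∈ L^p(ℝ^d)`, `d ≥ 3`, `t > 0`, this can happen
only if `x = 0` or `|x| = t`). -/
def absSphericalMean {d : ℕ} (t : ℝ) (f : EuclideanSpace ℝ (Fin d) → ℂ)
    (x : EuclideanSpace ℝ (Fin d)) : ℝ≥0∞ :=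
  open Classical in
  if Integrable (fun y : Metric.sphere (0 : EuclideanSpace ℝ (Fin d)) 1 =>
      f (x - t • (y : EuclideanSpace ℝ (Fin d)))) (sphereMeasure d)
  then ‖sphericalMean t f x‖ₑ else ∞

/-- The maximal function `M_E f(x) = sup_{t ∈ E} |A_t f(x)|`. -/
def maximalFunction {d : ℕ} (E : Set ℝ) (f : EuclideanSpace ℝ (Fin d) → ℂ)
    (x : EuclideanSpace ℝ (Fin d)) : ℝ≥0∞ :=
  ⨆ t ∈ E, absSphericalMean t f x

/-- `f` is radial: `f(x)` depends only on `|x|`. -/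
def IsRadial {d : ℕ} (f : EuclideanSpace ℝ (Fin d) → ℂ) : Prop :=
  ∀ x y, ‖x‖ = ‖y‖ → f x = f y

/-- The dyadic piece `E^k = [2^k, 2^(k+1)] ∩ E`. -/
def dyadicPiece (E : Set ℝ) (k : ℤ) : Set ℝ :=
  Icc ((2 : ℝ) ^ k) ((2 : ℝ) ^ (k + 1)) ∩ E

/-- The entropy number `N(A, a)`: the minimal number of intervals of length `a` needed to
cover `A` (`∞` if no finite number suffices). -/
def entropyNumber (A : Set ℝ) (a : ℝ) : ℝ≥0∞ :=
  ⨅ (S : Finset ℝ) (_ : A ⊆ ⋃ c ∈ S, Icc c (c + a)), (S.card : ℝ≥0∞)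

/-- The nonincreasing rearrangement `g^*(t) = inf {α : μ {g > α} ≤ t}`. -/
def rearrangement {Ω : Type*} [MeasurableSpace Ω] (μ : Measure Ω) (g : Ω → ℝ≥0∞)
    (t : ℝ≥0∞) : ℝ≥0∞ :=
  sInf {α : ℝ≥0∞ | μ {x | α < g x} ≤ t}

/-- The Lorentz quasinorm `‖g‖_{L^{p,q}(μ)} = ((q/p) ∫_0^∞ [t^{1/p} g^*(t)]^q dt/t)^{1/q}`. -/
def lorentzNorm {Ω : Type*} [MeasurableSpace Ω] (μ : Measure Ω) (p q : ℝ) (g : Ω → ℝ≥0∞) :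
    ℝ≥0∞ :=
  (ENNReal.ofReal (q / p) *
    ∫⁻ t in Ioi (0 : ℝ),
      (ENNReal.ofReal t ^ (1 / p) * rearrangement μ g (ENNReal.ofReal t)) ^ q /
        ENNReal.ofReal t) ^ (1 / q)

/-- `M_E` is of weak type `(p, p)` on radial functions on `ℝ^d`. -/
def WeakTypeOnRadial (d : ℕ) (E : Set ℝ) (p : ℝ) : Prop :=
  ∃ C : ℝ≥0, ∀ f : EuclideanSpace ℝ (Fin d) → ℂ,
    IsRadial f → MemLp f (ENNReal.ofReal p) volume →
      ∀ α : ℝ, 0 < α →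
        volume {x | ENNReal.ofReal α < maximalFunction E f x} ≤
          C * (eLpNorm f (ENNReal.ofReal p) volume) ^ p / ENNReal.ofReal α ^ p

/-- `M_E` maps the radial functions in `L^p(ℝ^d)` boundedly into the Lorentz space `L^{p,q}`. -/
def BoundedRadialToLorentz (d : ℕ) (E : Set ℝ) (p q : ℝ) : Prop :=
  ∃ C : ℝ≥0, ∀ f : EuclideanSpace ℝ (Fin d) → ℂ,
    IsRadial f → MemLp f (ENNReal.ofReal p) volume →
      lorentzNorm volume p q (maximalFunction E f) ≤
        C * eLpNorm f (ENNReal.ofReal p) volume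

/-- There is `C` with
`sup_k N(E^k, 2^k δ) ≤ C δ⁻¹ [log (1/δ)]^{-1/(d-1)}` for all `δ ∈ (0, 1/2)`. -/
def UniformEntropyBound (d : ℕ) (E : Set ℝ) : Prop :=
  ∃ C : ℝ≥0, ∀ δ : ℝ, 0 < δ → δ < 1 / 2 →
    (⨆ k : ℤ, entropyNumber (dyadicPiece E k) ((2 : ℝ) ^ k * δ)) ≤
      ENNReal.ofReal (C * δ⁻¹ * Real.log (1 / δ) ^ (-(1 / ((d : ℝ) - 1))))

/-- There is `C` with
`sup_{|I| = log δ⁻¹} (∑_{k ∈ I} N(E^k, 2^k δ)^{q/p})^{p/q} ≤ C δ⁻¹ [log (1/δ)]^{-1/(d-1)}`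
for all `δ ∈ (0, 1/2)`; here `I = [a, a + log δ⁻¹]` with `a` real. -/
def SummedEntropyBound (d : ℕ) (E : Set ℝ) (p q : ℝ) : Prop :=
  ∃ C : ℝ≥0, ∀ δ : ℝ, 0 < δ → δ < 1 / 2 →
    (⨆ a : ℝ, (∑' k : {k : ℤ // (k : ℝ) ∈ Icc a (a + Real.log δ⁻¹)},
        entropyNumber (dyadicPiece E k) ((2 : ℝ) ^ (k : ℤ) * δ) ^ (q / p)) ^ (p / q)) ≤
      ENNReal.ofReal (C * δ⁻¹ * Real.log (1 / δ) ^ (-(1 / ((d : ℝ) - 1))))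

end SphericalMaximal

end

/-! For a radial function the mean over a sphere of radius `t`, taken at distance `r` from the
origin, is a one-dimensional integral of the profile against an explicit kernel in `s ∈ (|r - t|, r
+ t)` (`lintegral_sphereMeasure_norm_sub`). For `t ≤ r/2` it is dominated by a Hardy–Littlewood
average, for `t ≥ 2r` by Hölder's inequality. Both regimes obey strong type bounds with all radii
admitted, so `E` matters only when `r/2 < t < 2r`.

In that regime the kernel is at most a constant times `s^(d-2) / r^(d-1)`. At `p = d/(d-1)` Hölder
on a dyadic shell bounds the integral of `s^(d-2) G` by a multiple of the weighted `L^p` norm `γ_j`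
of the profile on the shell, with no power of `2^j` left over (`setLIntegral_shell_le`). So for `r ≈
2^k` the quantity `2^(k(d-1)) A_t f` is controlled by the sum of `γ_j` over `log₂ |r - t| ≤ j ≤ k +
2`, up to rounding. If the mean exceeds a height, and `h` is the least index for which the window of
depth `2^h` has sum above the corresponding level `τ_k = α 2^(k(d-1))`, then `t` must be within `2^k
δ` of `r`, where `δ = 2^(-2^(h-1))`. The set of such `r` has measure about `2^k δ N(E^k, 2^k δ)`,
neighbouring pieces included. Since `log(1/δ) ≈ 2^h` and `p - 1 = 1/(d-1)`, the entropy hypothesis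
says exactly that this is `2^k 2^(-h(p-1)) e` with normalized densities `e` that are bounded, or
`ℓ^(q/p)`-bounded over `k` in intervals of length about `2^h`.

What remains concerns sequences. For (i) one needs `∑_k τ_k^p 2^(-h_k(p-1)) ≲ ∑ γ_j^p`. A single
term is Hölder's inequality. The windows overlap, but the levels `τ_k` are lacunary, so the earlier
ones use up only a third of what `τ_k` needs and the windows can be made essentially disjoint
(`sum_rpow_lacunary_le`). For (ii), the `L^{p,q}` quasinorm is an `ℓ^q` sum over dyadic heights, so
the `q/p`-th powers of these sums must be summed over the heights. A weighted Hölder inequality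
(`sum_hit_rpow_le`) leaves a factor localized to the window, the sum over heights becomes geometric,
and a Carleson type embedding (`tsum_window_le`) finishes; its hypothesis is the summed entropy
condition.

Necessity is tested on `|x|^(-(d-1))` restricted to a spherical shell. The `p`-th power of its `L^p`
norm is a logarithm, while its mean is at least about `2^(-k(d-1)) log(1/δ)` wherever `|x|` is
within `2^k δ` of a radius in `E^k` (`le_absSphericalMean_testFunction`). For (ii) one such function
serves all `k` in an interval of length `log(1/δ)`, and different `k` use different dyadic heights.
-/

noncomputable section
namespace SphericalMaximal

/-! ### Polar coordinates for lower integrals -/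

section Polar
open Metric Measure

variable {F : Type*} [NormedAddCommGroup F] [NormedSpace ℝ F] [MeasurableSpace F] [BorelSpace F]
  [FiniteDimensional ℝ F] [Nontrivial F]

theorem lintegral_eq_lintegral_toSphere_prod (μ : Measure F) [μ.IsAddHaarMeasure]
    {Φ : F → ℝ≥0∞} (hΦ : Measurable Φ) :
    ∫⁻ x, Φ x ∂μ = ∫⁻ r in Ioi (0 : ℝ), ENNReal.ofReal (r ^ (Module.finrank ℝ F - 1)) *
      ∫⁻ y : sphere (0 : F) 1, Φ (r • (y : F)) ∂μ.toSphere := by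
  have h1 : ∫⁻ x, Φ x ∂μ = ∫⁻ x : ({(0)}ᶜ : Set F), Φ x ∂(μ.comap (↑)) := by
    rw [lintegral_subtype_comap (measurableSet_singleton _).compl, restrict_compl_singleton]
  have h2 := μ.measurePreserving_homeomorphUnitSphereProd.lintegral_comp_emb
    (Homeomorph.measurableEmbedding _)
    (fun z : sphere (0 : F) 1 × Ioi (0 : ℝ) => Φ ((z.2 : ℝ) • (z.1 : F)))
  have h3 : ∀ x : ({(0)}ᶜ : Set F), (((homeomorphUnitSphereProd F x).2 : ℝ) •
      ((homeomorphUnitSphereProd F x).1 : F)) = x := by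
    intro x
    have hx : ‖(x : F)‖ ≠ 0 := norm_ne_zero_iff.2 x.2
    simp [smul_smul, hx]
  have hm : Measurable (fun z : sphere (0 : F) 1 × Ioi (0 : ℝ) => Φ ((z.2 : ℝ) • (z.1 : F))) := by
    fun_prop
  rw [h1]
  simp only [h3] at h2
  rw [h2, lintegral_prod_symm _ hm.aemeasurable, volumeIoiPow,
    lintegral_withDensity_eq_lintegral_mul _ (by fun_prop) hm.lintegral_prod_left',
    ← lintegral_subtype_comap measurableSet_Ioi]
  rfl

theorem lintegral_fun_norm_eq (μ : Measure F) [μ.IsAddHaarMeasure]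
    {Φ : ℝ → ℝ≥0∞} (hΦ : Measurable Φ) :
    ∫⁻ x, Φ ‖x‖ ∂μ = μ.toSphere univ *
      ∫⁻ r in Ioi (0 : ℝ), ENNReal.ofReal (r ^ (Module.finrank ℝ F - 1)) * Φ r := by
  rw [lintegral_eq_lintegral_toSphere_prod μ (Φ := fun x => Φ ‖x‖) (by fun_prop),
    ← lintegral_const_mul _ (by fun_prop)]
  refine setLIntegral_congr_fun measurableSet_Ioi fun r hr => ?_
  have hr' : |r| = r := abs_of_pos hr
  simp only [norm_smul, Real.norm_eq_abs, hr', norm_eq_of_mem_sphere, mul_one, lintegral_const]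
  ring

end Polar

theorem lintegral_unit_interval_pow (n : ℕ) :
    ∫⁻ r in Ioi (0 : ℝ), ENNReal.ofReal (r ^ n) * (Iio (1 : ℝ)).indicator 1 r =
      ENNReal.ofReal (1 / (n + 1)) := by
  have : ∀ r : ℝ, ENNReal.ofReal (r ^ n) * (Iio (1 : ℝ)).indicator 1 r =
      (Iio (1 : ℝ)).indicator (fun r => ENNReal.ofReal (r ^ n)) r := by
    intro r; by_cases h : r ∈ Iio (1 : ℝ) <;> simp [h]
  simp_rw [this]
  rw [setLIntegral_indicator measurableSet_Iio, Iio_inter_Ioi, restrict_Ioo_eq_restrict_Ioc,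
    ← ofReal_integral_eq_lintegral_ofReal,
    ← intervalIntegral.integral_of_le zero_le_one]
  · simp
  · exact ((continuous_pow n).intervalIntegrable 0 1).1
  · filter_upwards [ae_restrict_mem measurableSet_Ioc] with r hr using pow_nonneg hr.1.le n

/-- Integration over `ℝ × ℝ^n` of a function of the first coordinate and the norm of the second. -/
theorem lintegral_euclidean_succ {n : ℕ} {Φ : ℝ → ℝ → ℝ≥0∞}
    (hΦ : Measurable (Function.uncurry Φ)) :
    ∫⁻ z : EuclideanSpace ℝ (Fin (n + 1)), Φ (z 0) (Real.sqrt (∑ i : Fin n, z i.succ ^ 2)) =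
      ∫⁻ a : ℝ, ∫⁻ w : EuclideanSpace ℝ (Fin n), Φ a ‖w‖ := by
  have h0 := (EuclideanSpace.volume_preserving_symm_measurableEquiv_toLp (Fin (n+1)))
  have h1 := volume_preserving_piFinSuccAbove (fun _ : Fin (n + 1) => ℝ) 0
  have hn := (EuclideanSpace.volume_preserving_symm_measurableEquiv_toLp (Fin n))
  have hm : Measurable fun w : Fin n → ℝ => Real.sqrt (∑ i : Fin n, w i ^ 2) := by fun_prop
  have e1 : ∫⁻ z : EuclideanSpace ℝ (Fin (n + 1)), Φ (z 0) (Real.sqrt (∑ i : Fin n, z i.succ ^ 2))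
      = ∫⁻ z : Fin (n + 1) → ℝ, Φ (z 0) (Real.sqrt (∑ i : Fin n, z i.succ ^ 2)) := by
    rw [← h0.lintegral_comp_emb (MeasurableEquiv.measurableEmbedding _)]
    rfl
  have e2 : ∫⁻ z : Fin (n + 1) → ℝ, Φ (z 0) (Real.sqrt (∑ i : Fin n, z i.succ ^ 2))
      = ∫⁻ z : ℝ × (Fin n → ℝ), Φ z.1 (Real.sqrt (∑ i : Fin n, z.2 i ^ 2)) := by
    rw [← h1.lintegral_comp_emb (MeasurableEquiv.measurableEmbedding _)]
    rfl
  rw [e1, e2, Measure.volume_eq_prod, lintegral_prod _ (by fun_prop)]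
  refine lintegral_congr fun a => ?_
  rw [← hn.lintegral_comp_emb (MeasurableEquiv.measurableEmbedding _)]
  refine lintegral_congr fun w => ?_
  simp only [EuclideanSpace.norm_eq, Real.norm_eq_abs, sq_abs]
  rfl

end SphericalMaximal
end

noncomputable section
namespace SphericalMaximal

/-! ### The distribution of a coordinate on the sphere -/

section SphereLaw
open Metric Measure

/-- Integrating the extension of `h` that is homogeneous of degree zero over the unit ball costs
only `∫₀¹ r^(dim-1) dr = 1/dim`. This transfers properties of Lebesgue measure, such as invariance
under isometries, to the sphere. -/
theorem lintegral_toSphere_eq {F : Type*} [NormedAddCommGroup F] [NormedSpace ℝ F]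
    [MeasurableSpace F] [BorelSpace F] [FiniteDimensional ℝ F] [Nontrivial F]
    (μ : Measure F) [μ.IsAddHaarMeasure] {h : F → ℝ≥0∞} (hh : Measurable h) :
    ∫⁻ y : sphere (0 : F) 1, h y ∂μ.toSphere =
      Module.finrank ℝ F * ∫⁻ z, h (‖z‖⁻¹ • z) * (Iio (1 : ℝ)).indicator 1 ‖z‖ ∂μ := by
  have hind : Measurable ((Iio (1 : ℝ)).indicator (1 : ℝ → ℝ≥0∞)) :=
    measurable_one.indicator measurableSet_Iio
  rw [lintegral_eq_lintegral_toSphere_prod μ (by fun_prop)]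
  have : ∀ r ∈ Ioi (0 : ℝ), ENNReal.ofReal (r ^ (Module.finrank ℝ F - 1)) *
      ∫⁻ y : sphere (0 : F) 1, h (‖r • (y : F)‖⁻¹ • r • (y : F)) *
        (Iio (1 : ℝ)).indicator 1 ‖r • (y : F)‖ ∂μ.toSphere =
      ENNReal.ofReal (r ^ (Module.finrank ℝ F - 1)) * (Iio (1 : ℝ)).indicator 1 r *
        ∫⁻ y : sphere (0 : F) 1, h y ∂μ.toSphere := by
    intro r hr
    have hr' : |r| = r := abs_of_pos hr
    have hr0 : r ≠ 0 := ne_of_gt hr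
    simp only [norm_smul, Real.norm_eq_abs, hr', norm_eq_of_mem_sphere, mul_one, smul_smul,
      inv_mul_cancel₀ hr0, one_smul]
    rw [lintegral_mul_const _ (by fun_prop)]
    ring
  rw [setLIntegral_congr_fun measurableSet_Ioi this, lintegral_mul_const _ (by fun_prop),
    lintegral_unit_interval_pow, ← mul_assoc]
  have hpos : 0 < Module.finrank ℝ F := Module.finrank_pos
  have hc : ((Module.finrank ℝ F - 1 : ℕ) : ℝ) + 1 = Module.finrank ℝ F := by
    rw [Nat.cast_pred hpos]; ring
  rw [hc, ← ENNReal.ofReal_natCast, ← ENNReal.ofReal_mul (by positivity),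
    mul_one_div_cancel (by positivity)]
  simp

theorem lintegral_toSphere_isometry {n : ℕ}
    (U : EuclideanSpace ℝ (Fin (n + 1)) ≃ₗᵢ[ℝ] EuclideanSpace ℝ (Fin (n + 1)))
    {h : EuclideanSpace ℝ (Fin (n + 1)) → ℝ≥0∞} (hh : Measurable h) :
    ∫⁻ y : sphere (0 : EuclideanSpace ℝ (Fin (n + 1))) 1, h (U y) ∂volume.toSphere =
      ∫⁻ y : sphere (0 : EuclideanSpace ℝ (Fin (n + 1))) 1, h y ∂volume.toSphere := by
  have hU : Measurable U := U.continuous.measurable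
  rw [lintegral_toSphere_eq _ hh, lintegral_toSphere_eq _ (h := fun y => h (U y)) (by fun_prop),
    ← U.measurePreserving.lintegral_comp_emb U.toHomeomorph.measurableEmbedding
      (fun z => h (‖z‖⁻¹ • z) * (Iio (1 : ℝ)).indicator 1 ‖z‖)]
  simp

/-- Split the ambient space as `ℝ × ℝ^n`. Polar coordinates in `ℝ^n` produce `ρ^(n-1)`, and planar
polar coordinates in `(a, ρ)` then turn the first coordinate into `cos θ` with density `sin^(n-1)
θ`. The radial integral `1/(n+1)` cancels the dimension factor. -/
theorem lintegral_toSphere_coord {n : ℕ} (hn : 1 ≤ n) {ψ : ℝ → ℝ≥0∞} (hψ : Measurable ψ) :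
    ∫⁻ y : sphere (0 : EuclideanSpace ℝ (Fin (n + 1))) 1,
        ψ ((y : EuclideanSpace ℝ (Fin (n + 1))) 0) ∂volume.toSphere =
      (volume : Measure (EuclideanSpace ℝ (Fin n))).toSphere univ *
        ∫⁻ θ in Ioo 0 Real.pi, ENNReal.ofReal (Real.sin θ ^ (n - 1)) * ψ (Real.cos θ) := by
  have : Nonempty (Fin n) := ⟨⟨0, hn⟩⟩
  have hind : Measurable ((Iio (1 : ℝ)).indicator (1 : ℝ → ℝ≥0∞)) :=
    measurable_one.indicator measurableSet_Iio
  set c := (volume : Measure (EuclideanSpace ℝ (Fin n))).toSphere univ with hc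
  set Φ : ℝ → ℝ → ℝ≥0∞ := fun a ρ => ψ ((Real.sqrt (a ^ 2 + ρ ^ 2))⁻¹ * a) *
    (Iio (1 : ℝ)).indicator 1 (Real.sqrt (a ^ 2 + ρ ^ 2)) with hΦdef
  have hΦ : Measurable (Function.uncurry Φ) := by
    simp only [Function.uncurry_def, hΦdef]; fun_prop
  have hnorm : ∀ z : EuclideanSpace ℝ (Fin (n + 1)),
      ‖z‖ = Real.sqrt (z 0 ^ 2 + Real.sqrt (∑ i : Fin n, z i.succ ^ 2) ^ 2) := by
    intro z
    rw [Real.sq_sqrt (by positivity), EuclideanSpace.norm_eq, Fin.sum_univ_succ]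
    simp
  have h1 : ∀ z : EuclideanSpace ℝ (Fin (n + 1)),
      ψ ((‖z‖⁻¹ • z) 0) * (Iio (1 : ℝ)).indicator 1 ‖z‖ =
        Φ (z 0) (Real.sqrt (∑ i : Fin n, z i.succ ^ 2)) := by
    intro z
    simp only [hΦdef, ← hnorm, PiLp.smul_apply, smul_eq_mul]
  have h2 : ∫⁻ a : ℝ, ∫⁻ w : EuclideanSpace ℝ (Fin n), Φ a ‖w‖ =
      c * ∫⁻ z : ℝ × ℝ, (Ioi (0 : ℝ)).indicator
        (fun ρ => ENNReal.ofReal (ρ ^ (n - 1)) * Φ z.1 ρ) z.2 := by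
    have hm : Measurable fun z : ℝ × ℝ => (Ioi (0 : ℝ)).indicator
        (fun ρ => ENNReal.ofReal (ρ ^ (n - 1)) * Φ z.1 ρ) z.2 := by
      have : (fun z : ℝ × ℝ => (Ioi (0 : ℝ)).indicator
        (fun ρ => ENNReal.ofReal (ρ ^ (n - 1)) * Φ z.1 ρ) z.2) =
        (Prod.snd ⁻¹' Ioi (0 : ℝ)).indicator
          (fun z : ℝ × ℝ => ENNReal.ofReal (z.2 ^ (n - 1)) * Function.uncurry Φ z) := by
        ext z; by_cases h : 0 < z.2 <;> simp [indicator, h, Function.uncurry_def]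
      rw [this]
      exact Measurable.indicator (by fun_prop) (measurable_snd measurableSet_Ioi)
    rw [Measure.volume_eq_prod, lintegral_prod _ hm.aemeasurable,
      ← lintegral_const_mul _ hm.lintegral_prod_right']
    refine lintegral_congr fun a => ?_
    rw [lintegral_fun_norm_eq _ (Φ := Φ a) (hΦ.comp measurable_prodMk_left), finrank_euclideanSpace_fin,
      ← lintegral_indicator measurableSet_Ioi]
  rw [lintegral_toSphere_eq (volume : Measure (EuclideanSpace ℝ (Fin (n + 1))))
    (h := fun y => ψ (y 0)) (by fun_prop)]
  simp_rw [h1]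
  rw [lintegral_euclidean_succ hΦ, h2, ← lintegral_comp_polarCoord_symm]
  have h3 : ∀ z ∈ polarCoord.target, ENNReal.ofReal z.1 • (Ioi (0 : ℝ)).indicator
        (fun ρ => ENNReal.ofReal (ρ ^ (n - 1)) * Φ (polarCoord.symm z).1 ρ)
          (polarCoord.symm z).2 =
      (ENNReal.ofReal (z.1 ^ n) * (Iio (1 : ℝ)).indicator 1 z.1) *
        (Ioo 0 Real.pi).indicator
          (fun θ => ENNReal.ofReal (Real.sin θ ^ (n - 1)) * ψ (Real.cos θ)) z.2 := by
    rintro ⟨R, θ⟩ ⟨hR, hθ⟩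
    simp only [mem_Ioi] at hR
    have hs : Real.sqrt ((R * Real.cos θ) ^ 2 + (R * Real.sin θ) ^ 2) = R := by
      rw [mul_pow, mul_pow, ← mul_add, Real.cos_sq_add_sin_sq, mul_one, Real.sqrt_sq hR.le]
    simp only [polarCoord_symm_apply]
    by_cases h0 : 0 < θ
    · have hsin : 0 < Real.sin θ := Real.sin_pos_of_pos_of_lt_pi h0 hθ.2
      rw [indicator_of_mem (show R * Real.sin θ ∈ Ioi (0 : ℝ) from mul_pos hR hsin),
        indicator_of_mem (show θ ∈ Ioo 0 Real.pi from ⟨h0, hθ.2⟩)]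
      simp only [hΦdef, hs, inv_mul_cancel_left₀ hR.ne', smul_eq_mul]
      have : R ^ n = R * R ^ (n - 1) := by
        rw [← pow_succ', Nat.sub_add_cancel hn]
      rw [this, mul_pow, ENNReal.ofReal_mul hR.le, ENNReal.ofReal_mul (by positivity)]
      ring
    · have hsin : Real.sin θ ≤ 0 := Real.sin_nonpos_of_nonpos_of_neg_pi_le (not_lt.1 h0) hθ.1.le
      rw [indicator_of_notMem (show ¬ R * Real.sin θ ∈ Ioi (0 : ℝ) from
          not_lt.2 (mul_nonpos_of_nonneg_of_nonpos hR.le hsin)),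
        indicator_of_notMem (s := Ioo 0 Real.pi) (fun h => h0 h.1)]
      simp
  rw [setLIntegral_congr_fun polarCoord.open_target.measurableSet h3, polarCoord_target,
    Measure.volume_eq_prod, ← Measure.prod_restrict,
    lintegral_prod_mul (f := fun R : ℝ => ENNReal.ofReal (R ^ n) * (Iio (1 : ℝ)).indicator 1 R)
      (by fun_prop) (Measurable.aemeasurable (Measurable.indicator (by fun_prop)
        measurableSet_Ioo)), lintegral_unit_interval_pow,
    lintegral_indicator measurableSet_Ioo, Measure.restrict_restrict measurableSet_Ioo,
    inter_eq_left.2 (Ioo_subset_Ioo_left (by linarith [Real.pi_pos])), finrank_euclideanSpace_fin,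
    ← mul_assoc, ← mul_assoc, mul_right_comm, ← ENNReal.ofReal_natCast]
  push_cast
  have : ENNReal.ofReal ((n : ℝ) + 1) * ENNReal.ofReal (1 / (n + 1)) = 1 := by
    rw [← ENNReal.ofReal_mul (by positivity), mul_one_div_cancel (by positivity),
      ENNReal.ofReal_one]
  rw [mul_right_comm, mul_right_comm (ENNReal.ofReal _), this, one_mul]

end SphereLaw

end SphericalMaximal
end

noncomputable section
namespace SphericalMaximal

/-! ### Spherical means of radial functions -/

/-- The density, up to a constant factor, of the distribution of `‖x - t y‖` for `‖x‖ = r` and `y`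
uniformly distributed on the unit sphere of `ℝ^d`. -/
def sphericalKernel (d : ℕ) (t r s : ℝ) : ℝ :=
  s / (r * t) * (Real.sqrt ((s ^ 2 - (r - t) ^ 2) * ((r + t) ^ 2 - s ^ 2)) / (2 * r * t)) ^ (d - 3)

/-- The constant normalizing `sphericalKernel`. -/
def kernelConst (d : ℕ) : ℝ≥0∞ :=
  ((volume : Measure (EuclideanSpace ℝ (Fin d))).toSphere univ)⁻¹ *
    (volume : Measure (EuclideanSpace ℝ (Fin (d - 1)))).toSphere univ

/-- The mean of a radial function with profile `Φ` over a sphere of radius `t`, at distance `r` from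
the origin. -/
def radialMean (d : ℕ) (Φ : ℝ → ℝ≥0∞) (t r : ℝ) : ℝ≥0∞ :=
  kernelConst d * ∫⁻ s in Ioo |r - t| (r + t), ENNReal.ofReal (sphericalKernel d t r s) * Φ s

theorem toSphere_univ_ne_zero {d : ℕ} (hd : 1 ≤ d) :
    (volume : Measure (EuclideanSpace ℝ (Fin d))).toSphere univ ≠ 0 := by
  have : Nonempty (Fin d) := ⟨⟨0, hd⟩⟩
  rw [ne_eq, Measure.measure_univ_eq_zero]
  exact Measure.toSphere_ne_zero _

theorem toSphere_univ_ne_top {d : ℕ} :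
    (volume : Measure (EuclideanSpace ℝ (Fin d))).toSphere univ ≠ ∞ := measure_ne_top _ _

theorem kernelConst_ne_zero {d : ℕ} (hd : 3 ≤ d) : kernelConst d ≠ 0 :=
  mul_ne_zero (ENNReal.inv_ne_zero.2 toSphere_univ_ne_top) (toSphere_univ_ne_zero (by omega))

theorem kernelConst_ne_top {d : ℕ} (hd : 3 ≤ d) : kernelConst d ≠ ∞ :=
  ENNReal.mul_ne_top (ENNReal.inv_ne_top.2 (toSphere_univ_ne_zero (by omega))) toSphere_univ_ne_top

/-- The third side of a triangle with sides `r`, `t` enclosing the angle `θ`. -/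
def thirdSide (r t θ : ℝ) : ℝ := Real.sqrt (r ^ 2 + t ^ 2 - 2 * r * t * Real.cos θ)

section ThirdSide
variable {r t : ℝ}

theorem thirdSide_radicand_pos (hr : 0 < r) (ht : 0 < t) {θ : ℝ} (hθ : θ ∈ Ioo 0 Real.pi) :
    0 < r ^ 2 + t ^ 2 - 2 * r * t * Real.cos θ := by
  have h1 : Real.cos θ < 1 := by
    rw [← Real.cos_zero]
    exact Real.cos_lt_cos_of_nonneg_of_le_pi le_rfl hθ.2.le hθ.1
  nlinarith [sq_nonneg (r - t), mul_pos hr ht]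

theorem image_thirdSide (hr : 0 < r) (ht : 0 < t) :
    thirdSide r t '' Ioo 0 Real.pi = Ioo |r - t| (r + t) := by
  have hrt := mul_pos hr ht
  ext s
  constructor
  · rintro ⟨θ, hθ, rfl⟩
    have h1 : Real.cos θ < 1 := by
      rw [← Real.cos_zero]
      exact Real.cos_lt_cos_of_nonneg_of_le_pi le_rfl hθ.2.le hθ.1
    have h2 : -1 < Real.cos θ := by
      rw [← Real.cos_pi]
      exact Real.cos_lt_cos_of_nonneg_of_le_pi hθ.1.le le_rfl hθ.2
    constructor
    · rw [← Real.sqrt_sq_eq_abs]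
      exact Real.sqrt_lt_sqrt (sq_nonneg _) (by nlinarith)
    · rw [thirdSide, Real.sqrt_lt' (by positivity)]
      nlinarith
  · rintro ⟨h1, h2⟩
    have hs : 0 ≤ s := (abs_nonneg _).trans h1.le
    have h1' : (r - t) ^ 2 < s ^ 2 := by
      rw [← sq_abs (r - t)]; exact pow_lt_pow_left₀ h1 (abs_nonneg _) two_ne_zero
    have h2' : s ^ 2 < (r + t) ^ 2 := pow_lt_pow_left₀ h2 hs two_ne_zero
    set u := (r ^ 2 + t ^ 2 - s ^ 2) / (2 * r * t) with hu
    have hu1 : u < 1 := by rw [hu, div_lt_one (by positivity)]; nlinarith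
    have hu2 : -1 < u := by rw [hu, lt_div_iff₀ (by positivity)]; nlinarith
    refine ⟨Real.arccos u, ⟨Real.arccos_pos.2 hu1, ?_⟩, ?_⟩
    · refine lt_of_le_of_ne (Real.arccos_le_pi u) fun h => ?_
      rw [Real.arccos_eq_pi] at h; linarith
    · rw [thirdSide, Real.cos_arccos hu2.le hu1.le, hu, mul_div_cancel₀ _ (by positivity),
        sub_sub_cancel, Real.sqrt_sq hs]

theorem injOn_thirdSide (hr : 0 < r) (ht : 0 < t) : InjOn (thirdSide r t) (Ioo 0 Real.pi) := by
  intro θ hθ θ' hθ' h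
  have h1 := (Real.sqrt_inj (thirdSide_radicand_pos hr ht hθ).le
    (thirdSide_radicand_pos hr ht hθ').le).1 h
  have h2 : Real.cos θ = Real.cos θ' := by
    have := (mul_pos hr ht).ne'
    have h3 : (r * t) * Real.cos θ = (r * t) * Real.cos θ' := by linarith
    exact mul_left_cancel₀ this h3
  exact Real.injOn_cos ⟨hθ.1.le, hθ.2.le⟩ ⟨hθ'.1.le, hθ'.2.le⟩ h2

theorem hasDerivAt_thirdSide (hr : 0 < r) (ht : 0 < t) {θ : ℝ} (hθ : θ ∈ Ioo 0 Real.pi) :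
    HasDerivAt (thirdSide r t) (r * t * Real.sin θ / thirdSide r t θ) θ := by
  have h := ((((Real.hasDerivAt_cos θ).const_mul (2 * r * t)).const_sub (r ^ 2 + t ^ 2)).sqrt
    (thirdSide_radicand_pos hr ht hθ).ne')
  refine h.congr_deriv ?_
  have : Real.sqrt (r ^ 2 + t ^ 2 - 2 * r * t * Real.cos θ) ≠ 0 :=
    (Real.sqrt_pos.2 (thirdSide_radicand_pos hr ht hθ)).ne'
  simp only [thirdSide]
  field_simp

/-- Substitution by the law of cosines. By Heron's formula the square root in the kernel equals `2 r
t sin θ`, and the Jacobian `r t sin θ / s` uses up one of the `d - 2` sines. -/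
theorem lintegral_thirdSide (hr : 0 < r) (ht : 0 < t) {d : ℕ} (hd : 3 ≤ d)
    (Φ : ℝ → ℝ≥0∞) :
    ∫⁻ θ in Ioo 0 Real.pi, ENNReal.ofReal (Real.sin θ ^ (d - 2)) * Φ (thirdSide r t θ) =
      ∫⁻ s in Ioo |r - t| (r + t), ENNReal.ofReal (sphericalKernel d t r s) * Φ s := by
  rw [← image_thirdSide hr ht, lintegral_image_eq_lintegral_abs_deriv_mul measurableSet_Ioo
    (fun θ hθ => (hasDerivAt_thirdSide hr ht hθ).hasDerivWithinAt) (injOn_thirdSide hr ht)]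
  refine setLIntegral_congr_fun measurableSet_Ioo fun θ hθ => ?_
  have hsin : 0 < Real.sin θ := Real.sin_pos_of_pos_of_lt_pi hθ.1 hθ.2
  have hpos := thirdSide_radicand_pos hr ht hθ
  have hs : 0 < thirdSide r t θ := Real.sqrt_pos.2 hpos
  have hsq : thirdSide r t θ ^ 2 = r ^ 2 + t ^ 2 - 2 * r * t * Real.cos θ := Real.sq_sqrt hpos.le
  have hprod : (thirdSide r t θ ^ 2 - (r - t) ^ 2) * ((r + t) ^ 2 - thirdSide r t θ ^ 2) =
      (2 * r * t * Real.sin θ) ^ 2 := by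
    rw [hsq]
    linear_combination (-(4 * r ^ 2 * t ^ 2)) * (Real.sin_sq_add_cos_sq θ)
  rw [← mul_assoc, ← ENNReal.ofReal_mul (abs_nonneg _), sphericalKernel, hprod,
    Real.sqrt_sq (by positivity), abs_of_pos (by positivity),
    mul_div_cancel_left₀ _ (by positivity : (2 * r * t) ≠ 0)]
  congr 2
  have : d - 2 = (d - 3) + 1 := by omega
  rw [this, pow_succ]
  field_simp

end ThirdSide

theorem lintegral_sphereMeasure_norm_sub {d : ℕ} (hd : 3 ≤ d) {Φ : ℝ → ℝ≥0∞} (hΦ : Measurable Φ)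
    {x : EuclideanSpace ℝ (Fin d)} (hx : x ≠ 0) {t : ℝ} (ht : 0 < t) :
    ∫⁻ y, Φ ‖x - t • (y : EuclideanSpace ℝ (Fin d))‖ ∂(sphereMeasure d) =
      radialMean d Φ t ‖x‖ := by
  obtain ⟨n, rfl⟩ : ∃ n, d = n + 1 := ⟨d - 1, by omega⟩
  have hr : 0 < ‖x‖ := norm_pos_iff.2 hx
  set e : EuclideanSpace ℝ (Fin (n + 1)) := EuclideanSpace.single 0 ‖x‖ with he
  have hen : ‖x‖ = ‖e‖ := by simp [he]
  -- The reflection exchanging the vectors `x` and `e` of equal norm puts the centre on the first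
  -- axis.
  set U := (Submodule.span ℝ {x - e})ᗮ.reflection with hU
  have hUx : U x = e := Submodule.reflection_sub hen
  have h1 : ∫⁻ y : Metric.sphere (0 : EuclideanSpace ℝ (Fin (n + 1))) 1,
      Φ ‖x - t • (y : EuclideanSpace ℝ (Fin (n + 1)))‖ ∂volume.toSphere =
      ∫⁻ y : Metric.sphere (0 : EuclideanSpace ℝ (Fin (n + 1))) 1,
      Φ ‖e - t • (y : EuclideanSpace ℝ (Fin (n + 1)))‖ ∂volume.toSphere := by
    rw [← lintegral_toSphere_isometry U (h := fun y => Φ ‖e - t • y‖) (by fun_prop)]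
    refine lintegral_congr fun y => ?_
    rw [← hUx, ← map_smul, ← map_sub, LinearIsometryEquiv.norm_map]
  have h2 : ∀ y : Metric.sphere (0 : EuclideanSpace ℝ (Fin (n + 1))) 1,
      ‖e - t • (y : EuclideanSpace ℝ (Fin (n + 1)))‖ =
      Real.sqrt (‖x‖ ^ 2 + t ^ 2 - 2 * ‖x‖ * t * (y : EuclideanSpace ℝ (Fin (n + 1))) 0) := by
    intro y
    have hy : ‖(y : EuclideanSpace ℝ (Fin (n + 1)))‖ = 1 := norm_eq_of_mem_sphere y
    have : ‖e - t • (y : EuclideanSpace ℝ (Fin (n + 1)))‖ ^ 2 =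
        ‖x‖ ^ 2 + t ^ 2 - 2 * ‖x‖ * t * (y : EuclideanSpace ℝ (Fin (n + 1))) 0 := by
      rw [@norm_sub_sq_real, ← hen, norm_smul, inner_smul_right, he,
        EuclideanSpace.inner_single_left, hy, Real.norm_eq_abs, mul_one, sq_abs]
      simp
      ring
    rw [← this, Real.sqrt_sq (norm_nonneg _)]
  rw [sphereMeasure, lintegral_smul_measure, h1]
  simp_rw [h2]
  rw [lintegral_toSphere_coord (by omega)
    (ψ := fun u => Φ (Real.sqrt (‖x‖ ^ 2 + t ^ 2 - 2 * ‖x‖ * t * u))) (by fun_prop)]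
  have := lintegral_thirdSide hr ht hd Φ
  simp only [thirdSide] at this
  rw [radialMean, ← this, kernelConst, smul_eq_mul, mul_assoc (_)⁻¹]
  rfl

end SphericalMaximal
end

noncomputable section
namespace SphericalMaximal

/-! ### Replacing a radial function by a Borel profile. -/

theorem quasiMeasurePreserving_norm {d : ℕ} (hd : 1 ≤ d) :
    Measure.QuasiMeasurePreserving (fun x : EuclideanSpace ℝ (Fin d) => ‖x‖) volume
      (volume.restrict (Ioi 0)) := by
  have : Nonempty (Fin d) := ⟨⟨0, hd⟩⟩
  refine ⟨measurable_norm, Measure.AbsolutelyContinuous.mk fun s hs h0 => ?_⟩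
  rw [Measure.map_apply measurable_norm hs, ← lintegral_indicator_one (measurable_norm hs)]
  have h1 : ∀ x : EuclideanSpace ℝ (Fin d), ((fun x => ‖x‖) ⁻¹' s).indicator 1 x =
      s.indicator (1 : ℝ → ℝ≥0∞) ‖x‖ := fun x => rfl
  simp_rw [h1]
  rw [lintegral_fun_norm_eq _ (measurable_one.indicator hs)]
  have h2 : ∀ᵐ r ∂(volume.restrict (Ioi (0 : ℝ))), r ∉ s := by
    rw [ae_iff]; simpa using h0
  rw [lintegral_congr_ae (g := 0) (h2.mono fun r hr => by simp [hr])]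
  simp

/-- A maximal function takes a supremum over possibly uncountably many radii, so changing the
profile on a null set must be harmless on every single sphere. It is, because the law of the
distance has a density whenever the centre is not the origin. -/
theorem quasiMeasurePreserving_norm_sub {d : ℕ} (hd : 3 ≤ d)
    {x : EuclideanSpace ℝ (Fin d)} (hx : x ≠ 0) {t : ℝ} (ht : 0 < t) :
    Measure.QuasiMeasurePreserving
      (fun y : Metric.sphere (0 : EuclideanSpace ℝ (Fin d)) 1 =>
        ‖x - t • (y : EuclideanSpace ℝ (Fin d))‖) (sphereMeasure d)
      (volume.restrict (Ioi 0)) := by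
  have hm : Measurable (fun y : Metric.sphere (0 : EuclideanSpace ℝ (Fin d)) 1 =>
        ‖x - t • (y : EuclideanSpace ℝ (Fin d))‖) := by fun_prop
  refine ⟨hm, Measure.AbsolutelyContinuous.mk fun s hs h0 => ?_⟩
  rw [Measure.map_apply hm hs, ← lintegral_indicator_one (hm hs)]
  have h1 : ∀ y : Metric.sphere (0 : EuclideanSpace ℝ (Fin d)) 1,
      ((fun y : Metric.sphere (0 : EuclideanSpace ℝ (Fin d)) 1 =>
        ‖x - t • (y : EuclideanSpace ℝ (Fin d))‖) ⁻¹' s).indicator 1 y =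
      s.indicator (1 : ℝ → ℝ≥0∞) ‖x - t • (y : EuclideanSpace ℝ (Fin d))‖ := fun x => rfl
  simp_rw [h1]
  rw [lintegral_sphereMeasure_norm_sub hd (measurable_one.indicator hs) hx ht, radialMean]
  have h2 : ∀ᵐ r ∂(volume.restrict (Ioo |‖x‖ - t| (‖x‖ + t))), r ∉ s := by
    refine ae_mono (Measure.restrict_mono (s' := Ioi 0)
      (fun r (hr : r ∈ Ioo _ _) => (abs_nonneg _).trans_lt hr.1) le_rfl) ?_
    change ∀ᵐ r ∂(volume.restrict (Ioi (0 : ℝ))), r ∉ s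
    rw [ae_iff]; simpa using h0
  rw [lintegral_congr_ae (g := 0) (h2.mono fun r hr => by simp [hr])]
  simp

/-- In polar coordinates the function depends only on the radial factor, and measurability descends
to that factor because the measure of the sphere is not zero. The weight `r^(d-1)` is positive, so
it can be dropped. -/
theorem aestronglyMeasurable_profile {d : ℕ} (hd : 1 ≤ d) {g : ℝ → ℂ}
    (hg : AEStronglyMeasurable (fun x : EuclideanSpace ℝ (Fin d) => g ‖x‖) volume) :
    AEStronglyMeasurable g (volume.restrict (Ioi 0)) := by
  have : Nonempty (Fin d) := ⟨⟨0, hd⟩⟩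
  have h0 : MeasurableSet ({(0)}ᶜ : Set (EuclideanSpace ℝ (Fin d))) :=
    (measurableSet_singleton _).compl
  have h1 : AEStronglyMeasurable (fun x : ({(0)}ᶜ : Set (EuclideanSpace ℝ (Fin d))) =>
      g ‖(x : EuclideanSpace ℝ (Fin d))‖) (Measure.comap Subtype.val volume) := by
    have := hg.restrict (s := ({(0)}ᶜ : Set (EuclideanSpace ℝ (Fin d))))
    rw [← map_comap_subtype_coe h0,
      (MeasurableEmbedding.subtype_coe h0).aestronglyMeasurable_map_iff] at this
    exact this
  have h2 : AEStronglyMeasurable (fun r : Ioi (0 : ℝ) => g r) (Measure.volumeIoiPow (d - 1)) := by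
    have hp := (volume : Measure (EuclideanSpace ℝ (Fin d))).measurePreserving_homeomorphUnitSphereProd
    have := (hp.aestronglyMeasurable_comp_iff (Homeomorph.measurableEmbedding _)
      (g := fun z : Metric.sphere (0 : EuclideanSpace ℝ (Fin d)) 1 × Ioi (0 : ℝ) =>
        g z.2)).1 (by simpa [Function.comp_def] using h1)
    rw [finrank_euclideanSpace_fin] at this
    exact (AEStronglyMeasurable.comp_snd_iff (f := fun r : Ioi (0 : ℝ) => g r)
      (Measure.toSphere_ne_zero _)).1 this
  have h3 : AEStronglyMeasurable (fun r : Ioi (0 : ℝ) => g r) (Measure.comap Subtype.val volume) := by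
    refine h2.mono_ac (withDensity_absolutelyContinuous' (by fun_prop) ?_)
    exact .of_forall fun r => by simpa using pow_pos r.2 _
  rw [← map_comap_subtype_coe measurableSet_Ioi,
    (MeasurableEmbedding.subtype_coe measurableSet_Ioi).aestronglyMeasurable_map_iff]
  exact h3

/-- The spherical means of a radial function in `L^p` are dominated by the means of a measurable
profile. -/
theorem exists_measurable_profile {d : ℕ} (hd : 3 ≤ d) {p : ℝ} (hp : 0 < p)
    {f : EuclideanSpace ℝ (Fin d) → ℂ} (hf : IsRadial f)
    (hfp : MemLp f (ENNReal.ofReal p) volume) :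
    ∃ G : ℝ → ℝ≥0∞, Measurable G ∧
      eLpNorm f (ENNReal.ofReal p) volume ^ p =
        (volume : Measure (EuclideanSpace ℝ (Fin d))).toSphere univ *
          ∫⁻ s in Ioi (0 : ℝ), ENNReal.ofReal (s ^ (d - 1)) * G s ^ p ∧
      ∀ x, x ≠ 0 → ∀ t, 0 < t → absSphericalMean t f x ≤ radialMean d G t ‖x‖ := by
  have hne : Nonempty (Fin d) := ⟨⟨0, by omega⟩⟩
  set f₀ : ℝ → ℂ := fun s => f (EuclideanSpace.single ⟨0, by omega⟩ s) with hf₀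
  have hff₀ : ∀ x, f x = f₀ ‖x‖ := fun x => hf _ _ (by simp)
  have hm : AEStronglyMeasurable f₀ (volume.restrict (Ioi 0)) := by
    refine aestronglyMeasurable_profile (d := d) (by omega) ?_
    simpa only [← hff₀] using hfp.1
  refine ⟨fun s => ‖hm.mk f₀ s‖ₑ, hm.stronglyMeasurable_mk.measurable.enorm, ?_, ?_⟩
  · have hae := (quasiMeasurePreserving_norm (d := d) (by omega)).ae_eq_comp hm.ae_eq_mk
    rw [eLpNorm_eq_lintegral_rpow_enorm_toReal (by simpa using hp) (by simp),
      ENNReal.toReal_ofReal hp.le, ← ENNReal.rpow_mul, one_div, inv_mul_cancel₀ hp.ne',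
      ENNReal.rpow_one]
    have := lintegral_fun_norm_eq (volume : Measure (EuclideanSpace ℝ (Fin d)))
      (Φ := fun s => ‖hm.mk f₀ s‖ₑ ^ p)
      (hm.stronglyMeasurable_mk.measurable.enorm.pow_const _)
    rw [finrank_euclideanSpace_fin] at this
    rw [← this]
    refine lintegral_congr_ae (hae.mono fun x hx => ?_)
    simp only [Function.comp_apply] at hx
    simp only [hff₀, hx]
  · intro x hx t ht
    have hq := quasiMeasurePreserving_norm_sub hd hx ht
    have hae := hq.ae_eq_comp hm.ae_eq_mk
    have hsm : AEStronglyMeasurable (fun y : Metric.sphere (0 : EuclideanSpace ℝ (Fin d)) 1 =>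
        f (x - t • (y : EuclideanSpace ℝ (Fin d)))) (sphereMeasure d) := by
      simp only [hff₀]
      exact hm.comp_quasiMeasurePreserving hq
    have hlin : ∫⁻ y, ‖f (x - t • (y : EuclideanSpace ℝ (Fin d)))‖ₑ ∂(sphereMeasure d) =
        radialMean d (fun s => ‖hm.mk f₀ s‖ₑ) t ‖x‖ := by
      rw [← lintegral_sphereMeasure_norm_sub hd hm.stronglyMeasurable_mk.measurable.enorm hx ht]
      refine lintegral_congr_ae (hae.mono fun y hy => ?_)
      simp only [Function.comp_apply] at hy
      simp only [hff₀, hy]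
    rw [← hlin, absSphericalMean]
    split_ifs with h
    · exact enorm_integral_le_lintegral_enorm _
    -- Measurability along the sphere is known, so integrability can fail only through an infinite
    -- integral. The convention `∞` therefore never exceeds the mean of the profile.
    · by_contra hlt
      exact h ⟨hsm, by simpa [HasFiniteIntegral, lt_top_iff_ne_top] using hlt⟩

/-- The spherical means of a nonnegative radial function with measurable profile. -/
theorem radialMean_le_absSphericalMean {d : ℕ} (hd : 3 ≤ d) {g : ℝ → ℝ} (hg : Measurable g)
    (hg0 : ∀ s, 0 ≤ g s) {x : EuclideanSpace ℝ (Fin d)} (hx : x ≠ 0) {t : ℝ} (ht : 0 < t) :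
    radialMean d (fun s => ENNReal.ofReal (g s)) t ‖x‖ ≤
      absSphericalMean t (fun z => (g ‖z‖ : ℂ)) x := by
  rw [absSphericalMean]
  split_ifs with h
  · rw [← lintegral_sphereMeasure_norm_sub hd (by fun_prop) hx ht, sphericalMean,
      integral_complex_ofReal, ← ofReal_integral_eq_lintegral_ofReal _ (.of_forall fun _ => hg0 _)]
    · rw [← ofReal_norm, Complex.norm_real]
      exact ENNReal.ofReal_le_ofReal (le_abs_self _)
    · simpa using h.re
  · exact le_top

end SphericalMaximal
end

noncomputable section
namespace SphericalMaximal

/-! ### Elementary sums -/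

/-- The sum of the geometric series of ratio `2 ^ (-a)`. -/
def geomConst (a : ℝ) : ℝ≥0∞ := (1 - 2 ^ (-a))⁻¹

theorem geomConst_ne_top {a : ℝ} (ha : 0 < a) : geomConst a ≠ ∞ := by
  rw [geomConst, ENNReal.inv_ne_top]
  have : (2 : ℝ≥0∞) ^ (-a) < 1 := ENNReal.rpow_lt_one_of_one_lt_of_neg (by norm_num) (by linarith)
  exact (tsub_pos_of_lt this).ne'

theorem tsum_geometric_rpow (a : ℝ) : ∑' i : ℕ, (2 : ℝ≥0∞) ^ (-(a * i)) = geomConst a := by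
  rw [geomConst, ← ENNReal.tsum_geometric]
  congr 1; ext i
  rw [← ENNReal.rpow_natCast, ← ENNReal.rpow_mul, neg_mul]

/-- The geometric progression with ratio two and scale `c`. -/
def dyadicScale (c : ℝ≥0) (m : ℤ) : ℝ≥0 := c * 2 ^ m

theorem dyadicScale_pos {c : ℝ≥0} (hc : 0 < c) (m : ℤ) : 0 < dyadicScale c m := by
  unfold dyadicScale; positivity

/-- A geometric series is dominated by its largest term. This is used whenever a sum over dyadic
heights has to be carried out at a fixed point, where `X` may be infinite. -/
theorem tsum_dyadicScale_rpow_le {a : ℝ} (ha : 0 < a) {c : ℝ≥0} (hc : 0 < c) (X : ℝ≥0∞) :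
    ∑' m : ℤ, (if (dyadicScale c m : ℝ≥0∞) < X then (dyadicScale c m : ℝ≥0∞) ^ a else 0) ≤
      geomConst a * X ^ a := by
  rcases eq_or_ne X ∞ with rfl | hX
  · rw [ENNReal.top_rpow_of_pos ha, ENNReal.mul_top]
    · exact le_top
    · simp [geomConst]
  lift X to ℝ≥0 using hX
  rcases eq_or_ne X 0 with rfl | hX0
  · simp
  obtain ⟨M, hM1, hM2⟩ : ∃ M : ℤ, dyadicScale c M < X ∧ X ≤ dyadicScale c (M + 1) := by
    obtain ⟨M, h1, h2⟩ := exists_mem_Ioc_zpow (x := (X : ℝ) / c) (y := 2)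
      (by have := pos_iff_ne_zero.2 hX0; positivity) (by norm_num)
    have hc' : (0 : ℝ) < c := hc
    refine ⟨M, ?_, ?_⟩
    · rw [lt_div_iff₀ hc'] at h1
      rw [dyadicScale, ← NNReal.coe_lt_coe]; push_cast; linarith
    · rw [div_le_iff₀ hc'] at h2
      rw [dyadicScale, ← NNReal.coe_le_coe]; push_cast; linarith
  have hmono : ∀ {m m' : ℤ}, m ≤ m' → dyadicScale c m ≤ dyadicScale c m' := by
    intro m m' h
    unfold dyadicScale
    gcongr; norm_num
  have hinj : Function.Injective (fun i : ℕ => M - (i : ℤ)) := fun i j h => by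
    simpa using h
  rw [← hinj.tsum_eq]
  · have : ∀ i : ℕ, (if (dyadicScale c (M - i) : ℝ≥0∞) < X
        then (dyadicScale c (M - i) : ℝ≥0∞) ^ a else 0) ≤ (X : ℝ≥0∞) ^ a * 2 ^ (-(a * i)) := by
      intro i
      split_ifs
      · have h1 : (dyadicScale c (M - i) : ℝ≥0∞) = dyadicScale c M * 2 ^ (-(i : ℝ)) := by
          rw [dyadicScale, dyadicScale, zpow_sub₀ two_ne_zero, ENNReal.rpow_neg,
            ENNReal.rpow_natCast, div_eq_mul_inv, ← mul_assoc]
          push_cast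
          rw [ENNReal.coe_inv (by positivity)]
          simp
        rw [h1, ENNReal.mul_rpow_of_nonneg _ _ ha.le, ← ENNReal.rpow_mul]
        have : -(i : ℝ) * a = -(a * i) := by ring
        rw [this]
        gcongr
      · exact zero_le
    refine (ENNReal.tsum_le_tsum this).trans ?_
    rw [ENNReal.tsum_mul_left, tsum_geometric_rpow, mul_comm]
  · intro m hm
    have hlt : (dyadicScale c m : ℝ≥0∞) < X := by
      by_contra h; exact hm (if_neg h)
    have : m ≤ M := by
      by_contra h
      exact absurd (hM2.trans (hmono (by omega : M + 1 ≤ m))) (not_le.2 (by exact_mod_cast hlt))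
    exact ⟨(M - m).toNat, by simp; omega⟩

theorem rpow_sub_le_of_concave {β T y : ℝ} (hβ0 : 0 ≤ β) (hβ : β < 1) (hy : 0 ≤ y) (hyT : y ≤ T) :
    (1 - β) * ((T - y) * T ^ (-β)) + y ^ (1 - β) ≤ T ^ (1 - β) := by
  rcases eq_or_lt_of_le (hy.trans hyT) with h | hT
  · have : y = 0 := by linarith
    subst this; simp [← h]
  have hu := rpow_one_add_le_one_add_mul_self (s := y / T - 1)
    (by have := div_nonneg hy hT.le; linarith) (p := 1 - β) (by linarith) (by linarith)
  have e1 : (1 + (y / T - 1)) = y / T := by ring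
  rw [e1, Real.div_rpow hy hT.le, div_le_iff₀ (by positivity)] at hu
  have e2 : T ^ (1 - β) = T * T ^ (-β) := by
    rw [sub_eq_add_neg, Real.rpow_add hT, Real.rpow_one]
  have e3 : (1 + (1 - β) * (y / T - 1)) * (T * T ^ (-β)) =
      T * T ^ (-β) - (1 - β) * ((T - y) * T ^ (-β)) := by field_simp; ring
  rw [e2, e3] at hu
  rw [e2]; linarith

/-- The discrete form of `∫ S^(-β) dS = S^(1-β) / (1-β)`: by concavity each term is at most the
increment of `S^(1-β)` divided by `1 - β`, and the increments telescope. -/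
theorem sum_mul_partialSum_rpow_neg_le {ι : Type*} [LinearOrder ι] {β : ℝ} (hβ0 : 0 ≤ β)
    (hβ : β < 1) (K : Finset ι) (x : ι → ℝ≥0) :
    ∑ k ∈ K, (x k : ℝ) * (∑ k' ∈ K with k' ≤ k, (x k' : ℝ)) ^ (-β) ≤
      (1 - β)⁻¹ * (∑ k ∈ K, (x k : ℝ)) ^ (1 - β) := by
  rw [← div_eq_inv_mul, le_div_iff₀ (by linarith), mul_comm]
  induction K using Finset.induction_on_max with
  | empty => simp [Real.zero_rpow (by linarith : 1 - β ≠ 0)]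
  | insert a K hK ih =>
    have ha : a ∉ K := fun h => lt_irrefl _ (hK a h)
    rw [Finset.sum_insert ha]
    have h1 : (insert a K).filter (fun k' => k' ≤ a) = insert a K := by
      refine Finset.filter_true_of_mem fun k hk => ?_
      rcases Finset.mem_insert.1 hk with rfl | h
      · exact le_rfl
      · exact (hK k h).le
    have h2 : ∀ k ∈ K, (insert a K).filter (fun k' => k' ≤ k) = K.filter (fun k' => k' ≤ k) := by
      intro k hk
      rw [Finset.filter_insert, if_neg (not_le.2 (hK k hk))]
    have h3 : ∑ k ∈ K, (x k : ℝ) * (∑ k' ∈ insert a K with k' ≤ k, (x k' : ℝ)) ^ (-β) =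
        ∑ k ∈ K, (x k : ℝ) * (∑ k' ∈ K with k' ≤ k, (x k' : ℝ)) ^ (-β) :=
      Finset.sum_congr rfl fun k hk => by rw [h2 k hk]
    rw [h1, h3, Finset.sum_insert ha]
    have h4 : 0 ≤ ∑ k ∈ K, (x k : ℝ) := Finset.sum_nonneg fun _ _ => NNReal.coe_nonneg _
    have h5 := rpow_sub_le_of_concave hβ0 hβ h4
      (by linarith [(x a).coe_nonneg] : ∑ k ∈ K, (x k : ℝ) ≤ x a + ∑ k ∈ K, (x k : ℝ))
    rw [add_sub_cancel_right] at h5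
    linarith [mul_add (1 - β) ((x a : ℝ) * (x a + ∑ k ∈ K, (x k : ℝ)) ^ (-β))
      (∑ k ∈ K, (x k : ℝ) * (∑ k' ∈ K with k' ≤ k, (x k' : ℝ)) ^ (-β))]

/-- Summation against a negative power of an upper bound for the partial sums. -/
theorem sum_mul_rpow_neg_le {ι : Type*} [LinearOrder ι] {β : ℝ} (hβ0 : 0 ≤ β)
    (hβ : β < 1) (K : Finset ι) (x R : ι → ℝ≥0)
    (hR : ∀ k ∈ K, ∑ k' ∈ K with k' ≤ k, x k' ≤ R k) :
    ∑ k ∈ K, x k * R k ^ (-β) ≤ (1 - β).toNNReal⁻¹ * (∑ k ∈ K, x k) ^ (1 - β) := by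
  have h := sum_mul_partialSum_rpow_neg_le hβ0 hβ K x
  have h1 : ∑ k ∈ K, x k * R k ^ (-β) ≤
      ∑ k ∈ K, x k * (∑ k' ∈ K with k' ≤ k, x k') ^ (-β) := by
    refine Finset.sum_le_sum fun k hk => ?_
    rcases eq_or_ne (x k) 0 with h0 | h0
    · simp [h0]
    · have : 0 < ∑ k' ∈ K with k' ≤ k, x k' :=
        (pos_iff_ne_zero.2 h0).trans_le (Finset.single_le_sum (f := x)
          (fun _ _ => zero_le) (Finset.mem_filter.2 ⟨hk, le_rfl⟩))
      refine mul_le_mul_right ?_ _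
      rw [NNReal.rpow_neg, NNReal.rpow_neg]
      gcongr
      exact hR k hk
  refine h1.trans ?_
  rw [← NNReal.coe_le_coe]
  push_cast
  rw [Real.coe_toNNReal _ (by linarith)]
  exact h

theorem sum_mul_rpow_neg_le_of_ge {ι : Type*} [LinearOrder ι] {β : ℝ} (hβ0 : 0 ≤ β)
    (hβ : β < 1) (K : Finset ι) (x R : ι → ℝ≥0)
    (hR : ∀ k ∈ K, ∑ k' ∈ K with k ≤ k', x k' ≤ R k) :
    ∑ k ∈ K, x k * R k ^ (-β) ≤ (1 - β).toNNReal⁻¹ * (∑ k ∈ K, x k) ^ (1 - β) :=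
  sum_mul_rpow_neg_le (ι := ιᵒᵈ) hβ0 hβ K x R hR

end SphericalMaximal
end

noncomputable section
namespace SphericalMaximal

/-! ### Lacunary families of intervals of integers -/

theorem mul_sum_zpow_le (c : ℝ≥0) (K : Finset ℤ) (k : ℤ) (hK : ∀ k' ∈ K, k' < k) :
    c * ∑ k' ∈ K, (c + 1) ^ k' ≤ (c + 1) ^ k := by
  have hpos : 0 < c + 1 := by positivity
  induction K using Finset.induction_on_max generalizing k with
  | empty => simp
  | insert a K hKa ih =>
    rw [Finset.sum_insert (fun h => lt_irrefl _ (hKa a h)), mul_add]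
    calc c * (c + 1) ^ a + c * ∑ k' ∈ K, (c + 1) ^ k'
        ≤ c * (c + 1) ^ a + (c + 1) ^ a := by gcongr; exact ih a hKa
      _ = (c + 1) ^ (a + 1) := by rw [zpow_add₀ hpos.ne', zpow_one]; ring
      _ ≤ (c + 1) ^ k := by
        apply zpow_le_zpow_right₀ le_add_self
        have := hK a (Finset.mem_insert_self a K)
        omega

/-- The subtraction is truncated at zero. The running total `P` never exceeds the sum of the `b k`
already seen, so adding the next term gives at most `max (b a) P`. -/
theorem sum_tsub_partialSum_le_one {ι : Type*} [LinearOrder ι] (K : Finset ι) (b : ι → ℝ≥0)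
    (hb : ∀ k, b k ≤ 1) : ∑ k ∈ K, (b k - ∑ k' ∈ K with k' < k, b k') ≤ 1 := by
  induction K using Finset.induction_on_max with
  | empty => simp
  | insert a K hKa ih =>
    have ha : a ∉ K := fun h => lt_irrefl _ (hKa a h)
    have h1 : (insert a K).filter (fun k' => k' < a) = K := by
      rw [Finset.filter_insert, if_neg (lt_irrefl a), Finset.filter_true_of_mem hKa]
    have h2 : ∑ k ∈ K, (b k - ∑ k' ∈ insert a K with k' < k, b k') =
        ∑ k ∈ K, (b k - ∑ k' ∈ K with k' < k, b k') := by
      refine Finset.sum_congr rfl fun k hk => ?_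
      rw [Finset.filter_insert, if_neg (not_lt.2 (hKa k hk).le)]
    rw [Finset.sum_insert ha, h1, h2]
    set P := ∑ k ∈ K, (b k - ∑ k' ∈ K with k' < k, b k') with hP
    have h3 : P ≤ ∑ k ∈ K, b k := Finset.sum_le_sum fun k _ => tsub_le_self
    calc b a - ∑ k ∈ K, b k + P ≤ b a - P + P := by gcongr
      _ ≤ 1 := by
        rcases le_total P (b a) with h | h
        · rw [tsub_add_cancel_of_le h]; exact hb a
        · rw [tsub_eq_zero_of_le h, zero_add]; exact ih

/-- If the sums of `γ` over `A k` exceed a lacunary sequence `τ k`, then the family `A k` is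
essentially disjoint. -/
theorem sum_rpow_lacunary_le {p : ℝ} (hp : 1 ≤ p) (K : Finset ℤ) (A : ℤ → Finset ℤ)
    (γ τ M : ℤ → ℝ≥0) (B : Finset ℤ) (hAB : ∀ k ∈ K, A k ⊆ B)
    (hA : ∀ k ∈ K, τ k ≤ ∑ j ∈ A k, γ j)
    (hτ : ∀ k ∈ K, 3 * ∑ k' ∈ K with k' < k, τ k' ≤ τ k)
    (hM : ∀ k ∈ K, ((A k).card : ℝ≥0) ≤ M k) (hM0 : ∀ k ∈ K, 0 < M k) :
    ∑ k ∈ K, τ k ^ p * M k ^ (-(p - 1)) ≤ (3 / 2) ^ p * ∑ j ∈ B, γ j ^ p := by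
  -- The weights `b j k` cut `γ` down on `A k` until its sum is exactly `τ k`, and `φ k` removes
  -- from them what smaller indices already claim. The smaller levels total at most `τ k / 3`, so `φ
  -- k` keeps two thirds of the sum, while `∑ φ k j ≤ 1` over `k` gives bounded overlap. Hölder is
  -- applied for each `k` separately.
  set b : ℤ → ℤ → ℝ≥0 := fun j k =>
    if j ∈ A k then min 1 (τ k / ∑ j ∈ A k, γ j) else 0 with hb
  have hb1 : ∀ j k, b j k ≤ 1 := by
    intro j k; simp only [hb]; split_ifs
    · exact min_le_left _ _
    · exact zero_le
  set φ : ℤ → ℤ → ℝ≥0 := fun k j => b j k - ∑ k' ∈ K with k' < k, b j k' with hφ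
  have hφ1 : ∀ k j, φ k j ≤ 1 := fun k j => tsub_le_self.trans (hb1 j k)
  have hsum : ∀ k ∈ K, ∑ j ∈ A k, b j k * γ j = τ k := by
    intro k hk
    have h1 : ∑ j ∈ A k, b j k * γ j =
        min 1 (τ k / ∑ j ∈ A k, γ j) * ∑ j ∈ A k, γ j := by
      rw [Finset.mul_sum]
      exact Finset.sum_congr rfl fun j hj => by simp only [hb, if_pos hj]
    rw [h1]
    rcases eq_or_ne (∑ j ∈ A k, γ j) 0 with h0 | h0
    · have := hA k hk
      rw [h0] at this ⊢
      rw [mul_zero]; exact (le_antisymm this zero_le).symm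
    · rw [min_eq_right (div_le_one_of_le₀ (hA k hk) zero_le), div_mul_cancel₀ _ h0]
  have hsum' : ∀ k, ∀ k' ∈ K, ∑ j ∈ A k, b j k' * γ j ≤ τ k' := by
    intro k k' hk'
    rw [← hsum k' hk', ← Finset.sum_filter_add_sum_filter_not (A k) (· ∈ A k')]
    have h0 : ∑ j ∈ A k with j ∉ A k', b j k' * γ j = 0 := by
      refine Finset.sum_eq_zero fun j hj => ?_
      simp only [hb, if_neg (Finset.mem_filter.1 hj).2, zero_mul]
    rw [h0, add_zero]
    refine Finset.sum_le_sum_of_subset fun j hj => (Finset.mem_filter.1 hj).2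
  have hφτ : ∀ k ∈ K, 2 * τ k ≤ 3 * ∑ j ∈ A k, φ k j * γ j := by
    intro k hk
    have h1 : τ k ≤ ∑ j ∈ A k, φ k j * γ j + ∑ k' ∈ K with k' < k, τ k' := by
      calc τ k = ∑ j ∈ A k, b j k * γ j := (hsum k hk).symm
        _ ≤ ∑ j ∈ A k, (φ k j * γ j + ∑ k' ∈ K with k' < k, b j k' * γ j) := by
            refine Finset.sum_le_sum fun j _ => ?_
            rw [← Finset.sum_mul, ← add_mul]
            gcongr
            exact le_tsub_add
        _ = ∑ j ∈ A k, φ k j * γ j + ∑ k' ∈ K with k' < k, ∑ j ∈ A k, b j k' * γ j := by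
            rw [Finset.sum_add_distrib, Finset.sum_comm]
        _ ≤ _ := by
            gcongr with k' hk'
            exact hsum' k k' (Finset.mem_filter.1 hk').1
    have h2 := hτ k hk
    rw [← NNReal.coe_le_coe] at h1 h2 ⊢
    push_cast at h1 h2 ⊢
    linarith
  have hterm : ∀ k ∈ K, τ k ^ p * M k ^ (-(p - 1)) ≤
      (3 / 2) ^ p * ∑ j ∈ B, φ k j * γ j ^ p := by
    intro k hk
    have h1 : τ k ≤ (3 / 2) * ∑ j ∈ A k, φ k j * γ j := by
      have := hφτ k hk
      rw [← NNReal.coe_le_coe] at this ⊢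
      push_cast at this ⊢
      linarith
    have h2 : (∑ j ∈ A k, φ k j * γ j) ^ p ≤
        M k ^ (p - 1) * ∑ j ∈ B, φ k j * γ j ^ p := by
      refine (NNReal.rpow_sum_le_const_mul_sum_rpow (A k) _ hp).trans ?_
      refine mul_le_mul' (NNReal.rpow_le_rpow (hM k hk) (by linarith)) ?_
      refine (Finset.sum_le_sum fun j _ => ?_).trans
        (Finset.sum_le_sum_of_subset (hAB k hk))
      rw [NNReal.mul_rpow]
      gcongr
      calc φ k j ^ p ≤ φ k j ^ (1 : ℝ) :=
            Real.rpow_le_rpow_of_exponent_ge' (φ k j).coe_nonneg (hφ1 k j) zero_le_one hp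
        _ = φ k j := NNReal.rpow_one _
    calc τ k ^ p * M k ^ (-(p - 1))
        ≤ ((3 / 2) * ∑ j ∈ A k, φ k j * γ j) ^ p * M k ^ (-(p - 1)) := by gcongr
      _ ≤ (3 / 2) ^ p * (M k ^ (p - 1) * ∑ j ∈ B, φ k j * γ j ^ p) * M k ^ (-(p - 1)) := by
          rw [NNReal.mul_rpow]; gcongr
      _ = _ := by
          have : M k ^ (p - 1) * M k ^ (-(p - 1)) = 1 := by
            rw [← NNReal.rpow_add (hM0 k hk).ne']; simp
          rw [mul_assoc, mul_right_comm (M k ^ _), this, one_mul]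
  calc ∑ k ∈ K, τ k ^ p * M k ^ (-(p - 1))
      ≤ ∑ k ∈ K, (3 / 2) ^ p * ∑ j ∈ B, φ k j * γ j ^ p := Finset.sum_le_sum hterm
    _ = (3 / 2) ^ p * ∑ j ∈ B, (∑ k ∈ K, φ k j) * γ j ^ p := by
        rw [← Finset.mul_sum, Finset.sum_comm]
        simp_rw [Finset.sum_mul]
    _ ≤ (3 / 2) ^ p * ∑ j ∈ B, 1 * γ j ^ p := by
        gcongr with j
        exact sum_tsub_partialSum_le_one K (b j) (hb1 j)
    _ = _ := by simp

/-- The sum of `γ` over the interval `[k - 2^h, k + 2]`. -/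
def windowSum (γ : ℤ → ℝ≥0) (k : ℤ) (h : ℕ) : ℝ≥0 := ∑ j ∈ Finset.Icc (k - 2 ^ h) (k + 2), γ j

/-- The sum of `γ ^ p` over the interval `[k - 2 * 2^h, k + 2]`. -/
def windowMass (p : ℝ) (γ : ℤ → ℝ≥0) (k : ℤ) (h : ℕ) : ℝ≥0 :=
  ∑ j ∈ Finset.Icc (k - 2 * 2 ^ h) (k + 2), γ j ^ p

/-- The weight of a level `τ` at scale `h`. -/
def levelWeight (p : ℝ) (τ : ℝ≥0) (h : ℕ) : ℝ≥0 := τ ^ p * (2 ^ h) ^ (-(p - 1))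

theorem card_window_le (k : ℤ) (h : ℕ) :
    ((Finset.Icc (k - 2 ^ h) (k + 2)).card : ℝ≥0) ≤ 4 * 2 ^ h := by
  have h1 : (1 : ℤ) ≤ 2 ^ h := one_le_pow₀ (by norm_num)
  have : ((Finset.Icc (k - 2 ^ h) (k + 2)).card : ℤ) ≤ 4 * 2 ^ h := by
    rw [Int.card_Icc, Int.toNat_of_nonneg (by linarith)]; linarith
  exact_mod_cast this

section Lacunary
variable {p : ℝ} {b : ℝ≥0} {γ : ℤ → ℝ≥0} {α : ℝ≥0} {K : Finset ℤ} {h : ℤ → ℕ}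

/-- An application of `sum_rpow_lacunary_le` to the levels `α * b ^ k` and their windows. With `b =
c + 1` and `c ≥ 3`, the levels below a given one add up to at most a third of it. -/
theorem sum_levelWeight_le (hp : 1 ≤ p) (hb : 4 ≤ b)
    (hK : ∀ k ∈ K, α * b ^ k ≤ windowSum γ k (h k)) (B : Finset ℤ)
    (hB : ∀ k ∈ K, Finset.Icc (k - 2 ^ h k) (k + 2) ⊆ B) :
    ∑ k ∈ K, levelWeight p (α * b ^ k) (h k) ≤
      4 ^ (p - 1) * (3 / 2) ^ p * ∑ j ∈ B, γ j ^ p := by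
  have := sum_rpow_lacunary_le hp K (fun k => Finset.Icc (k - 2 ^ h k) (k + 2)) γ
    (fun k => α * b ^ k) (fun k => 4 * 2 ^ h k) B hB hK ?_ (fun k _ => card_window_le k (h k))
    (fun k _ => by positivity)
  · calc ∑ k ∈ K, levelWeight p (α * b ^ k) (h k)
        = 4 ^ (p - 1) * ∑ k ∈ K, (α * b ^ k) ^ p * (4 * 2 ^ h k) ^ (-(p - 1)) := by
          rw [Finset.mul_sum]
          refine Finset.sum_congr rfl fun k _ => ?_
          rw [levelWeight, NNReal.mul_rpow (x := 4), mul_left_comm, ← mul_assoc (4 ^ (p - 1)),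
            ← NNReal.rpow_add (by norm_num)]
          simp
      _ ≤ _ := by rw [mul_assoc]; gcongr
  · intro k hk
    obtain ⟨c, hc⟩ : ∃ c, b = c + 1 := ⟨b - 1, (tsub_add_cancel_of_le (le_trans (by norm_num) hb)).symm⟩
    have hc3 : 3 ≤ c := by
      rw [hc, ← NNReal.coe_le_coe] at hb
      rw [← NNReal.coe_le_coe]; push_cast at *; linarith
    rw [← Finset.mul_sum, mul_left_comm, hc]
    gcongr
    refine le_trans ?_ (mul_sum_zpow_le c {k' ∈ K | k' < k} k
      (fun k' hk' => (Finset.mem_filter.1 hk').2))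
    gcongr

/-- With `i = k - k'`, the bound `b ≥ 4` gives `b^(-ip) ≤ 2^(-i) 2^(-i(p-1))`. The first factor is
the decay wanted. The second compensates the loss in the window factor when `k'` is far, because
then `i > 2^l > l`; when `l < l'` there is no loss. -/
theorem levelWeight_le_of_far_or_coarse (hp : 1 ≤ p) (hb : 4 ≤ b) {k k' : ℤ} (hk : k' ≤ k)
    {l l' : ℕ} (hfar : k' < k - 2 ^ l ∨ l < l') :
    levelWeight p (α * b ^ k') l' ≤ levelWeight p (α * b ^ k) l * 2 ^ (k' - k) := by
  have hb0 : b ≠ 0 := (lt_of_lt_of_le (by norm_num) hb).ne'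
  obtain ⟨i, rfl⟩ : ∃ i : ℕ, k' = k - i := ⟨(k - k').toNat, by omega⟩
  have e1 : (2 : ℝ≥0) ^ (k - (i : ℤ) - k) = (2 ^ i)⁻¹ := by
    rw [show k - (i : ℤ) - k = -(i : ℤ) by ring, zpow_neg, zpow_natCast]
  have e2 : α * b ^ (k - (i : ℤ)) = α * b ^ k * (b ^ i)⁻¹ := by
    rw [zpow_sub₀ hb0, zpow_natCast, div_eq_mul_inv, mul_assoc]
  rw [e1, e2, levelWeight, levelWeight, NNReal.mul_rpow (x := α * b ^ k)]
  have hbi : ((b ^ i)⁻¹ : ℝ≥0) ^ p ≤ (2 ^ i)⁻¹ * ((2 ^ i) ^ (-(p - 1))) := by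
    calc ((b ^ i)⁻¹ : ℝ≥0) ^ p ≤ (((2 ^ i) * (2 ^ i))⁻¹) ^ p := by
          gcongr
          rw [← mul_pow]
          exact pow_le_pow_left₀ zero_le (le_trans (by norm_num) hb) i
      _ ≤ ((2 ^ i)⁻¹) ^ p := by
          gcongr
          exact le_mul_of_one_le_left' (one_le_pow₀ (by norm_num))
      _ = _ := by
          rw [← NNReal.rpow_neg_one (2 ^ i), ← NNReal.rpow_mul, ← NNReal.rpow_add (by positivity)]
          congr 1; ring
  have hneg : ∀ {u v : ℝ≥0}, 0 < u → u ≤ v → v ^ (-(p - 1)) ≤ u ^ (-(p - 1)) := by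
    intro u v hu huv
    rw [NNReal.rpow_neg, NNReal.rpow_neg]
    gcongr
  have hle1 : ∀ n : ℕ, ((2 : ℝ≥0) ^ n) ^ (-(p - 1)) ≤ 1 := by
    intro n
    have := hneg (u := 1) (v := 2 ^ n) one_pos (one_le_pow₀ (by norm_num))
    simpa using this
  have key : ((2 : ℝ≥0) ^ i) ^ (-(p - 1)) * (2 ^ l') ^ (-(p - 1)) ≤ (2 ^ l) ^ (-(p - 1)) := by
    rcases hfar with h1 | h1
    · have h2 : (l : ℤ) < 2 ^ l := by exact_mod_cast Nat.lt_two_pow_self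
      have h3 : l ≤ i := by omega
      calc _ ≤ ((2 : ℝ≥0) ^ i) ^ (-(p - 1)) * 1 := by gcongr; exact hle1 l'
        _ ≤ _ := by
          rw [mul_one]
          exact hneg (by positivity) (pow_le_pow_right₀ (by norm_num) h3)
    · calc _ ≤ 1 * ((2 : ℝ≥0) ^ l') ^ (-(p - 1)) := by gcongr; exact hle1 i
        _ ≤ _ := by
          rw [one_mul]
          exact hneg (by positivity) (pow_le_pow_right₀ (by norm_num) h1.le)
  calc (α * b ^ k) ^ p * ((b ^ i)⁻¹) ^ p * (2 ^ l') ^ (-(p - 1))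
      ≤ (α * b ^ k) ^ p * ((2 ^ i)⁻¹ * ((2 ^ i) ^ (-(p - 1)))) * (2 ^ l') ^ (-(p - 1)) := by gcongr
    _ = (α * b ^ k) ^ p * (((2 ^ i) ^ (-(p - 1))) * (2 ^ l') ^ (-(p - 1))) * (2 ^ i)⁻¹ := by ring
    _ ≤ _ := by gcongr

/-- The constant in `partialSum_levelWeight_le`. -/
def lacunaryConst (p : ℝ) : ℝ≥0 := 3 * (4 ^ (p - 1) * (3 / 2) ^ p)

/-- Indices `k'` that are near and have windows no deeper than that of `k` have windows inside the
enlarged window defining `windowMass`, so `sum_levelWeight_le` applies to them. All others decay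
geometrically and add up to at most twice the weight at `k`. This is the source of the factor `3 = 1
+ 2` in `lacunaryConst`. -/
theorem partialSum_levelWeight_le (hp : 1 ≤ p) (hb : 4 ≤ b)
    (hK : ∀ k ∈ K, α * b ^ k ≤ windowSum γ k (h k)) {k : ℤ} (hk : k ∈ K) :
    ∑ k' ∈ K with k' ≤ k, levelWeight p (α * b ^ k') (h k') ≤
      lacunaryConst p * windowMass p γ k (h k) := by
  have hpow : (0 : ℤ) < 2 ^ h k := by positivity
  have hself : levelWeight p (α * b ^ k) (h k) ≤
      4 ^ (p - 1) * (3 / 2) ^ p * windowMass p γ k (h k) := by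
    have := sum_levelWeight_le (K := {k}) (h := h) hp hb (fun k' hk' => by
      rw [Finset.mem_singleton.1 hk']; exact hK k hk) (Finset.Icc (k - 2 * 2 ^ h k) (k + 2))
      (fun k' hk' => by
        rw [Finset.mem_singleton.1 hk']
        exact Finset.Icc_subset_Icc (by linarith) le_rfl)
    simpa [windowMass] using this
  rw [← Finset.sum_filter_add_sum_filter_not _ (fun k' => k - 2 ^ h k ≤ k' ∧ h k' ≤ h k)]
  have hnear : ∑ k' ∈ {k' ∈ K | k' ≤ k} with k - 2 ^ h k ≤ k' ∧ h k' ≤ h k,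
      levelWeight p (α * b ^ k') (h k') ≤
      4 ^ (p - 1) * (3 / 2) ^ p * windowMass p γ k (h k) := by
    refine sum_levelWeight_le hp hb (fun k' hk' => hK k' ?_) _ fun k' hk' => ?_
    · exact (Finset.mem_filter.1 (Finset.mem_filter.1 hk').1).1
    · simp only [Finset.mem_filter] at hk'
      have : (2 : ℤ) ^ h k' ≤ 2 ^ h k := pow_le_pow_right₀ (by norm_num) hk'.2.2
      exact Finset.Icc_subset_Icc (by linarith [hk'.2.1]) (by linarith [hk'.1.2])
  have hrest : ∑ k' ∈ {k' ∈ K | k' ≤ k} with ¬ (k - 2 ^ h k ≤ k' ∧ h k' ≤ h k),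
      levelWeight p (α * b ^ k') (h k') ≤ 2 * levelWeight p (α * b ^ k) (h k) := by
    set K' := {k' ∈ {k' ∈ K | k' ≤ k} | ¬ (k - 2 ^ h k ≤ k' ∧ h k' ≤ h k)} with hK'
    calc ∑ k' ∈ K', levelWeight p (α * b ^ k') (h k')
        ≤ ∑ k' ∈ K', levelWeight p (α * b ^ k) (h k) * 2 ^ (k' - k) := by
          refine Finset.sum_le_sum fun k' hk' => ?_
          simp only [hK', Finset.mem_filter, not_and_or, not_le] at hk'
          exact levelWeight_le_of_far_or_coarse hp hb hk'.1.2 hk'.2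
      _ = levelWeight p (α * b ^ k) (h k) * (2 ^ (-k) * ∑ k' ∈ K', (1 + 1) ^ k') := by
          rw [← Finset.mul_sum, Finset.mul_sum (a := (2 : ℝ≥0) ^ (-k))]
          congr 1
          refine Finset.sum_congr rfl fun k' _ => ?_
          rw [one_add_one_eq_two, ← zpow_add₀ two_ne_zero]; congr 1; ring
      _ ≤ levelWeight p (α * b ^ k) (h k) * (2 ^ (-k) * (1 + 1) ^ (k + 1)) := by
          gcongr
          have := mul_sum_zpow_le 1 K' (k + 1) (fun k' hk' => by
            simp only [hK', Finset.mem_filter] at hk'; omega)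
          simpa using this
      _ = _ := by
          rw [one_add_one_eq_two, ← zpow_add₀ two_ne_zero]
          simp [mul_comm]
  calc _ ≤ 4 ^ (p - 1) * (3 / 2) ^ p * windowMass p γ k (h k) +
        2 * levelWeight p (α * b ^ k) (h k) := add_le_add hnear hrest
    _ ≤ 4 ^ (p - 1) * (3 / 2) ^ p * windowMass p γ k (h k) +
        2 * (4 ^ (p - 1) * (3 / 2) ^ p * windowMass p γ k (h k)) := by gcongr
    _ = _ := by rw [lacunaryConst]; ring

end Lacunary

end SphericalMaximal
end

noncomputable section
namespace SphericalMaximal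

/-! ### A Carleson type embedding for sequences -/

theorem sum_range_rpow_neg_half_le (n : ℕ) :
    ∑ i ∈ Finset.range n, (1 + (i : ℝ)) ^ (-(1 / 2) : ℝ) ≤ 2 * Real.sqrt n := by
  induction n with
  | zero => simp
  | succ n ih =>
    rw [Finset.sum_range_succ]
    have h1 : (1 + (n : ℝ)) ^ (-(1 / 2) : ℝ) = (Real.sqrt (n + 1))⁻¹ := by
      rw [Real.rpow_neg (by positivity), Real.sqrt_eq_rpow, add_comm]
    have hx : 0 < Real.sqrt ((n : ℝ) + 1) := Real.sqrt_pos.2 (by positivity)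
    have e1 : Real.sqrt ((n : ℝ) + 1) ^ 2 = n + 1 := Real.sq_sqrt (by positivity)
    have e2 : Real.sqrt (n : ℝ) ^ 2 = n := Real.sq_sqrt (by positivity)
    have h2 : (Real.sqrt ((n : ℝ) + 1))⁻¹ ≤ 2 * Real.sqrt (n + 1) - 2 * Real.sqrt n := by
      rw [inv_le_iff_one_le_mul₀' hx]
      nlinarith [sq_nonneg (Real.sqrt ((n : ℝ) + 1) - Real.sqrt n)]
    rw [h1]; push_cast; linarith

theorem sum_natAbs_sub_le (g : ℕ → ℝ≥0) (z : ℤ) (n : ℕ) :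
    ∑ j ∈ Finset.Icc (z - n) (z + n), g (j - z).natAbs ≤ 2 * ∑ i ∈ Finset.range (n + 1), g i := by
  rw [← Finset.sum_fiberwise_of_maps_to (t := Finset.range (n + 1))
    (g := fun j : ℤ => (j - z).natAbs) (fun j hj => by
      rw [Finset.mem_Icc] at hj; rw [Finset.mem_range]; omega), Finset.mul_sum]
  refine Finset.sum_le_sum fun i _ => ?_
  calc ∑ j ∈ Finset.Icc (z - n) (z + n) with (j - z).natAbs = i, g (j - z).natAbs
      ≤ ∑ j ∈ ({z + i, z - i} : Finset ℤ), g i := by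
        rw [Finset.sum_congr rfl (g := fun _ => g i) (fun j hj => by
          rw [(Finset.mem_filter.1 hj).2])]
        refine Finset.sum_le_sum_of_subset fun j hj => ?_
        have := (Finset.mem_filter.1 hj).2
        simp only [Finset.mem_insert, Finset.mem_singleton]; omega
    _ ≤ 2 * g i := by
        rw [Finset.sum_const, nsmul_eq_mul]
        gcongr
        exact_mod_cast Finset.card_le_two

/-- One plus the distance of two integers. -/
def intDist (j z : ℤ) : ℝ≥0 := 1 + (j - z).natAbs

theorem sum_intDist_rpow_le {k z : ℤ} {h : ℕ} (hz : z ∈ Finset.Icc (k - 2 * 2 ^ h) (k + 2)) :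
    ∑ j ∈ Finset.Icc (k - 2 ^ h) (k + 2), intDist j z ^ (-(1 / 2) : ℝ) ≤
      12 * (2 ^ h) ^ (1 / 2 : ℝ) := by
  have h1 : (1 : ℤ) ≤ 2 ^ h := one_le_pow₀ (by norm_num)
  have hn : ((4 * 2 ^ h : ℕ) : ℤ) = 4 * 2 ^ h := by push_cast; ring
  calc ∑ j ∈ Finset.Icc (k - 2 ^ h) (k + 2), intDist j z ^ (-(1 / 2) : ℝ)
      ≤ ∑ j ∈ Finset.Icc (z - (4 * 2 ^ h : ℕ)) (z + (4 * 2 ^ h : ℕ)),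
        intDist j z ^ (-(1 / 2) : ℝ) := by
        refine Finset.sum_le_sum_of_subset fun j hj => ?_
        rw [Finset.mem_Icc] at hj hz ⊢
        rw [hn]
        constructor <;> linarith [hj.1, hj.2, hz.1, hz.2]
    _ ≤ 2 * ∑ i ∈ Finset.range (4 * 2 ^ h + 1), (1 + (i : ℝ≥0)) ^ (-(1 / 2) : ℝ) :=
        sum_natAbs_sub_le (fun i => (1 + (i : ℝ≥0)) ^ (-(1 / 2) : ℝ)) z _
    _ ≤ _ := by
        have h2 := sum_range_rpow_neg_half_le (4 * 2 ^ h + 1)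
        rw [← NNReal.coe_le_coe]
        push_cast at h2 ⊢
        rw [← Real.sqrt_eq_rpow]
        have h3 : Real.sqrt (4 * 2 ^ h + 1) ≤ 3 * Real.sqrt (2 ^ h) := by
          have h4 : (1 : ℝ) ≤ 2 ^ h := one_le_pow₀ (by norm_num)
          rw [Real.sqrt_le_left (by positivity), mul_pow, Real.sq_sqrt (by positivity)]
          linarith
        linarith

/-- Hölder with a power of the distance to `z` as weight. The exponent `a = (p-1)/2` makes the dual
weight `dist^(-1/2)`, whose sum over the window is of order `2^(h/2)`. The gain over plain Hölder is
the factor `(dist / 2^h)^a`, which later makes the sum over `h` converge. -/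
theorem levelWeight_windowSum_le {p : ℝ} (hp : 1 < p) (γ : ℤ → ℝ≥0) {k z : ℤ} {h : ℕ}
    (hz : z ∈ Finset.Icc (k - 2 * 2 ^ h) (k + 2)) :
    levelWeight p (windowSum γ k h) h ≤ 12 ^ (p - 1) *
      ∑ j ∈ Finset.Icc (k - 2 ^ h) (k + 2),
        γ j ^ p * (intDist j z / 2 ^ h) ^ ((p - 1) / 2) := by
  have hp0 : 0 < p := by linarith
  have hq : p.HolderConjugate (p / (p - 1)) := Real.HolderConjugate.conjExponent hp
  set a := (p - 1) / 2 with ha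
  have hX : ∀ j, intDist j z ≠ 0 := fun j => by unfold intDist; positivity
  have hH := NNReal.inner_le_Lp_mul_Lq (Finset.Icc (k - 2 ^ h) (k + 2))
    (fun j => γ j * intDist j z ^ (a / p)) (fun j => intDist j z ^ (-(a / p))) hq
  have e1 : ∑ j ∈ Finset.Icc (k - 2 ^ h) (k + 2), γ j * intDist j z ^ (a / p) *
      intDist j z ^ (-(a / p)) = windowSum γ k h := by
    refine Finset.sum_congr rfl fun j _ => ?_
    rw [mul_assoc, ← NNReal.rpow_add (hX j), add_neg_cancel, NNReal.rpow_zero, mul_one]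
  have e2 : ∀ j, (γ j * intDist j z ^ (a / p)) ^ p = γ j ^ p * intDist j z ^ a := by
    intro j
    rw [NNReal.mul_rpow, ← NNReal.rpow_mul, div_mul_cancel₀ _ hp0.ne']
  have e3 : ∀ j, (intDist j z ^ (-(a / p))) ^ (p / (p - 1)) = intDist j z ^ (-(1 / 2) : ℝ) := by
    intro j
    rw [← NNReal.rpow_mul]
    congr 1
    have : p - 1 ≠ 0 := by linarith
    rw [ha]; field_simp
  rw [e1] at hH
  simp_rw [e2, e3] at hH
  have h1 : windowSum γ k h ^ p ≤ (∑ j ∈ Finset.Icc (k - 2 ^ h) (k + 2),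
      γ j ^ p * intDist j z ^ a) * (12 * (2 ^ h) ^ (1 / 2 : ℝ)) ^ (p - 1) := by
    calc windowSum γ k h ^ p ≤ _ := NNReal.rpow_le_rpow hH hp0.le
      _ = (∑ j ∈ Finset.Icc (k - 2 ^ h) (k + 2), γ j ^ p * intDist j z ^ a) *
          (∑ j ∈ Finset.Icc (k - 2 ^ h) (k + 2), intDist j z ^ (-(1 / 2) : ℝ)) ^ (p - 1) := by
        rw [NNReal.mul_rpow, ← NNReal.rpow_mul, ← NNReal.rpow_mul, one_div_mul_cancel hp0.ne',
          NNReal.rpow_one]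
        congr 2
        field_simp
      _ ≤ _ := by
        refine mul_le_mul_right (NNReal.rpow_le_rpow (sum_intDist_rpow_le hz) (by linarith)) _
  have e4 : (12 * ((2 : ℝ≥0) ^ h) ^ (1 / 2 : ℝ)) ^ (p - 1) * (2 ^ h) ^ (-(p - 1)) =
      12 ^ (p - 1) * (2 ^ h) ^ (-a) := by
    rw [NNReal.mul_rpow, ← NNReal.rpow_mul, mul_assoc, ← NNReal.rpow_add (by positivity)]
    congr 2
    rw [ha]; ring
  rw [levelWeight]
  calc windowSum γ k h ^ p * (2 ^ h) ^ (-(p - 1)) ≤ _ := mul_le_mul_left h1 _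
    _ = _ := by
      rw [mul_assoc, e4, mul_left_comm, Finset.sum_mul]
      congr 1
      refine Finset.sum_congr rfl fun j _ => ?_
      rw [NNReal.div_rpow, NNReal.rpow_neg, div_eq_mul_inv, mul_assoc]

/-- The sum of `γ ^ p` over the interval between `j` and `z`. -/
def segmentMass (p : ℝ) (γ : ℤ → ℝ≥0) (j z : ℤ) : ℝ≥0 := ∑ i ∈ Finset.uIcc j z, γ i ^ p

/-- One factor of the mass is opened as a sum over `z`, and the remaining negative power decreases
with the mass, which is at least that of the segment from `j` to `z` inside the enlarged window.
After this `k` and `h` enter each summand only through the distance factor and the ranges of `j` and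
`z`. -/
theorem levelWeight_mul_windowMass_le {p β : ℝ} (hp : 1 < p) (hβ0 : 0 ≤ β) (hβ : β < 1)
    (γ : ℤ → ℝ≥0) (k : ℤ) (h : ℕ) :
    levelWeight p (windowSum γ k h) h * windowMass p γ k h ^ (1 - β) ≤ 12 ^ (p - 1) *
      ∑ j ∈ Finset.Icc (k - 2 ^ h) (k + 2), ∑ z ∈ Finset.Icc (k - 2 * 2 ^ h) (k + 2),
        (γ j ^ p * (γ z ^ p * segmentMass p γ j z ^ (-β))) *
          (intDist j z / 2 ^ h) ^ ((p - 1) / 2) := by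
  rcases eq_or_ne (windowMass p γ k h) 0 with h0 | h0
  · rw [h0, NNReal.zero_rpow (by linarith), mul_zero]; exact zero_le
  have hpow : (0 : ℤ) < 2 ^ h := by positivity
  have e1 : windowMass p γ k h ^ (1 - β) =
      (∑ z ∈ Finset.Icc (k - 2 * 2 ^ h) (k + 2), γ z ^ p) * windowMass p γ k h ^ (-β) := by
    rw [sub_eq_add_neg, NNReal.rpow_add h0, NNReal.rpow_one]; rfl
  rw [e1, Finset.sum_mul, Finset.mul_sum, Finset.sum_comm, Finset.mul_sum]
  refine Finset.sum_le_sum fun z hz => ?_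
  calc levelWeight p (windowSum γ k h) h * (γ z ^ p * windowMass p γ k h ^ (-β))
      ≤ (12 ^ (p - 1) * ∑ j ∈ Finset.Icc (k - 2 ^ h) (k + 2),
        γ j ^ p * (intDist j z / 2 ^ h) ^ ((p - 1) / 2)) *
        (γ z ^ p * windowMass p γ k h ^ (-β)) := by
        gcongr; exact levelWeight_windowSum_le hp γ hz
    _ = 12 ^ (p - 1) * ∑ j ∈ Finset.Icc (k - 2 ^ h) (k + 2),
        (γ j ^ p * (γ z ^ p * windowMass p γ k h ^ (-β))) *
          (intDist j z / 2 ^ h) ^ ((p - 1) / 2) := by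
        rw [mul_assoc, Finset.sum_mul]
        congr 1
        exact Finset.sum_congr rfl fun j _ => by ring
    _ ≤ _ := by
        gcongr 12 ^ (p - 1) * ∑ j ∈ _, (γ j ^ p * ?_) * _ with j hj
        rcases eq_or_ne (γ z ^ p) 0 with hz0 | hz0
        · simp [hz0]
        · refine mul_le_mul_right ?_ _
          have hpos : 0 < segmentMass p γ j z := (pos_iff_ne_zero.2 hz0).trans_le
            (Finset.single_le_sum (f := fun i => γ i ^ p) (fun _ _ => zero_le)
              Finset.right_mem_uIcc)
          rw [NNReal.rpow_neg, NNReal.rpow_neg]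
          gcongr
          refine Finset.sum_le_sum_of_subset ?_
          rw [Finset.mem_Icc] at hj
          exact (Finset.uIcc_subset_Icc (Finset.mem_Icc.2 ⟨by linarith [hj.1], hj.2⟩) hz)

/-- On either side of `j` the segment masses dominate the partial sums of `γ ^ p` counted from `j`,
so the summation lemma applies to each side. This explains the factor `2`. -/
theorem tsum_mul_segmentMass_rpow_le {p β : ℝ} (hβ0 : 0 ≤ β) (hβ : β < 1)
    (γ : ℤ → ℝ≥0) (j : ℤ) :
    ∑' z, ((γ z ^ p * segmentMass p γ j z ^ (-β) : ℝ≥0) : ℝ≥0∞) ≤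
      2 * (1 - β).toNNReal⁻¹ * (∑' z, ((γ z ^ p : ℝ≥0) : ℝ≥0∞)) ^ (1 - β) := by
  rw [ENNReal.tsum_eq_iSup_sum]
  refine iSup_le fun K => ?_
  have hcoe : ∀ K' ⊆ K, (((1 - β).toNNReal⁻¹ * (∑ k ∈ K', γ k ^ p) ^ (1 - β) : ℝ≥0) : ℝ≥0∞) ≤
      ((1 - β).toNNReal⁻¹ : ℝ≥0) * (∑' z, ((γ z ^ p : ℝ≥0) : ℝ≥0∞)) ^ (1 - β) := by
    intro K' _
    push_cast
    rw [ENNReal.coe_rpow_of_nonneg _ (by linarith)]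
    gcongr
    push_cast
    exact ENNReal.sum_le_tsum K'
  have hhalf1 : ∑ z ∈ K with j ≤ z, γ z ^ p * segmentMass p γ j z ^ (-β) ≤
      (1 - β).toNNReal⁻¹ * (∑ k ∈ K with j ≤ k, γ k ^ p) ^ (1 - β) := by
    refine sum_mul_rpow_neg_le hβ0 hβ _ (fun z => γ z ^ p) _ fun k hk => ?_
    refine Finset.sum_le_sum_of_subset fun i hi => ?_
    simp only [Finset.mem_filter] at hi
    rw [Finset.mem_uIcc']
    exact Or.inl ⟨hi.1.2, hi.2⟩
  have hhalf2 : ∑ z ∈ K with ¬ j ≤ z, γ z ^ p * segmentMass p γ j z ^ (-β) ≤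
      (1 - β).toNNReal⁻¹ * (∑ k ∈ K with ¬ j ≤ k, γ k ^ p) ^ (1 - β) := by
    refine sum_mul_rpow_neg_le_of_ge hβ0 hβ _ (fun z => γ z ^ p) _ fun k hk => ?_
    refine Finset.sum_le_sum_of_subset fun i hi => ?_
    simp only [Finset.mem_filter] at hi
    rw [Finset.mem_uIcc']
    exact Or.inr ⟨hi.2, (not_le.1 hi.1.2).le⟩
  rw [← ENNReal.ofNNReal_finsetSum, ← Finset.sum_filter_add_sum_filter_not K (fun z => j ≤ z)]
  rw [mul_assoc, two_mul, ENNReal.coe_add]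
  exact add_le_add ((ENNReal.coe_le_coe.2 hhalf1).trans (hcoe _ (Finset.filter_subset _ _)))
    ((ENNReal.coe_le_coe.2 hhalf2).trans (hcoe _ (Finset.filter_subset _ _)))

end SphericalMaximal
end

noncomputable section
namespace SphericalMaximal

/-! ### Summing the window estimates over all positions and scales. -/

theorem sum_eq_tsum_ite {ι : Type*} [DecidableEq ι] (s : Finset ι) (f : ι → ℝ≥0∞) :
    ∑ i ∈ s, f i = ∑' i, if i ∈ s then f i else 0 := by
  rw [tsum_eq_sum (s := s) (fun i hi => if_neg hi)]
  exact Finset.sum_congr rfl fun i hi => (if_pos hi).symm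

/-- The constant in `tsum_window_le`. -/
def embeddingConst (p β : ℝ) : ℝ≥0∞ :=
  12 ^ (p - 1) * (geomConst ((p - 1) / 2) * 6 ^ ((p - 1) / 2)) *
    (2 * ((1 - β).toNNReal⁻¹ : ℝ≥0))

theorem embeddingConst_ne_top {p β : ℝ} (hp : 1 < p) : embeddingConst p β ≠ ∞ := by
  refine ENNReal.mul_ne_top (ENNReal.mul_ne_top ?_ (ENNReal.mul_ne_top
    (geomConst_ne_top (by linarith)) ?_)) (ENNReal.mul_ne_top (by simp) ENNReal.coe_ne_top)
  · exact ENNReal.rpow_ne_top_of_nonneg (by linarith) (by simp)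
  · exact ENNReal.rpow_ne_top_of_nonneg (by linarith) (by simp)

/-- The admitted ratios `dist / 2^h` form a geometric progression bounded by `5`; the constant `6`
provides the strict inequality required by `tsum_dyadicScale_rpow_le`. -/
theorem tsum_scales_le {a : ℝ} (ha : 0 < a) (j z : ℤ) :
    ∑' h : ℕ, (if intDist j z ≤ 5 * 2 ^ h then ((intDist j z / 2 ^ h : ℝ≥0) : ℝ≥0∞) ^ a else 0) ≤
      geomConst a * 6 ^ a := by
  have hX : 0 < intDist j z := by unfold intDist; positivity
  refine le_trans ?_ (tsum_dyadicScale_rpow_le ha hX 6)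
  have hinj : Function.Injective (fun h : ℕ => -(h : ℤ)) := fun i j h => by simpa using h
  refine le_trans (ENNReal.tsum_le_tsum fun h => ?_) (ENNReal.tsum_comp_le_tsum_of_injective hinj _)
  have e : dyadicScale (intDist j z) (-(h : ℤ)) = intDist j z / 2 ^ h := by
    rw [dyadicScale, zpow_neg, zpow_natCast, div_eq_mul_inv]
  split_ifs with h1 h2
  · simp only [e]; exact le_rfl
  · exfalso
    apply h2
    rw [e]
    have : intDist j z / 2 ^ h ≤ 5 := by rwa [div_le_iff₀ (by positivity)]
    exact lt_of_le_of_lt (ENNReal.coe_le_coe.2 this) (by norm_num)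
  · exact zero_le
  · exact le_rfl

/-- A Carleson type embedding theorem. -/
theorem tsum_window_le {p β : ℝ} (hp : 1 < p) (hβ0 : 0 ≤ β) (hβ : β < 1) (γ : ℤ → ℝ≥0)
    (w : ℤ → ℕ → ℝ≥0∞) (W : ℝ≥0∞)
    (hw : ∀ (h : ℕ) (j : ℤ), ∑ k ∈ Finset.Icc (j - 2) (j + 2 ^ h), w k h ≤ W) :
    ∑' k, ∑' h, w k h *
        ((levelWeight p (windowSum γ k h) h * windowMass p γ k h ^ (1 - β) : ℝ≥0) : ℝ≥0∞) ≤
      embeddingConst p β * W * (∑' z, ((γ z ^ p : ℝ≥0) : ℝ≥0∞)) ^ (2 - β) := by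
  set a := (p - 1) / 2 with ha
  have ha0 : 0 < a := by rw [ha]; linarith
  set N := ∑' z, ((γ z ^ p : ℝ≥0) : ℝ≥0∞) with hN
  set Q : ℤ → ℤ → ℝ≥0∞ := fun j z =>
    ((γ j ^ p : ℝ≥0) : ℝ≥0∞) * ((γ z ^ p * segmentMass p γ j z ^ (-β) : ℝ≥0) : ℝ≥0∞) with hQ
  set A : ℤ → ℕ → Finset ℤ := fun k h => Finset.Icc (k - 2 ^ h) (k + 2) with hA
  set B : ℤ → ℕ → Finset ℤ := fun k h => Finset.Icc (k - 2 * 2 ^ h) (k + 2) with hB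
  set D : ℤ → ℤ → ℕ → ℝ≥0∞ := fun j z h => ((intDist j z / 2 ^ h : ℝ≥0) : ℝ≥0∞) ^ a with hD
  have step1 : ∀ k h, w k h *
      ((levelWeight p (windowSum γ k h) h * windowMass p γ k h ^ (1 - β) : ℝ≥0) : ℝ≥0∞) ≤
      12 ^ (p - 1) * ∑' j, ∑' z, Q j z *
        (if j ∈ A k h ∧ z ∈ B k h then w k h * D j z h else 0) := by
    intro k h
    have h1 := ENNReal.coe_le_coe.2 (levelWeight_mul_windowMass_le hp hβ0 hβ γ k h)
    calc _ ≤ w k h * _ := mul_le_mul_right h1 _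
      _ = 12 ^ (p - 1) * ∑ j ∈ A k h, ∑ z ∈ B k h, Q j z * (w k h * D j z h) := by
        rw [ENNReal.coe_mul, ENNReal.coe_rpow_of_nonneg _ (by linarith : 0 ≤ p - 1),
          mul_left_comm]
        congr 1
        rw [ENNReal.ofNNReal_finsetSum, Finset.mul_sum]
        refine Finset.sum_congr rfl fun j _ => ?_
        rw [ENNReal.ofNNReal_finsetSum, Finset.mul_sum]
        refine Finset.sum_congr rfl fun z _ => ?_
        rw [ENNReal.coe_mul, ENNReal.coe_mul, ENNReal.coe_rpow_of_nonneg _ ha0.le]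
        simp only [hQ, hD]
        ring
      _ = _ := by
        congr 1
        rw [sum_eq_tsum_ite]
        refine tsum_congr fun j => ?_
        rw [sum_eq_tsum_ite]
        by_cases hj : j ∈ A k h
        · rw [if_pos hj]
          refine tsum_congr fun z => ?_
          by_cases hz : z ∈ B k h <;> simp [hj, hz]
        · simp [hj]
  -- For fixed `j` and `h`, only `k` with `j - 2 ≤ k ≤ j + 2^h` have `j` in their window, which is
  -- the range in `hw`. If `j` and `z` belong to the windows of the same `k`, then `1 + |j - z| ≤ 2
  -- * 2^h + 3 ≤ 5 * 2^h`.
  have step2 : ∀ j z h, ∑' k, (if j ∈ A k h ∧ z ∈ B k h then w k h * D j z h else 0) ≤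
      W * (if intDist j z ≤ 5 * 2 ^ h then D j z h else 0) := by
    intro j z h
    have hpow : (1 : ℤ) ≤ 2 ^ h := one_le_pow₀ (by norm_num)
    calc _ ≤ ∑' k, (if k ∈ Finset.Icc (j - 2) (j + 2 ^ h) then w k h *
          (if intDist j z ≤ 5 * 2 ^ h then D j z h else 0) else 0) := by
          refine ENNReal.tsum_le_tsum fun k => ?_
          split_ifs with h1 h2 h3 h2
          · exact le_rfl
          · exfalso
            apply h3
            simp only [hA, hB, Finset.mem_Icc] at h1
            have h4 : 1 + ((j - z).natAbs : ℤ) ≤ 5 * 2 ^ h := by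
              have := abs_le.2 (⟨by linarith [h1.1.1, h1.2.2], by linarith [h1.1.2, h1.2.1]⟩ :
                -(2 * 2 ^ h + 2) ≤ j - z ∧ j - z ≤ 2 * 2 ^ h + 2)
              rw [Int.natCast_natAbs]
              linarith
            rw [intDist]
            exact_mod_cast h4
          · exfalso
            apply h2
            simp only [hA, Finset.mem_Icc] at h1 ⊢
            constructor <;> linarith [h1.1.1, h1.1.2]
          all_goals exact zero_le
      _ = (∑ k ∈ Finset.Icc (j - 2) (j + 2 ^ h), w k h) *
          (if intDist j z ≤ 5 * 2 ^ h then D j z h else 0) := by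
          rw [Finset.sum_mul, sum_eq_tsum_ite]
      _ ≤ _ := by gcongr; exact hw h j
  calc _ ≤ ∑' k, ∑' h, 12 ^ (p - 1) * ∑' j, ∑' z, Q j z *
        (if j ∈ A k h ∧ z ∈ B k h then w k h * D j z h else 0) :=
        ENNReal.tsum_le_tsum fun k => ENNReal.tsum_le_tsum fun h => step1 k h
    _ = 12 ^ (p - 1) * ∑' j, ∑' z, Q j z * ∑' h, ∑' k,
        (if j ∈ A k h ∧ z ∈ B k h then w k h * D j z h else 0) := by
        simp_rw [ENNReal.tsum_mul_left]
        congr 1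
        simp_rw [← ENNReal.tsum_mul_left]
        rw [ENNReal.tsum_comm]
        have : ∀ h, ∑' k, ∑' j, ∑' z, Q j z *
            (if j ∈ A k h ∧ z ∈ B k h then w k h * D j z h else 0) =
            ∑' j, ∑' z, ∑' k, Q j z *
            (if j ∈ A k h ∧ z ∈ B k h then w k h * D j z h else 0) := by
          intro h
          rw [ENNReal.tsum_comm]
          exact tsum_congr fun j => ENNReal.tsum_comm
        simp_rw [this]
        rw [ENNReal.tsum_comm]
        exact tsum_congr fun j => ENNReal.tsum_comm
    _ ≤ 12 ^ (p - 1) * ∑' j, ∑' z, Q j z * (W * (geomConst a * 6 ^ a)) := by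
        gcongr with j z
        calc _ ≤ ∑' h, W * (if intDist j z ≤ 5 * 2 ^ h then D j z h else 0) :=
              ENNReal.tsum_le_tsum fun h => step2 j z h
          _ = W * ∑' h, (if intDist j z ≤ 5 * 2 ^ h then D j z h else 0) := ENNReal.tsum_mul_left
          _ ≤ _ := by gcongr; exact tsum_scales_le ha0 j z
    _ = 12 ^ (p - 1) * ((∑' j, ((γ j ^ p : ℝ≥0) : ℝ≥0∞) *
        ∑' z, ((γ z ^ p * segmentMass p γ j z ^ (-β) : ℝ≥0) : ℝ≥0∞)) *
          (W * (geomConst a * 6 ^ a))) := by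
        simp_rw [ENNReal.tsum_mul_right, hQ, ENNReal.tsum_mul_left]
    _ ≤ 12 ^ (p - 1) * ((∑' j, ((γ j ^ p : ℝ≥0) : ℝ≥0∞) *
        (2 * (1 - β).toNNReal⁻¹ * N ^ (1 - β))) * (W * (geomConst a * 6 ^ a))) := by
        gcongr with j
        exact tsum_mul_segmentMass_rpow_le hβ0 hβ γ j
    _ = _ := by
        have : N ^ (2 - β) = N * N ^ (1 - β) := by
          rw [show (2 - β) = 1 + (1 - β) by ring,
            ENNReal.rpow_add_of_nonneg _ _ zero_le_one (by linarith), ENNReal.rpow_one]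
        rw [ENNReal.tsum_mul_right, ← hN, this, embeddingConst]
        ring

end SphericalMaximal
end

noncomputable section
namespace SphericalMaximal

/-! ### Summation over the levels -/

section Levels
open Classical in
/-- The least `h` for which the window sum at `k` exceeds `τ`, or zero. -/
def levelIndex (γ : ℤ → ℝ≥0) (τ : ℝ≥0) (k : ℤ) : ℕ :=
  if hh : ∃ h, τ < windowSum γ k h then Nat.find hh else 0

theorem lt_windowSum_levelIndex {γ : ℤ → ℝ≥0} {τ : ℝ≥0} {k : ℤ}
    (hh : ∃ h, τ < windowSum γ k h) : τ < windowSum γ k (levelIndex γ τ k) := by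
  classical
  rw [levelIndex, dif_pos hh]
  exact Nat.find_spec hh

theorem windowSum_le_of_lt_levelIndex {γ : ℤ → ℝ≥0} {τ : ℝ≥0} {k : ℤ} {h : ℕ}
    (hlt : h < levelIndex γ τ k) : windowSum γ k h ≤ τ := by
  classical
  by_cases hh : ∃ h, τ < windowSum γ k h
  · rw [levelIndex, dif_pos hh] at hlt
    exact not_lt.1 (Nat.find_min hh hlt)
  · exact not_lt.1 fun h' => hh ⟨h, h'⟩

open Classical in
/-- The weighted sum of the level weights at height `α`. -/
def levelSum (p : ℝ) (b : ℝ≥0) (γ : ℤ → ℝ≥0) (e : ℤ → ℕ → ℝ≥0∞) (α : ℝ≥0) : ℝ≥0∞ :=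
  ∑' k, if ∃ h, α * b ^ k < windowSum γ k h then
    (levelWeight p (α * b ^ k) (levelIndex γ (α * b ^ k) k) : ℝ≥0∞) *
      e k (levelIndex γ (α * b ^ k) k) else 0

variable {p : ℝ} {b : ℝ≥0} (γ : ℤ → ℝ≥0)

theorem sum_hit_le (hp : 1 ≤ p) (hb : 4 ≤ b) (α : ℝ≥0) (K : Finset ℤ)
    (hK : ∀ k ∈ K, ∃ h, α * b ^ k < windowSum γ k h) :
    ((∑ k ∈ K, levelWeight p (α * b ^ k) (levelIndex γ (α * b ^ k) k) : ℝ≥0) : ℝ≥0∞) ≤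
      lacunaryConst p * ∑' j, ((γ j ^ p : ℝ≥0) : ℝ≥0∞) := by
  set B := K.biUnion fun k => Finset.Icc (k - 2 ^ levelIndex γ (α * b ^ k) k) (k + 2)
  have h1 := sum_levelWeight_le (h := fun k => levelIndex γ (α * b ^ k) k) hp hb
    (fun k hk => (lt_windowSum_levelIndex (hK k hk)).le) B
    (fun k hk => Finset.subset_biUnion_of_mem
      (fun k => Finset.Icc (k - 2 ^ levelIndex γ (α * b ^ k) k) (k + 2)) hk)
  calc _ ≤ (((4 ^ (p - 1) * (3 / 2) ^ p) * ∑ j ∈ B, γ j ^ p : ℝ≥0) : ℝ≥0∞) :=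
        ENNReal.coe_le_coe.2 h1
    _ ≤ _ := by
        rw [ENNReal.coe_mul, ENNReal.ofNNReal_finsetSum]
        gcongr
        · rw [lacunaryConst]
          exact le_mul_of_one_le_left' (by norm_num)
        · exact ENNReal.sum_le_tsum B

/-- The estimate at a single height, which is all that the weak type bound needs. -/
theorem levelSum_le (hp : 1 ≤ p) (hb : 4 ≤ b) (e : ℤ → ℕ → ℝ≥0∞) {C : ℝ≥0∞}
    (he : ∀ k h, e k h ≤ C) (α : ℝ≥0) :
    levelSum p b γ e α ≤ C * (lacunaryConst p * ∑' j, ((γ j ^ p : ℝ≥0) : ℝ≥0∞)) := by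
  classical
  rw [levelSum, ENNReal.tsum_eq_iSup_sum]
  refine iSup_le fun K => ?_
  rw [← Finset.sum_filter]
  refine le_trans ?_ (mul_le_mul_right (sum_hit_le γ hp hb α
    (K.filter fun k => ∃ h, α * b ^ k < windowSum γ k h)
    (fun k hk => (Finset.mem_filter.1 hk).2)) C)
  rw [ENNReal.ofNNReal_finsetSum, Finset.mul_sum]
  refine Finset.sum_le_sum fun k _ => ?_
  rw [mul_comm]
  gcongr
  exact he _ _

/-- The constant in `tsum_levelSum_rpow_le`. -/
def levelConst (p s : ℝ) : ℝ≥0∞ :=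
  (((1 - s⁻¹).toNNReal⁻¹ : ℝ≥0) * (lacunaryConst p : ℝ≥0∞) ^ (1 - s⁻¹)) ^ (s - 1) *
    ((lacunaryConst p : ℝ≥0∞) ^ (1 - s⁻¹) * (geomConst p * embeddingConst p s⁻¹))

theorem levelConst_ne_top {s : ℝ} (hp : 1 < p) (hs : 1 < s) : levelConst p s ≠ ∞ := by
  have h1 : 0 ≤ 1 - s⁻¹ := by
    have := inv_lt_one_of_one_lt₀ hs; linarith
  refine ENNReal.mul_ne_top (ENNReal.rpow_ne_top_of_nonneg (by linarith)
    (ENNReal.mul_ne_top ENNReal.coe_ne_top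
      (ENNReal.rpow_ne_top_of_nonneg h1 ENNReal.coe_ne_top))) (ENNReal.mul_ne_top
      (ENNReal.rpow_ne_top_of_nonneg h1 ENNReal.coe_ne_top) (ENNReal.mul_ne_top
        (geomConst_ne_top (by linarith)) (embeddingConst_ne_top hp)))

/-- Hölder with weights `ρ x^(-1/s)`, where `x`, a multiple of the window mass, bounds the partial
sums of the level weights `ρ` (`partialSum_levelWeight_le`). The total weight is then of order
`N^(1-1/s)`, with `N` the sum of all `γ ^ p`. Each term retains the local factor `windowMass ^ (1 -
1/s)`, which is the form that `tsum_window_le` can sum. -/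
theorem sum_hit_rpow_le {s : ℝ} (hs : 1 < s) (hp : 1 ≤ p) (hb : 4 ≤ b) (e : ℤ → ℕ → ℝ≥0∞)
    (α : ℝ≥0) (K : Finset ℤ) (hK : ∀ k ∈ K, ∃ h, α * b ^ k < windowSum γ k h) :
    (∑ k ∈ K, (levelWeight p (α * b ^ k) (levelIndex γ (α * b ^ k) k) : ℝ≥0∞) *
      e k (levelIndex γ (α * b ^ k) k)) ^ s ≤
    (((1 - s⁻¹).toNNReal⁻¹ : ℝ≥0) * (lacunaryConst p : ℝ≥0∞) ^ (1 - s⁻¹)) ^ (s - 1) *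
      (∑' j, ((γ j ^ p : ℝ≥0) : ℝ≥0∞)) ^ ((1 - s⁻¹) * (s - 1)) *
    ∑ k ∈ K, (lacunaryConst p : ℝ≥0∞) ^ (1 - s⁻¹) *
      (e k (levelIndex γ (α * b ^ k) k) ^ s *
      ((levelWeight p (α * b ^ k) (levelIndex γ (α * b ^ k) k) *
        windowMass p γ k (levelIndex γ (α * b ^ k) k) ^ (1 - s⁻¹) : ℝ≥0) : ℝ≥0∞)) := by
  have hs0 : 0 < s := by linarith
  have hβ0 : 0 ≤ s⁻¹ := by positivity
  have hβ1 : s⁻¹ < 1 := inv_lt_one_of_one_lt₀ hs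
  set N := ∑' j, ((γ j ^ p : ℝ≥0) : ℝ≥0∞)
  set hk := fun k => levelIndex γ (α * b ^ k) k with hhk
  set ρ := fun k => levelWeight p (α * b ^ k) (hk k) with hρ
  set x := fun k => lacunaryConst p * windowMass p γ k (hk k) with hx
  have hR : ∀ k ∈ K, ∑ k' ∈ K with k' ≤ k, ρ k' ≤ x k := fun k hkK =>
    partialSum_levelWeight_le (h := hk) hp hb (fun k hk => (lt_windowSum_levelIndex (hK k hk)).le) hkK
  have hρx : ∀ k ∈ K, ρ k ≤ x k := fun k hkK =>
    le_trans (Finset.single_le_sum (f := ρ) (s := {k' ∈ K | k' ≤ k}) (fun _ _ => zero_le)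
      (Finset.mem_filter.2 ⟨hkK, le_rfl⟩)) (hR k hkK)
  have hw : ((∑ k ∈ K, ρ k * x k ^ (-s⁻¹) : ℝ≥0) : ℝ≥0∞) ≤
      ((1 - s⁻¹).toNNReal⁻¹ : ℝ≥0) * (lacunaryConst p * N) ^ (1 - s⁻¹) := by
    refine (ENNReal.coe_le_coe.2 (sum_mul_rpow_neg_le hβ0 hβ1 K ρ x hR)).trans ?_
    rw [ENNReal.coe_mul, ENNReal.coe_rpow_of_nonneg _ (by linarith)]
    gcongr
    exact sum_hit_le γ hp hb α K hK
  have hJ := ENNReal.inner_le_weight_mul_Lp_of_nonneg K hs.le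
    (fun k => ((ρ k * x k ^ (-s⁻¹) : ℝ≥0) : ℝ≥0∞)) (fun k => e k (hk k) * (x k : ℝ≥0∞) ^ s⁻¹)
  have e1 : ∀ k ∈ K, ((ρ k * x k ^ (-s⁻¹) : ℝ≥0) : ℝ≥0∞) * (e k (hk k) * (x k : ℝ≥0∞) ^ s⁻¹) =
      (ρ k : ℝ≥0∞) * e k (hk k) := by
    intro k hkK
    rcases eq_or_ne (x k) 0 with h0 | h0
    · have : ρ k = 0 := le_antisymm ((hρx k hkK).trans h0.le) zero_le
      simp [this]
    · rw [← ENNReal.coe_rpow_of_nonneg _ hβ0, mul_left_comm, ← ENNReal.coe_mul, mul_assoc,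
        ← NNReal.rpow_add h0, neg_add_cancel, NNReal.rpow_zero, mul_one, mul_comm]
  have e2 : ∀ k ∈ K, ((ρ k * x k ^ (-s⁻¹) : ℝ≥0) : ℝ≥0∞) *
      (e k (hk k) * (x k : ℝ≥0∞) ^ s⁻¹) ^ s =
      (lacunaryConst p : ℝ≥0∞) ^ (1 - s⁻¹) * (e k (hk k) ^ s *
        ((ρ k * windowMass p γ k (hk k) ^ (1 - s⁻¹) : ℝ≥0) : ℝ≥0∞)) := by
    intro k hkK
    rcases eq_or_ne (x k) 0 with h0 | h0
    · have : ρ k = 0 := le_antisymm ((hρx k hkK).trans h0.le) zero_le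
      simp [this]
    · rw [ENNReal.mul_rpow_of_nonneg _ _ hs0.le, ← ENNReal.rpow_mul, inv_mul_cancel₀ hs0.ne',
        ENNReal.rpow_one, ← ENNReal.coe_rpow_of_nonneg _ (by linarith : 0 ≤ 1 - s⁻¹)]
      have : x k ^ (-s⁻¹) * x k = lacunaryConst p ^ (1 - s⁻¹) *
          windowMass p γ k (hk k) ^ (1 - s⁻¹) := by
        rw [← NNReal.mul_rpow]
        change x k ^ (-s⁻¹) * x k = x k ^ (1 - s⁻¹)
        rw [sub_eq_add_neg, NNReal.rpow_add h0, NNReal.rpow_one, mul_comm]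
      rw [mul_left_comm, ← ENNReal.coe_mul, mul_left_comm ((lacunaryConst p ^ (1 - s⁻¹) : ℝ≥0) : ℝ≥0∞),
        ← ENNReal.coe_mul, mul_assoc (ρ k), this]
      congr 2
      ring
  rw [Finset.sum_congr rfl e1, Finset.sum_congr rfl e2] at hJ
  refine (ENNReal.rpow_le_rpow hJ hs0.le).trans ?_
  rw [ENNReal.mul_rpow_of_nonneg _ _ hs0.le, ← ENNReal.rpow_mul, ← ENNReal.rpow_mul,
    inv_mul_cancel₀ hs0.ne', ENNReal.rpow_one, sub_mul, one_mul, inv_mul_cancel₀ hs0.ne']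
  gcongr
  rw [← ENNReal.ofNNReal_finsetSum]
  refine (ENNReal.rpow_le_rpow hw (by linarith)).trans_eq ?_
  rw [ENNReal.mul_rpow_of_nonneg _ _ (by linarith : 0 ≤ 1 - s⁻¹), ← mul_assoc,
    ENNReal.mul_rpow_of_nonneg _ _ (by linarith : 0 ≤ s - 1), ← ENNReal.rpow_mul N]

/-- The index selected at each height is replaced by a sum over all `h`. For fixed `k` and `h` the
heights whose level stays below the window sum form a geometric progression, so summing them
replaces the level by the window sum itself. The embedding `tsum_window_le` with `w = e ^ s` then
concludes. -/
theorem tsum_levelSum_rpow_le {s : ℝ} (hs : 1 < s) (hp : 1 < p) (hb : 4 ≤ b)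
    (e : ℤ → ℕ → ℝ≥0∞) (W : ℝ≥0∞)
    (hw : ∀ (h : ℕ) (j : ℤ), ∑ k ∈ Finset.Icc (j - 2) (j + 2 ^ h), e k h ^ s ≤ W)
    {c : ℝ≥0} (hc : 0 < c) :
    ∑' m, levelSum p b γ e (dyadicScale c m) ^ s ≤
      levelConst p s * W * (∑' j, ((γ j ^ p : ℝ≥0) : ℝ≥0∞)) ^ s := by
  classical
  have hs0 : 0 < s := by linarith
  have hβ0 : 0 ≤ s⁻¹ := by positivity
  have hβ1 : s⁻¹ < 1 := inv_lt_one_of_one_lt₀ hs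
  have hb0 : 0 < b := lt_of_lt_of_le (by norm_num) hb
  set N := ∑' j, ((γ j ^ p : ℝ≥0) : ℝ≥0∞) with hN
  set X := (((1 - s⁻¹).toNNReal⁻¹ : ℝ≥0) * (lacunaryConst p : ℝ≥0∞) ^ (1 - s⁻¹)) ^ (s - 1) *
      N ^ ((1 - s⁻¹) * (s - 1)) with hX
  set Y := (lacunaryConst p : ℝ≥0∞) ^ (1 - s⁻¹) with hY
  set V : ℤ → ℕ → ℝ≥0∞ := fun k h => ((windowMass p γ k h ^ (1 - s⁻¹) : ℝ≥0) : ℝ≥0∞) with hV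
  have step1 : ∀ α, levelSum p b γ e α ^ s ≤ X * ∑' k, Y *
      (if ∃ h, α * b ^ k < windowSum γ k h then
        e k (levelIndex γ (α * b ^ k) k) ^ s *
        ((levelWeight p (α * b ^ k) (levelIndex γ (α * b ^ k) k) : ℝ≥0∞) *
          V k (levelIndex γ (α * b ^ k) k)) else 0) := by
    intro α
    rw [levelSum, ← ENNReal.le_rpow_inv_iff hs0, ENNReal.tsum_eq_iSup_sum]
    refine iSup_le fun K => ?_
    rw [ENNReal.le_rpow_inv_iff hs0, ← Finset.sum_filter]
    refine (sum_hit_rpow_le γ hs hp.le hb e α _ (fun k hk => (Finset.mem_filter.1 hk).2)).trans ?_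
    refine mul_le_mul_right ?_ _
    rw [Finset.sum_filter]
    refine (Finset.sum_le_sum fun k _ => ?_).trans (ENNReal.sum_le_tsum K)
    split_ifs with h
    · rw [ENNReal.coe_mul]
    · exact zero_le
  have step2 : ∀ k h, ∑' m, (if dyadicScale c m * b ^ k < windowSum γ k h then
      (levelWeight p (dyadicScale c m * b ^ k) h : ℝ≥0∞) else 0) ≤
      geomConst p * levelWeight p (windowSum γ k h) h := by
    intro k h
    have h1 := tsum_dyadicScale_rpow_le (a := p) (by linarith) (c := c * b ^ k) (by positivity)
      (windowSum γ k h)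
    have h2 : ∀ m, dyadicScale (c * b ^ k) m = dyadicScale c m * b ^ k := fun m => by
      rw [dyadicScale, dyadicScale]; ring
    calc _ = (∑' m, if (dyadicScale (c * b ^ k) m : ℝ≥0∞) < windowSum γ k h then
          (dyadicScale (c * b ^ k) m : ℝ≥0∞) ^ p else 0) *
            (((2 ^ h) ^ (-(p - 1)) : ℝ≥0) : ℝ≥0∞) := by
          rw [← ENNReal.tsum_mul_right]
          refine tsum_congr fun m => ?_
          simp only [h2, ENNReal.coe_lt_coe]
          split_ifs
          · rw [levelWeight, ENNReal.coe_mul, ENNReal.coe_rpow_of_nonneg _ (by linarith : 0 ≤ p)]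
          · simp
      _ ≤ _ := by
          rw [levelWeight, ENNReal.coe_mul, ENNReal.coe_rpow_of_nonneg _ (by linarith : 0 ≤ p),
            ← mul_assoc]
          gcongr
  calc ∑' m, levelSum p b γ e (dyadicScale c m) ^ s
      ≤ ∑' m, X * ∑' k, Y * ∑' h, e k h ^ s * (V k h *
        (if dyadicScale c m * b ^ k < windowSum γ k h then
          (levelWeight p (dyadicScale c m * b ^ k) h : ℝ≥0∞) else 0)) := by
        refine ENNReal.tsum_le_tsum fun m => (step1 _).trans ?_
        gcongr with k
        split_ifs with hh
        · refine le_trans ?_ (ENNReal.le_tsum (levelIndex γ (dyadicScale c m * b ^ k) k))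
          rw [if_pos (lt_windowSum_levelIndex hh), mul_comm (V _ _)]
        · exact zero_le
    _ = X * (Y * ∑' k, ∑' h, e k h ^ s * (V k h *
        ∑' m, (if dyadicScale c m * b ^ k < windowSum γ k h then
          (levelWeight p (dyadicScale c m * b ^ k) h : ℝ≥0∞) else 0))) := by
        simp_rw [← ENNReal.tsum_mul_left]
        rw [ENNReal.tsum_comm]
        exact tsum_congr fun k => ENNReal.tsum_comm
    _ ≤ X * (Y * ∑' k, ∑' h, geomConst p * (e k h ^ s *
        ((levelWeight p (windowSum γ k h) h * windowMass p γ k h ^ (1 - s⁻¹) : ℝ≥0) : ℝ≥0∞))) := by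
        refine mul_le_mul_right (mul_le_mul_right (ENNReal.tsum_le_tsum fun k =>
          ENNReal.tsum_le_tsum fun h => ?_) _) _
        calc _ ≤ e k h ^ s * (V k h * (geomConst p * levelWeight p (windowSum γ k h) h)) := by
              gcongr; exact step2 k h
          _ = _ := by rw [ENNReal.coe_mul]; ring
    _ ≤ X * (Y * (geomConst p * (embeddingConst p s⁻¹ * W * N ^ (2 - s⁻¹)))) := by
        simp_rw [ENNReal.tsum_mul_left]
        gcongr
        exact tsum_window_le hp hβ0 hβ1 γ (fun k h => e k h ^ s) W hw
    _ = _ := by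
        -- The two powers combine because `(1 - 1/s)(s - 1) + (2 - 1/s) = s`.
        have : N ^ s = N ^ ((1 - s⁻¹) * (s - 1)) * N ^ (2 - s⁻¹) := by
          rw [← ENNReal.rpow_add_of_nonneg _ _ (mul_nonneg (by linarith) (by linarith)) (by linarith)]
          congr 1
          field_simp
          ring
        rw [this, levelConst, hX]
        ring

end Levels

end SphericalMaximal
end

noncomputable section
namespace SphericalMaximal

/-! ### The one-dimensional maximal function -/

/-- Vitali's covering lemma: disjoint intervals whose enlargements by the factor `4` cover the level
set, hence the constant `8 = 2 * 4`. The bound `T` on the radii is what the covering lemma requires;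
it does not enter the estimate. -/
theorem volume_maximal_le (g : ℝ → ℝ≥0∞) {T : ℝ} {lam : ℝ≥0} (hl : 0 < lam) :
    volume {r : ℝ | ∃ t, 0 < t ∧ t ≤ T ∧
      (lam : ℝ≥0∞) * ENNReal.ofReal t < ∫⁻ s in Ioo (r - t) (r + t), g s} ≤
      8 * (lam : ℝ≥0∞)⁻¹ * ∫⁻ s, g s := by
  set U := {r : ℝ | ∃ t, 0 < t ∧ t ≤ T ∧
      (lam : ℝ≥0∞) * ENNReal.ofReal t < ∫⁻ s in Ioo (r - t) (r + t), g s} with hU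
  have hl0 : (lam : ℝ≥0∞) ≠ 0 := by simpa using hl.ne'
  choose! R hR0 hRT hR using fun r (hr : r ∈ U) => hr
  obtain ⟨u, huU, hdisj, hcov⟩ := Vitali.exists_disjoint_subfamily_covering_enlargement_ball U
    (fun r => r) R T hRT 4 (by norm_num)
  have hcount : u.Countable := hdisj.countable_of_isOpen (fun _ _ => Metric.isOpen_ball)
    (fun r hr => Metric.nonempty_ball.2 (hR0 r (huU hr)))
  have hsub : U ⊆ ⋃ r ∈ u, Metric.ball r (4 * R r) := by
    intro r hr
    obtain ⟨b, hb, hsub⟩ := hcov r hr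
    exact mem_biUnion hb (hsub (Metric.mem_ball_self (hR0 r hr)))
  have := hcount.to_subtype
  calc volume U ≤ volume (⋃ r ∈ u, Metric.ball r (4 * R r)) := measure_mono hsub
    _ ≤ ∑' r : u, volume (Metric.ball (r : ℝ) (4 * R r)) := measure_biUnion_le volume hcount _
    _ ≤ ∑' r : u, 8 * (lam : ℝ≥0∞)⁻¹ * ∫⁻ s in Metric.ball (r : ℝ) (R r), g s := by
        refine ENNReal.tsum_le_tsum fun r => ?_
        have h1 := (hR r (huU r.2)).le
        rw [Real.volume_ball, Real.ball_eq_Ioo,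
          show 2 * (4 * R r) = 8 * R r by ring, ENNReal.ofReal_mul (by norm_num), mul_assoc]
        have h8 : ENNReal.ofReal 8 = 8 := by simp
        rw [h8]
        gcongr
        rw [mul_comm, ← div_eq_mul_inv,
          ENNReal.le_div_iff_mul_le (Or.inl hl0) (Or.inl ENNReal.coe_ne_top)]
        rwa [mul_comm]
    _ = 8 * (lam : ℝ≥0∞)⁻¹ * ∫⁻ s in ⋃ r ∈ u, Metric.ball (r : ℝ) (R r), g s := by
        rw [ENNReal.tsum_mul_left, lintegral_biUnion hcount (fun _ _ => measurableSet_ball) hdisj]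
    _ ≤ _ := by gcongr; exact Measure.restrict_le_self

/-- The part of `g` below `α / (4C)` contributes at most `α t / 2` over an interval of length `2t`,
so half of the height must come from the large values of `g`. -/
theorem volume_maximal_le_truncated {g : ℝ → ℝ≥0∞} (hg : Measurable g) {T : ℝ} {C α : ℝ≥0}
    (hC : 0 < C) (hα : 0 < α) :
    volume {r : ℝ | ∃ t, 0 < t ∧ t ≤ T ∧
      (α : ℝ≥0∞) * ENNReal.ofReal t < C * ∫⁻ s in Ioo (r - t) (r + t), g s} ≤
      16 * C * (α : ℝ≥0∞)⁻¹ * ∫⁻ s, (if (α : ℝ≥0∞) < 4 * C * g s then g s else 0) := by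
  set g' : ℝ → ℝ≥0∞ := fun s => if (α : ℝ≥0∞) < 4 * C * g s then g s else 0 with hg'
  have hm : Measurable g' := Measurable.ite (measurableSet_lt measurable_const (by fun_prop)) hg
    measurable_const
  have hC0 : (C : ℝ≥0∞) ≠ 0 := by simpa using hC.ne'
  have hle : ∀ s, C * g s ≤ C * g' s + α / 4 := by
    intro s
    simp only [hg']
    split_ifs with h
    · exact le_self_add
    · rw [mul_zero, zero_add, ENNReal.le_div_iff_mul_le (by simp) (by simp)]
      calc (C : ℝ≥0∞) * g s * 4 = 4 * C * g s := by ring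
        _ ≤ α := not_lt.1 h
  refine (measure_mono ?_).trans ((volume_maximal_le g' (T := T) (lam := α / (2 * C))
    (by positivity)).trans_eq ?_)
  · rintro r ⟨t, ht0, htT, ht⟩
    refine ⟨t, ht0, htT, ?_⟩
    have h1 : (C : ℝ≥0∞) * ∫⁻ s in Ioo (r - t) (r + t), g s ≤
        C * (∫⁻ s in Ioo (r - t) (r + t), g' s) + α * ENNReal.ofReal t / 2 := by
      calc _ = ∫⁻ s in Ioo (r - t) (r + t), C * g s := (lintegral_const_mul _ hg).symm
        _ ≤ ∫⁻ s in Ioo (r - t) (r + t), (C * g' s + α / 4) := lintegral_mono hle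
        _ = _ := by
          rw [lintegral_add_right _ measurable_const, lintegral_const_mul _ hm, setLIntegral_const,
            Real.volume_Ioo, show r + t - (r - t) = 2 * t by ring, ENNReal.ofReal_mul (by norm_num)]
          congr 1
          have h2 : ENNReal.ofReal 2 = 2 := by simp
          rw [h2, ← mul_assoc, div_eq_mul_inv, div_eq_mul_inv, mul_assoc (α : ℝ≥0∞)]
          have : (4 : ℝ≥0∞)⁻¹ * 2 = 2⁻¹ := by
            rw [show (4 : ℝ≥0∞) = 2 * 2 by norm_num, ENNReal.mul_inv (by simp) (by simp), mul_assoc,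
              ENNReal.inv_mul_cancel (by simp) (by simp), mul_one]
          rw [this]; ring
    have h3 := ht.trans_le h1
    set y := (α : ℝ≥0∞) * ENNReal.ofReal t with hy
    have hyt : y ≠ ∞ := ENNReal.mul_ne_top ENNReal.coe_ne_top ENNReal.ofReal_ne_top
    have h4 : y / 2 < C * ∫⁻ s in Ioo (r - t) (r + t), g' s := by
      by_contra hcon
      refine absurd h3 (not_lt.2 ?_)
      calc _ ≤ y / 2 + y / 2 := by gcongr; exact not_lt.1 hcon
        _ = y := ENNReal.add_halves y
    have e1 : ((α / (2 * C) : ℝ≥0) : ℝ≥0∞) * ENNReal.ofReal t = y / 2 / C := by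
      rw [ENNReal.coe_div (by positivity), hy, div_eq_mul_inv, div_eq_mul_inv, div_eq_mul_inv,
        ENNReal.coe_mul, ENNReal.mul_inv (by simp) (by simp)]
      push_cast
      ring
    rw [e1]
    exact ENNReal.div_lt_of_lt_mul' h4
  · congr 1
    rw [ENNReal.coe_div (by positivity), ENNReal.inv_div (by simp) (by simp [hα.ne']),
      div_eq_mul_inv]
    push_cast
    ring

/-- The Hardy-Littlewood maximal theorem on the line, in terms of dyadic levels. -/
theorem tsum_volume_maximal_le {g : ℝ → ℝ≥0∞} (hg : Measurable g) {T p : ℝ} (hp : 1 < p)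
    {C c : ℝ≥0} (hC : 0 < C) (hc : 0 < c) :
    ∑' m, (dyadicScale c m : ℝ≥0∞) ^ p * volume {r : ℝ | ∃ t, 0 < t ∧ t ≤ T ∧
      (dyadicScale c m : ℝ≥0∞) * ENNReal.ofReal t < C * ∫⁻ s in Ioo (r - t) (r + t), g s} ≤
      16 * C * (geomConst (p - 1) * (4 * C) ^ (p - 1)) * ∫⁻ s, g s ^ p := by
  have hp1 : 0 < p - 1 := by linarith
  have hα : ∀ m, (dyadicScale c m : ℝ≥0∞) ≠ 0 := fun m => by
    simpa using (dyadicScale_pos hc m).ne'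
  have hm : ∀ m : ℤ, Measurable fun s => (if (dyadicScale c m : ℝ≥0∞) < 4 * C * g s
      then (dyadicScale c m : ℝ≥0∞) ^ (p - 1) else 0) := fun m =>
    Measurable.ite (measurableSet_lt measurable_const (by fun_prop)) measurable_const
      measurable_const
  calc _ ≤ ∑' m, 16 * C * ∫⁻ s, (if (dyadicScale c m : ℝ≥0∞) < 4 * C * g s
          then (dyadicScale c m : ℝ≥0∞) ^ (p - 1) else 0) * g s := by
        refine ENNReal.tsum_le_tsum fun m => ?_
        refine (mul_le_mul_right (volume_maximal_le_truncated hg hC (dyadicScale_pos hc m)) _).trans_eq ?_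
        have e1 : (dyadicScale c m : ℝ≥0∞) ^ p * (dyadicScale c m : ℝ≥0∞)⁻¹ =
            (dyadicScale c m : ℝ≥0∞) ^ (p - 1) := by
          rw [← ENNReal.rpow_neg_one, ← ENNReal.rpow_add _ _ (hα m) ENNReal.coe_ne_top, sub_eq_add_neg]
        have e2 : ∀ s, (if (dyadicScale c m : ℝ≥0∞) < 4 * C * g s
            then (dyadicScale c m : ℝ≥0∞) ^ (p - 1) else 0) * g s =
            (dyadicScale c m : ℝ≥0∞) ^ (p - 1) *
              (if (dyadicScale c m : ℝ≥0∞) < 4 * C * g s then g s else 0) := by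
          intro s; split_ifs <;> simp
        simp_rw [e2]
        rw [lintegral_const_mul _ (Measurable.ite (measurableSet_lt measurable_const (by fun_prop))
          hg measurable_const), ← e1]
        ring
    _ = 16 * C * ∫⁻ s, (∑' m, if (dyadicScale c m : ℝ≥0∞) < 4 * C * g s
          then (dyadicScale c m : ℝ≥0∞) ^ (p - 1) else 0) * g s := by
        rw [ENNReal.tsum_mul_left, ← lintegral_tsum (f := fun (m : ℤ) s =>
          (if (dyadicScale c m : ℝ≥0∞) < 4 * C * g s
            then (dyadicScale c m : ℝ≥0∞) ^ (p - 1) else 0) * g s)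
          fun m => ((hm m).mul hg).aemeasurable]
        simp_rw [ENNReal.tsum_mul_right]
    _ ≤ 16 * C * ∫⁻ s, (geomConst (p - 1) * (4 * C) ^ (p - 1)) * g s ^ p := by
        refine mul_le_mul_right (lintegral_mono fun s => ?_) _
        have hs : g s ^ p = g s ^ (p - 1) * g s := by
          conv_rhs => rw [← ENNReal.rpow_one (g s), ← ENNReal.rpow_mul, one_mul,
            ← ENNReal.rpow_add_of_nonneg _ _ hp1.le zero_le_one, sub_add_cancel]
        calc _ ≤ geomConst (p - 1) * (4 * C * g s) ^ (p - 1) * g s := by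
              gcongr; exact tsum_dyadicScale_rpow_le hp1 hc _
          _ = _ := by
              rw [ENNReal.mul_rpow_of_nonneg _ _ hp1.le, hs]
              ring
    _ = _ := by
        rw [lintegral_const_mul _ (hg.pow_const _)]
        ring

end SphericalMaximal
end

noncomputable section
namespace SphericalMaximal

/-! ### Bounds for the kernel -/

theorem sphericalKernel_le (d : ℕ) {r t s : ℝ} (hr : 0 < r) (ht : 0 < t) (hs : 0 ≤ s) :
    sphericalKernel d t r s ≤ s / (r * t) := by
  have h2 : (0 : ℝ) < 2 * r * t := by positivity
  have h1 : Real.sqrt ((s ^ 2 - (r - t) ^ 2) * ((r + t) ^ 2 - s ^ 2)) / (2 * r * t) ≤ 1 := by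
    rw [div_le_one h2]
    refine Real.sqrt_le_iff.2 ⟨h2.le, ?_⟩
    nlinarith [sq_nonneg (s ^ 2 - r ^ 2 - t ^ 2)]
  unfold sphericalKernel
  have h3 : 0 ≤ s / (r * t) := by positivity
  exact mul_le_of_le_one_right h3 (pow_le_one₀ (by positivity) h1)

/-- The bracket in the kernel is the sine of an angle of the triangle. The first factor under its
root is at most `s²`, the second at most `(4t)²` because `r < 2t`, so the bracket is at most `2s/r`.
Its `d - 3` powers combine with `s / (r t) ≤ 2 s / r²`. -/
theorem sphericalKernel_le_pow {d : ℕ} (hd : 3 ≤ d) {r t s : ℝ} (hr : 0 < r) (h1 : r / 2 < t)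
    (hs : |r - t| < s) (hs' : s < r + t) :
    sphericalKernel d t r s ≤ 2 ^ d * (s ^ (d - 2) / r ^ (d - 1)) := by
  have ht : 0 < t := by linarith
  have hs0 : 0 < s := (abs_nonneg _).trans_lt hs
  have hsq : (r - t) ^ 2 ≤ s ^ 2 := sq_le_sq' (by linarith [neg_abs_le (r - t)])
    (by linarith [le_abs_self (r - t)])
  have hbr : Real.sqrt ((s ^ 2 - (r - t) ^ 2) * ((r + t) ^ 2 - s ^ 2)) / (2 * r * t) ≤
      2 * s / r := by
    have h2 : (0 : ℝ) < 2 * r * t := by positivity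
    rw [div_le_iff₀ h2]
    refine Real.sqrt_le_iff.2 ⟨by positivity, ?_⟩
    have e1 : 2 * s / r * (2 * r * t) = s * (4 * t) := by field_simp; ring
    rw [e1, mul_pow]
    refine mul_le_mul (by nlinarith) ?_ (by nlinarith) (by positivity)
    nlinarith
  obtain ⟨n, rfl⟩ : ∃ n, d = n + 3 := ⟨d - 3, by omega⟩
  unfold sphericalKernel
  rw [show n + 3 - 3 = n by omega, show n + 3 - 2 = n + 1 by omega, show n + 3 - 1 = n + 2 by omega]
  calc _ ≤ s * (2 / r ^ 2) * (2 * s / r) ^ n := by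
        refine mul_le_mul ?_ (pow_le_pow_left₀ (by positivity) hbr n) (by positivity)
          (by positivity)
        rw [div_eq_mul_inv]
        refine mul_le_mul_of_nonneg_left ?_ hs0.le
        rw [inv_eq_one_div, div_le_div_iff₀ (by positivity) (by positivity)]
        nlinarith
    _ = 2 ^ (n + 1) * (s ^ (n + 1) / r ^ (n + 2)) := by
        rw [div_pow, mul_pow]; field_simp; ring
    _ ≤ _ := by gcongr <;> norm_num

/-- A lower bound for the kernel near the sphere. -/
theorem le_sphericalKernel {d : ℕ} (hd : 3 ≤ d) {r t s : ℝ} (ht : 0 < t) (hs0 : 0 < s)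
    (hs : 2 * |r - t| ≤ s) (hs' : s ≤ r) :
    4⁻¹ ^ d * (s ^ (d - 2) / (r * t) ^ (d - 2) * t ^ (d - 3)) ≤ sphericalKernel d t r s := by
  have hr : 0 < r := hs0.trans_le hs'
  have hsq : (r - t) ^ 2 ≤ s ^ 2 / 4 := by
    have : (r - t) ^ 2 ≤ (s / 2) ^ 2 := sq_le_sq' (by linarith [neg_abs_le (r - t)])
      (by linarith [le_abs_self (r - t)])
    nlinarith
  have hbr : s * t / (4 * (r * t)) ≤
      Real.sqrt ((s ^ 2 - (r - t) ^ 2) * ((r + t) ^ 2 - s ^ 2)) / (2 * r * t) := by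
    rw [div_le_div_iff₀ (by positivity) (by positivity)]
    have : s * t / 2 ≤ Real.sqrt ((s ^ 2 - (r - t) ^ 2) * ((r + t) ^ 2 - s ^ 2)) := by
      refine Real.le_sqrt_of_sq_le ?_
      calc (s * t / 2) ^ 2 = (s ^ 2 / 4) * t ^ 2 := by ring
        _ ≤ _ := by
          refine mul_le_mul ?_ ?_ (by positivity) ?_
          all_goals nlinarith
    calc s * t * (2 * r * t) = s * t / 2 * (4 * (r * t)) := by ring
      _ ≤ _ := by gcongr
  obtain ⟨n, rfl⟩ : ∃ n, d = n + 3 := ⟨d - 3, by omega⟩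
  unfold sphericalKernel
  rw [show n + 3 - 3 = n by omega, show n + 3 - 2 = n + 1 by omega]
  calc _ ≤ 4⁻¹ ^ n * (s ^ (n + 1) / (r * t) ^ (n + 1) * t ^ n) := by
        refine mul_le_mul_of_nonneg_right ?_ (by positivity)
        exact pow_le_pow_of_le_one (by norm_num) (by norm_num) (by omega)
    _ = s / (r * t) * (s * t / (4 * (r * t))) ^ n := by
        rw [div_pow, mul_pow s t, mul_pow 4, pow_succ s, pow_succ (r * t), inv_pow]
        field_simp
    _ ≤ _ := by gcongr

/-! ### Dyadic shells -/

/-- The dyadic interval `[2^k, 2^(k+1))`. -/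
def shell (k : ℤ) : Set ℝ := Ico ((2 : ℝ) ^ k) ((2 : ℝ) ^ (k + 1))

theorem two_zpow_pos (k : ℤ) : (0 : ℝ) < 2 ^ k := by positivity

theorem two_zpow_succ (k : ℤ) : (2 : ℝ) ^ (k + 1) = 2 * 2 ^ k := by
  rw [zpow_add_one₀ two_ne_zero, mul_comm]

theorem measurableSet_shell (k : ℤ) : MeasurableSet (shell k) := measurableSet_Ico

theorem shell_subset_Ioi (k : ℤ) : shell k ⊆ Ioi 0 := fun _ hr => (two_zpow_pos k).trans_le hr.1

theorem exists_mem_shell {r : ℝ} (hr : 0 < r) : ∃ k, r ∈ shell k :=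
  exists_mem_Ico_zpow hr one_lt_two

theorem iUnion_shell : ⋃ k, shell k = Ioi 0 := by
  refine subset_antisymm (iUnion_subset shell_subset_Ioi) fun r hr => ?_
  exact mem_iUnion.2 (exists_mem_shell hr)

theorem pairwise_disjoint_shell : Pairwise (Function.onFun Disjoint shell) := by
  intro i j hij
  rw [Function.onFun, Set.disjoint_left]
  rintro r ⟨h1, h2⟩ ⟨h3, h4⟩
  have a := (zpow_lt_zpow_iff_right₀ one_lt_two).1 (h1.trans_lt h4)
  have b := (zpow_lt_zpow_iff_right₀ one_lt_two).1 (h3.trans_lt h2)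
  omega

theorem volume_shell (k : ℤ) : volume (shell k) = ENNReal.ofReal (2 ^ k) := by
  rw [shell, Real.volume_Ico, two_zpow_succ]
  congr 1; ring

variable {d : ℕ}

theorem volume_norm_mem_eq (hd : 1 ≤ d) {B : Set ℝ} (hB : MeasurableSet B) :
    volume {x : EuclideanSpace ℝ (Fin d) | ‖x‖ ∈ B} =
      (volume : Measure (EuclideanSpace ℝ (Fin d))).toSphere univ *
        ∫⁻ r in Ioi 0 ∩ B, ENNReal.ofReal (r ^ (d - 1)) := by
  have : Nonempty (Fin d) := ⟨⟨0, hd⟩⟩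
  have h1 := lintegral_fun_norm_eq (volume : Measure (EuclideanSpace ℝ (Fin d)))
    (Φ := B.indicator 1) (measurable_const.indicator hB)
  rw [finrank_euclideanSpace_fin] at h1
  have h2 : ∀ x : EuclideanSpace ℝ (Fin d), B.indicator (1 : ℝ → ℝ≥0∞) ‖x‖ =
      {x : EuclideanSpace ℝ (Fin d) | ‖x‖ ∈ B}.indicator 1 x := fun x => rfl
  simp_rw [h2] at h1
  rw [lintegral_indicator_one (s := {x : EuclideanSpace ℝ (Fin d) | ‖x‖ ∈ B}) (measurable_norm hB)] at h1
  rw [h1, inter_comm, ← Measure.restrict_restrict hB, ← lintegral_indicator hB]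
  congr 2
  ext r
  by_cases hr : r ∈ B <;> simp [hr]

theorem volume_norm_mem_shell_le (hd : 1 ≤ d) {U : Set ℝ} {k : ℤ} (hU : U ⊆ shell k) :
    volume {x : EuclideanSpace ℝ (Fin d) | ‖x‖ ∈ U} ≤
      (volume : Measure (EuclideanSpace ℝ (Fin d))).toSphere univ *
        (ENNReal.ofReal ((2 ^ (k + 1)) ^ (d - 1)) * volume U) := by
  -- No measurability of the level sets is available, so `U` is replaced by a measurable hull cut
  -- down to the shell.
  have hB := (measurableSet_toMeasurable volume U).inter (measurableSet_shell k)
  calc _ ≤ volume {x : EuclideanSpace ℝ (Fin d) | ‖x‖ ∈ toMeasurable volume U ∩ shell k} :=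
        measure_mono fun x hx => ⟨subset_toMeasurable _ _ hx, hU hx⟩
    _ = _ := volume_norm_mem_eq hd hB
    _ ≤ (volume : Measure (EuclideanSpace ℝ (Fin d))).toSphere univ *
        ∫⁻ r in Ioi 0 ∩ (toMeasurable volume U ∩ shell k),
          ENNReal.ofReal ((2 ^ (k + 1)) ^ (d - 1)) := by
        refine mul_le_mul_right (setLIntegral_mono' (measurableSet_Ioi.inter hB) fun r hr => ?_) _
        exact ENNReal.ofReal_le_ofReal (pow_le_pow_left₀ (le_of_lt hr.1) hr.2.2.2.le _)
    _ ≤ _ := by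
        rw [setLIntegral_const]
        refine mul_le_mul_right (mul_le_mul_right ?_ _) _
        calc _ ≤ volume (toMeasurable volume U) := measure_mono fun r hr => hr.2.1
          _ = _ := measure_toMeasurable U

theorem le_volume_norm_mem_shell (hd : 1 ≤ d) {U : Set ℝ} (hm : MeasurableSet U) {k : ℤ}
    (hU : U ⊆ Ici (2 ^ k)) :
    (volume : Measure (EuclideanSpace ℝ (Fin d))).toSphere univ *
        (ENNReal.ofReal ((2 ^ k) ^ (d - 1)) * volume U) ≤
    volume {x : EuclideanSpace ℝ (Fin d) | ‖x‖ ∈ U} := by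
  rw [volume_norm_mem_eq hd hm, ← setLIntegral_const]
  have h0 : Ioi 0 ∩ U = U := inter_eq_right.2 fun r hr => (two_zpow_pos k).trans_le (hU hr)
  rw [h0]
  refine mul_le_mul_right (setLIntegral_mono' hm fun r hr => ?_) _
  exact ENNReal.ofReal_le_ofReal (pow_le_pow_left₀ (two_zpow_pos k).le (hU hr) _)

theorem volume_norm_mem_le (hd : 1 ≤ d) {U : Set ℝ} (hU : U ⊆ Ioi 0) :
    volume {x : EuclideanSpace ℝ (Fin d) | ‖x‖ ∈ U} ≤
      (volume : Measure (EuclideanSpace ℝ (Fin d))).toSphere univ *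
        ∑' k : ℤ, ENNReal.ofReal ((2 ^ (k + 1)) ^ (d - 1)) * volume (U ∩ shell k) := by
  calc _ ≤ volume (⋃ k, {x : EuclideanSpace ℝ (Fin d) | ‖x‖ ∈ U ∩ shell k}) := by
        refine measure_mono fun x hx => ?_
        obtain ⟨k, hk⟩ := exists_mem_shell (hU hx)
        exact mem_iUnion.2 ⟨k, hx, hk⟩
    _ ≤ ∑' k, volume {x : EuclideanSpace ℝ (Fin d) | ‖x‖ ∈ U ∩ shell k} := measure_iUnion_le _
    _ ≤ _ := by
        rw [← ENNReal.tsum_mul_left]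
        exact ENNReal.tsum_le_tsum fun k => volume_norm_mem_shell_le hd inter_subset_right

theorem tsum_shell_lintegral (F : ℝ → ℝ≥0∞) :
    ∑' k, ∫⁻ s in shell k, F s = ∫⁻ s in Ioi 0, F s := by
  rw [← iUnion_shell, lintegral_iUnion measurableSet_shell pairwise_disjoint_shell]

end SphericalMaximal
end

noncomputable section
namespace SphericalMaximal

/-! ### Spheres whose radius is not comparable to the distance of the centre -/

variable {d : ℕ} {p : ℝ} {G : ℝ → ℝ≥0∞}

/-- The weighted `L^p` mass of a radial profile. -/
def profileMass (d : ℕ) (p : ℝ) (G : ℝ → ℝ≥0∞) : ℝ≥0∞ :=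
  ∫⁻ s in Ioi (0 : ℝ), ENNReal.ofReal (s ^ (d - 1)) * G s ^ p

/-- After exchanging sum and integral, a point `s` is counted only for `2^(k-1) < s`. The weights
`2^((k+1)(d-1))` grow geometrically in `k`, so they add up to a multiple of `s^(d-1)`. -/
theorem tsum_tail_le (hd : 3 ≤ d) (hG : Measurable G) :
    ∑' k : ℤ, ENNReal.ofReal ((2 ^ (k + 1)) ^ (d - 1)) * ∫⁻ s in Ioi ((2 : ℝ) ^ (k - 1)), G s ^ p ≤
      4 ^ (d - 1) * geomConst ((d - 1 : ℕ) : ℝ) * profileMass d p G := by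
  have hd1 : (0 : ℝ) < ((d - 1 : ℕ) : ℝ) := by exact_mod_cast (by omega : 0 < d - 1)
  have hm : ∀ k : ℤ, Measurable fun s => (Ioi ((2 : ℝ) ^ (k - 1))).indicator (fun s => G s ^ p) s :=
    fun k => (hG.pow_const p).indicator measurableSet_Ioi
  have e1 : ∀ k : ℤ, ENNReal.ofReal (((2 : ℝ) ^ (k + 1)) ^ (d - 1)) =
      4 ^ (d - 1) * (dyadicScale (1 / 2) k : ℝ≥0∞) ^ ((d - 1 : ℕ) : ℝ) := by
    intro k
    have h2 : (2 : ℝ) ^ (k + 1) = ((4 * dyadicScale (1 / 2) k : ℝ≥0) : ℝ) := by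
      simp only [dyadicScale]
      push_cast
      rw [two_zpow_succ]; ring
    rw [h2, ← NNReal.coe_pow, ENNReal.ofReal_coe_nnreal, ENNReal.rpow_natCast, mul_pow]
    push_cast
    rfl
  have e2 : ∀ k : ℤ, ((dyadicScale (1 / 2) k : ℝ≥0) : ℝ) = 2 ^ (k - 1) := by
    intro k
    simp only [dyadicScale]
    push_cast
    rw [zpow_sub_one₀ two_ne_zero]; ring
  have e3 : ∀ (k : ℤ) (s : ℝ), 0 < s →
      ENNReal.ofReal (((2 : ℝ) ^ (k + 1)) ^ (d - 1)) *
        (Ioi ((2 : ℝ) ^ (k - 1))).indicator (fun s => G s ^ p) s =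
      4 ^ (d - 1) * ((if (dyadicScale (1 / 2) k : ℝ≥0∞) < ENNReal.ofReal s then
        (dyadicScale (1 / 2) k : ℝ≥0∞) ^ ((d - 1 : ℕ) : ℝ) else 0) * G s ^ p) := by
    intro k s hs
    have : (dyadicScale (1 / 2) k : ℝ≥0∞) < ENNReal.ofReal s ↔ s ∈ Ioi ((2 : ℝ) ^ (k - 1)) := by
      rw [mem_Ioi, ← e2, ← ENNReal.ofReal_coe_nnreal, ENNReal.ofReal_lt_ofReal_iff hs]
    rw [e1]
    by_cases h : s ∈ Ioi ((2 : ℝ) ^ (k - 1))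
    · rw [indicator_of_mem h, if_pos (this.2 h)]; ring
    · rw [indicator_of_notMem h, if_neg (mt this.1 h)]; simp
  calc _ = ∑' k : ℤ, ∫⁻ s in Ioi 0, ENNReal.ofReal ((2 ^ (k + 1)) ^ (d - 1)) *
        (Ioi ((2 : ℝ) ^ (k - 1))).indicator (fun s => G s ^ p) s := by
        congr 1; ext k
        rw [lintegral_const_mul _ (hm k), lintegral_indicator measurableSet_Ioi,
          Measure.restrict_restrict measurableSet_Ioi,
          inter_eq_left.2 (Ioi_subset_Ioi (two_zpow_pos _).le)]
    _ = ∫⁻ s in Ioi 0, ∑' k : ℤ, ENNReal.ofReal ((2 ^ (k + 1)) ^ (d - 1)) *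
        (Ioi ((2 : ℝ) ^ (k - 1))).indicator (fun s => G s ^ p) s :=
        (lintegral_tsum fun k => ((hm k).const_mul _).aemeasurable).symm
    _ ≤ ∫⁻ s in Ioi 0, 4 ^ (d - 1) * geomConst ((d - 1 : ℕ) : ℝ) *
        (ENNReal.ofReal (s ^ (d - 1)) * G s ^ p) := by
        refine setLIntegral_mono' measurableSet_Ioi fun s hs => ?_
        simp_rw [e3 _ s hs]
        rw [ENNReal.tsum_mul_left, ENNReal.tsum_mul_right, mul_assoc, ← mul_assoc (geomConst _)]
        refine mul_le_mul_right (mul_le_mul_left ?_ _) _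
        refine (tsum_dyadicScale_rpow_le hd1 (by norm_num) _).trans_eq ?_
        rw [ENNReal.rpow_natCast, ENNReal.ofReal_pow (le_of_lt hs)]
    _ = _ := by
        rw [lintegral_const_mul _ (by fun_prop), profileMass]

theorem radialMean_le_of_le {t r B : ℝ} (hB : ∀ s ∈ Ioo |r - t| (r + t), sphericalKernel d t r s ≤ B) :
    radialMean d G t r ≤ kernelConst d * (ENNReal.ofReal B * ∫⁻ s in Ioo |r - t| (r + t), G s) := by
  unfold radialMean
  refine mul_le_mul_right ?_ _
  rw [← lintegral_const_mul' _ _ ENNReal.ofReal_ne_top]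
  exact setLIntegral_mono' measurableSet_Ioo fun s hs =>
    mul_le_mul_left (ENNReal.ofReal_le_ofReal (hB s hs)) _

/-- The distances at which some mean over a small sphere exceeds `α`. -/
def smallRadiusLevel (d : ℕ) (G : ℝ → ℝ≥0∞) (α : ℝ≥0∞) : Set ℝ :=
  {r | 0 < r ∧ ∃ t, 0 < t ∧ t ≤ r / 2 ∧ α < radialMean d G t r}

/-- The distances at which some mean over a large sphere exceeds `α`. -/
def largeRadiusLevel (d : ℕ) (G : ℝ → ℝ≥0∞) (α : ℝ≥0∞) : Set ℝ :=
  {r | 0 < r ∧ ∃ t, 2 * r ≤ t ∧ α < radialMean d G t r}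

/-- For `t ≤ r/2` one has `s < r + t ≤ 2r`, so the kernel is at most `2/t` and the mean is dominated
by an average over `(r - t, r + t)`. This interval lies to the right of `r/2 ≥ 2^(k-1)`, so the
estimate on a shell involves only a tail of the profile. -/
theorem smallRadiusLevel_inter_shell_subset (hd : 3 ≤ d) (α : ℝ≥0) (k : ℤ) :
    smallRadiusLevel d G α ∩ shell k ⊆ {r : ℝ | ∃ t, 0 < t ∧ t ≤ (2 : ℝ) ^ k ∧
      (α : ℝ≥0∞) * ENNReal.ofReal t < ((2 * kernelConst d).toNNReal : ℝ≥0∞) *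
        ∫⁻ s in Ioo (r - t) (r + t), (Ioi ((2 : ℝ) ^ (k - 1))).indicator G s} := by
  rintro r ⟨⟨hr, t, ht, htr, hα⟩, hk⟩
  have hk2 := hk.2
  rw [two_zpow_succ] at hk2
  refine ⟨t, ht, by linarith, ?_⟩
  rw [ENNReal.coe_toNNReal (ENNReal.mul_ne_top (by simp) (kernelConst_ne_top hd))]
  have habs : |r - t| = r - t := abs_of_pos (by linarith)
  have h1 : radialMean d G t r ≤ _ := radialMean_le_of_le (B := 2 / t) (by
    rw [habs]
    intro s hs
    refine (sphericalKernel_le d hr ht (by linarith [hs.1])).trans ?_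
    rw [div_le_div_iff₀ (by positivity) ht]
    nlinarith [hs.2])
  have h2 := hα.trans_le h1
  rw [habs] at h2
  have h3 : ∫⁻ s in Ioo (r - t) (r + t), (Ioi ((2 : ℝ) ^ (k - 1))).indicator G s =
      ∫⁻ s in Ioo (r - t) (r + t), G s := by
    refine setLIntegral_congr_fun measurableSet_Ioo fun s hs => indicator_of_mem ?_ _
    have := hk.1
    rw [mem_Ioi, zpow_sub_one₀ two_ne_zero]
    linarith [hs.1]
  rw [h3]
  have ht0 : ENNReal.ofReal t ≠ 0 := by simpa using ht
  calc (α : ℝ≥0∞) * ENNReal.ofReal t < kernelConst d * (ENNReal.ofReal (2 / t) *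
          ∫⁻ s in Ioo (r - t) (r + t), G s) * ENNReal.ofReal t :=
        ENNReal.mul_lt_mul_left ht0 ENNReal.ofReal_ne_top h2
    _ = _ := by
        rw [ENNReal.ofReal_div_of_pos ht, div_eq_mul_inv]
        calc _ = ENNReal.ofReal 2 * kernelConst d * (∫⁻ s in Ioo (r - t) (r + t), G s) *
              ((ENNReal.ofReal t)⁻¹ * ENNReal.ofReal t) := by ring
          _ = _ := by
            rw [ENNReal.inv_mul_cancel ht0 ENNReal.ofReal_ne_top, mul_one]; simp

/-- The constant in the bound for small radii. -/
def smallRadiusConst (d : ℕ) (p : ℝ) : ℝ≥0∞ :=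
  (volume : Measure (EuclideanSpace ℝ (Fin d))).toSphere univ *
    (16 * ((2 * kernelConst d).toNNReal : ℝ≥0∞) * (geomConst (p - 1) *
      (4 * ((2 * kernelConst d).toNNReal : ℝ≥0∞)) ^ (p - 1)) *
      (4 ^ (d - 1) * geomConst ((d - 1 : ℕ) : ℝ)))

/-- A strong type bound expressed through dyadic heights. A single term gives the weak type
estimate, and the inclusion `ℓ¹ ⊆ ℓ^(q/p)` gives what the Lorentz estimate needs. -/
theorem tsum_smallRadiusLevel_le (hd : 3 ≤ d) (hp : 1 < p) (hG : Measurable G) {c : ℝ≥0}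
    (hc : 0 < c) :
    ∑' m, (dyadicScale c m : ℝ≥0∞) ^ p *
      volume {x : EuclideanSpace ℝ (Fin d) | ‖x‖ ∈ smallRadiusLevel d G (dyadicScale c m)} ≤
      smallRadiusConst d p * profileMass d p G := by
  have hC : 0 < (2 * kernelConst d).toNNReal := ENNReal.toNNReal_pos
    (mul_ne_zero (by simp) (kernelConst_ne_zero hd))
    (ENNReal.mul_ne_top (by simp) (kernelConst_ne_top hd))
  calc _ ≤ ∑' m, (dyadicScale c m : ℝ≥0∞) ^ p *
        ((volume : Measure (EuclideanSpace ℝ (Fin d))).toSphere univ *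
        ∑' k : ℤ, ENNReal.ofReal ((2 ^ (k + 1)) ^ (d - 1)) *
          volume (smallRadiusLevel d G (dyadicScale c m) ∩ shell k)) :=
        ENNReal.tsum_le_tsum fun m => mul_le_mul_right
          (volume_norm_mem_le (by omega) fun r hr => hr.1) _
    _ = (volume : Measure (EuclideanSpace ℝ (Fin d))).toSphere univ *
        ∑' k : ℤ, ENNReal.ofReal ((2 ^ (k + 1)) ^ (d - 1)) * ∑' m, (dyadicScale c m : ℝ≥0∞) ^ p *
          volume (smallRadiusLevel d G (dyadicScale c m) ∩ shell k) := by
        simp_rw [← ENNReal.tsum_mul_left]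
        rw [ENNReal.tsum_comm]
        congr 1; ext k; congr 1; ext m; ring
    _ ≤ (volume : Measure (EuclideanSpace ℝ (Fin d))).toSphere univ *
        ∑' k : ℤ, ENNReal.ofReal ((2 ^ (k + 1)) ^ (d - 1)) *
          (16 * ((2 * kernelConst d).toNNReal : ℝ≥0∞) * (geomConst (p - 1) *
            (4 * ((2 * kernelConst d).toNNReal : ℝ≥0∞)) ^ (p - 1)) *
          ∫⁻ s in Ioi ((2 : ℝ) ^ (k - 1)), G s ^ p) := by
        refine mul_le_mul_right (ENNReal.tsum_le_tsum fun k => mul_le_mul_right ?_ _) _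
        refine (ENNReal.tsum_le_tsum fun m => mul_le_mul_right (measure_mono
          (smallRadiusLevel_inter_shell_subset hd _ k)) _).trans
          ((tsum_volume_maximal_le (hG.indicator measurableSet_Ioi) hp hC hc).trans_eq ?_)
        congr 1
        rw [← lintegral_indicator measurableSet_Ioi]
        congr 1; ext s
        by_cases hs : s ∈ Ioi ((2 : ℝ) ^ (k - 1))
        · simp only [indicator_of_mem hs]
        · simp only [indicator_of_notMem hs]; exact ENNReal.zero_rpow_of_pos (by linarith)
    _ = (volume : Measure (EuclideanSpace ℝ (Fin d))).toSphere univ *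
          (16 * ((2 * kernelConst d).toNNReal : ℝ≥0∞) * (geomConst (p - 1) *
            (4 * ((2 * kernelConst d).toNNReal : ℝ≥0∞)) ^ (p - 1)) *
        ∑' k : ℤ, ENNReal.ofReal ((2 ^ (k + 1)) ^ (d - 1)) *
          ∫⁻ s in Ioi ((2 : ℝ) ^ (k - 1)), G s ^ p) := by
        congr 1
        rw [← ENNReal.tsum_mul_left]
        exact tsum_congr fun k => by ring
    _ ≤ _ := mul_le_mul_right (mul_le_mul_right (tsum_tail_le hd hG) _) _
    _ = _ := by rw [smallRadiusConst]; ring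

theorem smallRadiusConst_ne_top (hd : 3 ≤ d) (hp : 1 < p) : smallRadiusConst d p ≠ ∞ := by
  have h1 : (0 : ℝ) < ((d - 1 : ℕ) : ℝ) := by exact_mod_cast (by omega : 0 < d - 1)
  refine ENNReal.mul_ne_top toSphere_univ_ne_top (ENNReal.mul_ne_top (ENNReal.mul_ne_top
    (ENNReal.mul_ne_top (by simp) ENNReal.coe_ne_top) (ENNReal.mul_ne_top
    (geomConst_ne_top (by linarith)) (ENNReal.rpow_ne_top_of_nonneg (by linarith)
    (ENNReal.mul_ne_top (by simp) ENNReal.coe_ne_top)))) (ENNReal.mul_ne_top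
    (ENNReal.pow_ne_top (by simp)) (geomConst_ne_top h1)))

theorem setLIntegral_le_rpow_mul {p : ℝ} (hp : 1 < p) (hG : Measurable G) (I : Set ℝ) :
    ∫⁻ s in I, G s ≤ (∫⁻ s in I, G s ^ p) ^ (1 / p) * volume I ^ (1 - 1 / p) := by
  have hpq := Real.HolderConjugate.conjExponent hp
  have h := ENNReal.lintegral_mul_le_Lp_mul_Lq (volume.restrict I) hpq hG.aemeasurable
    (g := 1) aemeasurable_const
  have e : 1 / p.conjExponent = 1 - 1 / p := by
    have := hpq.inv_add_inv_eq_one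
    rw [one_div, one_div]; linarith
  simpa [e] using h

/-- Here `s < r + t ≤ 3t/2`, so the kernel is at most `2/r` on an interval of length `2r`, and
Hölder applies. The bound depends neither on `t` nor on the position of `r` in the shell, so a
height at or above it is exceeded nowhere in the shell. -/
theorem radialMean_large_le (hp : 1 < p) (hG : Measurable G) {r t : ℝ} {k : ℤ} (hk : r ∈ shell k)
    (ht : 2 * r ≤ t) :
    radialMean d G t r ≤ 4 * kernelConst d *
      ((ENNReal.ofReal (2 ^ k))⁻¹ * ∫⁻ s in Ioi ((2 : ℝ) ^ (k - 1)), G s ^ p) ^ (1 / p) := by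
  have hr : 0 < r := shell_subset_Ioi k hk
  have ht0 : 0 < t := by linarith
  have habs : |r - t| = t - r := by rw [abs_sub_comm]; exact abs_of_pos (by linarith)
  have h1 : radialMean d G t r ≤ _ := radialMean_le_of_le (B := 4 / (2 * r)) (by
    rw [habs]
    intro s hs
    refine (sphericalKernel_le d hr ht0 (by linarith [hs.1])).trans ?_
    rw [div_le_div_iff₀ (by positivity) (by positivity)]
    nlinarith [hs.2, mul_pos hr ht0])
  refine h1.trans ?_
  rw [habs, mul_comm 4 (kernelConst d), mul_assoc]
  refine mul_le_mul_right ?_ _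
  set V := ENNReal.ofReal (2 * r) with hV
  have hV0 : V ≠ 0 := by simpa [hV] using hr
  have hVt : V ≠ ∞ := ENNReal.ofReal_ne_top
  have hvol : volume (Ioo (t - r) (r + t)) = V := by
    rw [Real.volume_Ioo, hV]; congr 1; ring
  have hp0 : 0 ≤ 1 / p := by positivity
  calc _ ≤ 4 * V⁻¹ * ((∫⁻ s in Ioo (t - r) (r + t), G s ^ p) ^ (1 / p) * V ^ (1 - 1 / p)) := by
        rw [ENNReal.ofReal_div_of_pos (by positivity), ← hV, div_eq_mul_inv, ← hvol]
        refine (mul_le_mul_right (setLIntegral_le_rpow_mul hp hG _) _).trans_eq ?_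
        simp
    _ = 4 * (V⁻¹ * ∫⁻ s in Ioo (t - r) (r + t), G s ^ p) ^ (1 / p) := by
        rw [ENNReal.mul_rpow_of_nonneg _ _ hp0, ENNReal.rpow_sub _ _ hV0 hVt, ENNReal.rpow_one,
          ENNReal.inv_rpow, div_eq_mul_inv V]
        calc _ = 4 * ((V ^ (1 / p))⁻¹ * (∫⁻ s in Ioo (t - r) (r + t), G s ^ p) ^ (1 / p)) *
              (V⁻¹ * V) := by ring
          _ = _ := by rw [ENNReal.inv_mul_cancel hV0 hVt, mul_one]
    _ ≤ _ := by
        refine mul_le_mul_right (ENNReal.rpow_le_rpow (mul_le_mul' ?_ ?_) hp0) _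
        · exact ENNReal.inv_le_inv.2 (ENNReal.ofReal_le_ofReal (by linarith [hk.1]))
        · refine lintegral_mono_set fun s hs => ?_
          have := hk.1
          rw [mem_Ioi, zpow_sub_one₀ two_ne_zero]
          linarith [hs.1, two_zpow_pos k]

/-- The constant in the bound for large radii. -/
def largeRadiusConst (d : ℕ) (p : ℝ) : ℝ≥0∞ :=
  (volume : Measure (EuclideanSpace ℝ (Fin d))).toSphere univ *
    (geomConst p * (4 * kernelConst d) ^ p * (4 ^ (d - 1) * geomConst ((d - 1 : ℕ) : ℝ)))

theorem largeRadiusConst_ne_top (hd : 3 ≤ d) (hp : 1 < p) : largeRadiusConst d p ≠ ∞ := by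
  have h1 : (0 : ℝ) < ((d - 1 : ℕ) : ℝ) := by exact_mod_cast (by omega : 0 < d - 1)
  refine ENNReal.mul_ne_top toSphere_univ_ne_top (ENNReal.mul_ne_top (ENNReal.mul_ne_top
    (geomConst_ne_top (by linarith)) (ENNReal.rpow_ne_top_of_nonneg (by linarith)
    (ENNReal.mul_ne_top (by simp) (kernelConst_ne_top hd)))) (ENNReal.mul_ne_top
    (ENNReal.pow_ne_top (by simp)) (geomConst_ne_top h1)))

theorem tsum_largeRadiusLevel_le (hd : 3 ≤ d) (hp : 1 < p) (hG : Measurable G) {c : ℝ≥0}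
    (hc : 0 < c) :
    ∑' m, (dyadicScale c m : ℝ≥0∞) ^ p *
      volume {x : EuclideanSpace ℝ (Fin d) | ‖x‖ ∈ largeRadiusLevel d G (dyadicScale c m)} ≤
      largeRadiusConst d p * profileMass d p G := by
  have hp0 : 0 < p := by linarith
  set X : ℤ → ℝ≥0∞ := fun k => 4 * kernelConst d *
      ((ENNReal.ofReal (2 ^ k))⁻¹ * ∫⁻ s in Ioi ((2 : ℝ) ^ (k - 1)), G s ^ p) ^ (1 / p) with hX
  have hvol : ∀ (m k : ℤ), (dyadicScale c m : ℝ≥0∞) ^ p *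
      volume (largeRadiusLevel d G (dyadicScale c m) ∩ shell k) ≤
      (if (dyadicScale c m : ℝ≥0∞) < X k then (dyadicScale c m : ℝ≥0∞) ^ p else 0) *
        ENNReal.ofReal (2 ^ k) := by
    intro m k
    split_ifs with h
    · exact mul_le_mul_right ((measure_mono inter_subset_right).trans_eq (volume_shell k)) _
    · have : largeRadiusLevel d G (dyadicScale c m) ∩ shell k = ∅ := by
        refine eq_empty_of_forall_notMem ?_
        rintro r ⟨⟨hr, t, ht, hα⟩, hk⟩
        exact h (hα.trans_le (radialMean_large_le hp hG hk ht))
      simp [this]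
  calc _ ≤ ∑' m, (dyadicScale c m : ℝ≥0∞) ^ p *
        ((volume : Measure (EuclideanSpace ℝ (Fin d))).toSphere univ *
        ∑' k : ℤ, ENNReal.ofReal ((2 ^ (k + 1)) ^ (d - 1)) *
          volume (largeRadiusLevel d G (dyadicScale c m) ∩ shell k)) :=
        ENNReal.tsum_le_tsum fun m => mul_le_mul_right
          (volume_norm_mem_le (by omega) fun r hr => hr.1) _
    _ = (volume : Measure (EuclideanSpace ℝ (Fin d))).toSphere univ *
        ∑' k : ℤ, ENNReal.ofReal ((2 ^ (k + 1)) ^ (d - 1)) * ∑' m, (dyadicScale c m : ℝ≥0∞) ^ p *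
          volume (largeRadiusLevel d G (dyadicScale c m) ∩ shell k) := by
        simp_rw [← ENNReal.tsum_mul_left]
        rw [ENNReal.tsum_comm]
        congr 1; ext k; congr 1; ext m; ring
    _ ≤ (volume : Measure (EuclideanSpace ℝ (Fin d))).toSphere univ *
        ∑' k : ℤ, ENNReal.ofReal ((2 ^ (k + 1)) ^ (d - 1)) *
          (geomConst p * (4 * kernelConst d) ^ p * ∫⁻ s in Ioi ((2 : ℝ) ^ (k - 1)), G s ^ p) := by
        refine mul_le_mul_right (ENNReal.tsum_le_tsum fun k => mul_le_mul_right ?_ _) _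
        refine (ENNReal.tsum_le_tsum fun m => hvol m k).trans ?_
        rw [ENNReal.tsum_mul_right]
        refine (mul_le_mul_left (tsum_dyadicScale_rpow_le hp0 hc _) _).trans_eq ?_
        have h0 : ENNReal.ofReal (2 ^ k) ≠ 0 := by simpa using two_zpow_pos k
        simp only [hX]
        rw [ENNReal.mul_rpow_of_nonneg _ _ hp0.le, ← ENNReal.rpow_mul, one_div_mul_cancel hp0.ne',
          ENNReal.rpow_one]
        calc _ = geomConst p * (4 * kernelConst d) ^ p * (∫⁻ s in Ioi ((2 : ℝ) ^ (k - 1)), G s ^ p) *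
              ((ENNReal.ofReal (2 ^ k))⁻¹ * ENNReal.ofReal (2 ^ k)) := by ring
          _ = _ := by rw [ENNReal.inv_mul_cancel h0 ENNReal.ofReal_ne_top, mul_one]
    _ = (volume : Measure (EuclideanSpace ℝ (Fin d))).toSphere univ *
          (geomConst p * (4 * kernelConst d) ^ p *
        ∑' k : ℤ, ENNReal.ofReal ((2 ^ (k + 1)) ^ (d - 1)) *
          ∫⁻ s in Ioi ((2 : ℝ) ^ (k - 1)), G s ^ p) := by
        congr 1
        rw [← ENNReal.tsum_mul_left]
        exact tsum_congr fun k => by ring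
    _ ≤ _ := mul_le_mul_right (mul_le_mul_right (tsum_tail_le hd hG) _) _
    _ = _ := by rw [largeRadiusConst]; ring

end SphericalMaximal
end

noncomputable section
namespace SphericalMaximal

/-! ### Spheres whose radius is comparable to the distance of the centre -/

variable {d : ℕ} {p : ℝ} {G : ℝ → ℝ≥0∞}

/-- The weighted `L^p` norm of a radial profile on a dyadic shell. -/
def shellNorm (d : ℕ) (p : ℝ) (G : ℝ → ℝ≥0∞) (j : ℤ) : ℝ≥0 :=
  (∫⁻ s in shell j, ENNReal.ofReal (s ^ (d - 1)) * G s ^ p).toNNReal ^ (1 / p)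

theorem shellNorm_rpow (hp : 0 < p) (hG : profileMass d p G ≠ ∞) (j : ℤ) :
    ((shellNorm d p G j ^ p : ℝ≥0) : ℝ≥0∞) =
      ∫⁻ s in shell j, ENNReal.ofReal (s ^ (d - 1)) * G s ^ p := by
  rw [shellNorm, ← NNReal.rpow_mul, one_div_mul_cancel hp.ne', NNReal.rpow_one,
    ENNReal.coe_toNNReal]
  exact ne_top_of_le_ne_top hG (lintegral_mono_set (shell_subset_Ioi j))

theorem tsum_shellNorm_rpow (hp : 0 < p) (hG : profileMass d p G ≠ ∞) :
    ∑' j, ((shellNorm d p G j ^ p : ℝ≥0) : ℝ≥0∞) = profileMass d p G := by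
  simp_rw [shellNorm_rpow hp hG]
  exact tsum_shell_lintegral _

theorem one_lt_criticalExponent (hd : 3 ≤ d) (hp : p = (d : ℝ) / ((d : ℝ) - 1)) : 1 < p := by
  have : (3 : ℝ) ≤ d := by exact_mod_cast hd
  rw [hp, one_lt_div (by linarith)]; linarith

/-- Hölder on the shell. The powers of `2^j` combine to `(d-2) - (d-1)/p + 1 - 1/p = d - 1 - d/p`,
which vanishes precisely at the critical exponent. -/
theorem setLIntegral_shell_le (hd : 3 ≤ d) (hp : p = (d : ℝ) / ((d : ℝ) - 1))
    (hm : Measurable G) (hG : profileMass d p G ≠ ∞) (j : ℤ) :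
    ∫⁻ s in shell j, ENNReal.ofReal (s ^ (d - 2)) * G s ≤ 2 ^ (d - 2) * shellNorm d p G j := by
  have hp1 := one_lt_criticalExponent hd hp
  have hD : (3 : ℝ) ≤ d := by exact_mod_cast hd
  have hp0 : 0 < p := by linarith
  have hx : (0 : ℝ) < 2 ^ j := two_zpow_pos j
  set x : ℝ≥0∞ := ENNReal.ofReal (2 ^ j) with hxdef
  have hx0 : x ≠ 0 := by simpa [hxdef] using hx
  have hxt : x ≠ ∞ := ENNReal.ofReal_ne_top
  have h1 : ∫⁻ s in shell j, ENNReal.ofReal (s ^ (d - 2)) * G s ≤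
      2 ^ (d - 2) * x ^ (d - 2) * ∫⁻ s in shell j, G s := by
    rw [← lintegral_const_mul _ hm]
    refine setLIntegral_mono' (measurableSet_shell j) fun s hs => mul_le_mul_left ?_ _
    have hs0 : 0 ≤ s := (shell_subset_Ioi j hs : (0 : ℝ) < s).le
    calc ENNReal.ofReal (s ^ (d - 2)) ≤ ENNReal.ofReal ((2 * 2 ^ j) ^ (d - 2)) := by
          refine ENNReal.ofReal_le_ofReal (pow_le_pow_left₀ hs0 ?_ _)
          rw [← two_zpow_succ]; exact hs.2.le
      _ = _ := by
          rw [mul_pow, ENNReal.ofReal_mul (by positivity), ENNReal.ofReal_pow (by norm_num),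
            ENNReal.ofReal_pow hx.le]; simp [hxdef]
  have h2 : x ^ (d - 1) * ∫⁻ s in shell j, G s ^ p ≤ ((shellNorm d p G j ^ p : ℝ≥0) : ℝ≥0∞) := by
    rw [shellNorm_rpow hp0 hG, ← lintegral_const_mul _ (hm.pow_const p)]
    refine setLIntegral_mono' (measurableSet_shell j) fun s hs => mul_le_mul_left ?_ _
    rw [hxdef, ← ENNReal.ofReal_pow hx.le]
    exact ENNReal.ofReal_le_ofReal (pow_le_pow_left₀ hx.le hs.1 _)
  have h3 : (∫⁻ s in shell j, G s ^ p) ^ (1 / p) ≤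
      x ^ (-((d : ℝ) - 1) / p) * shellNorm d p G j := by
    have h4 : ∫⁻ s in shell j, G s ^ p ≤
        x ^ (-((d : ℝ) - 1)) * ((shellNorm d p G j ^ p : ℝ≥0) : ℝ≥0∞) := by
      refine le_trans (le_of_eq ?_) (mul_le_mul_right h2 _)
      rw [← mul_assoc, ← ENNReal.rpow_natCast, ← ENNReal.rpow_add _ _ hx0 hxt,
        Nat.cast_sub (by omega), Nat.cast_one, neg_add_cancel, ENNReal.rpow_zero, one_mul]
    refine (ENNReal.rpow_le_rpow h4 (by positivity)).trans_eq ?_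
    rw [ENNReal.mul_rpow_of_nonneg _ _ (by positivity), ← ENNReal.rpow_mul,
      ENNReal.coe_rpow_of_nonneg _ hp0.le, ← ENNReal.rpow_mul, mul_one_div_cancel hp0.ne',
      ENNReal.rpow_one, mul_one_div]
  calc _ ≤ 2 ^ (d - 2) * x ^ (d - 2) *
        ((∫⁻ s in shell j, G s ^ p) ^ (1 / p) * volume (shell j) ^ (1 - 1 / p)) :=
        h1.trans (mul_le_mul_right (setLIntegral_le_rpow_mul hp1 hm _) _)
    _ ≤ 2 ^ (d - 2) * x ^ (d - 2) * ((x ^ (-((d : ℝ) - 1) / p) * shellNorm d p G j) *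
        x ^ (1 - 1 / p)) := by
        rw [volume_shell]; exact mul_le_mul_right (mul_le_mul_left h3 _) _
    _ = 2 ^ (d - 2) * shellNorm d p G j *
        (x ^ (d - 2) * x ^ (-((d : ℝ) - 1) / p) * x ^ (1 - 1 / p)) := by ring
    _ = _ := by
        rw [← ENNReal.rpow_natCast x, ← ENNReal.rpow_add _ _ hx0 hxt,
          ← ENNReal.rpow_add _ _ hx0 hxt, Nat.cast_sub (by omega)]
        have : ((d : ℝ) - ((2 : ℕ) : ℝ) + -((d : ℝ) - 1) / p + (1 - 1 / p)) = 0 := by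
          rw [hp]
          have : (d : ℝ) - 1 ≠ 0 := by linarith
          have : (d : ℝ) ≠ 0 := by linarith
          push_cast
          field_simp
          ring
        rw [this, ENNReal.rpow_zero, mul_one]

/-- The constant in the bound for comparable radii. -/
def nearConst (d : ℕ) : ℝ≥0 := (kernelConst d).toNNReal * (2 ^ d * 2 ^ (d - 2))

theorem nearConst_pos (hd : 3 ≤ d) : 0 < nearConst d :=
  mul_pos (ENNReal.toNNReal_pos (kernelConst_ne_zero hd) (kernelConst_ne_top hd)) (by positivity)

/-- The range of integration meets only shells with `k - 2^h ≤ j ≤ k + 2`: the lower end is the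
hypothesis on `|r - t|`, the upper end is `r + t < 3r < 6 * 2^k < 2^(k+3)`. The factor `r^(-(d-1))`
of the kernel is absorbed by `2^(k(d-1))`. -/
theorem radialMean_near_mul_le (hd : 3 ≤ d) (hp : p = (d : ℝ) / ((d : ℝ) - 1))
    (hm : Measurable G) (hG : profileMass d p G ≠ ∞) {k : ℤ} {r t : ℝ} (hr : r ∈ shell k)
    (h1 : r / 2 < t) (h2 : t < 2 * r) {h : ℕ} (hh : (2 : ℝ) ^ (k - 2 ^ h) ≤ |r - t|) :
    radialMean d G t r * (((2 ^ (d - 1) : ℝ≥0) ^ k : ℝ≥0) : ℝ≥0∞) ≤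
      nearConst d * windowSum (shellNorm d p G) k h := by
  have hr0 : 0 < r := shell_subset_Ioi k hr
  set b : ℝ≥0 := 2 ^ (d - 1) with hb
  have hbk : ((b ^ k : ℝ≥0) : ℝ≥0∞) = ENNReal.ofReal ((2 ^ k) ^ (d - 1)) := by
    rw [← ENNReal.ofReal_coe_nnreal]
    congr 1
    rw [hb]; push_cast
    rw [← zpow_natCast, ← zpow_natCast, ← zpow_mul, ← zpow_mul, mul_comm]
  have hsub : Ioo |r - t| (r + t) ⊆ ⋃ j ∈ Finset.Icc (k - 2 ^ h) (k + 2), shell j := by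
    intro s hs
    have hs0 : 0 < s := (abs_nonneg _).trans_lt hs.1
    obtain ⟨j, hj⟩ := exists_mem_shell hs0
    refine mem_biUnion (x := j) ?_ hj
    have a1 := (zpow_lt_zpow_iff_right₀ one_lt_two).1 ((hh.trans hs.1.le).trans_lt hj.2)
    have a2 : (2 : ℝ) ^ j < 2 ^ (k + 3) := by
      have e : (2 : ℝ) ^ (k + 3) = 8 * 2 ^ k := by
        rw [zpow_add₀ two_ne_zero]; norm_num; ring
      have := hr.2
      rw [two_zpow_succ] at this
      rw [e]; linarith [hj.1, hs.2, two_zpow_pos k]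
    have a3 := (zpow_lt_zpow_iff_right₀ one_lt_two).1 a2
    simp only [Finset.coe_Icc, mem_Icc]
    omega
  have hintegral : ∫⁻ s in Ioo |r - t| (r + t), ENNReal.ofReal (s ^ (d - 2)) * G s ≤
      2 ^ (d - 2) * windowSum (shellNorm d p G) k h := by
    calc _ ≤ ∫⁻ s in ⋃ j ∈ Finset.Icc (k - 2 ^ h) (k + 2), shell j,
          ENNReal.ofReal (s ^ (d - 2)) * G s := lintegral_mono_set hsub
      _ = ∑ j ∈ Finset.Icc (k - 2 ^ h) (k + 2), ∫⁻ s in shell j,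
          ENNReal.ofReal (s ^ (d - 2)) * G s :=
          lintegral_biUnion_finset (fun i _ j _ hij => pairwise_disjoint_shell hij)
            (fun j _ => measurableSet_shell j) _
      _ ≤ ∑ j ∈ Finset.Icc (k - 2 ^ h) (k + 2), 2 ^ (d - 2) * (shellNorm d p G j : ℝ≥0∞) :=
          Finset.sum_le_sum fun j _ => setLIntegral_shell_le hd hp hm hG j
      _ = _ := by rw [← Finset.mul_sum, windowSum, ENNReal.ofNNReal_finsetSum]
  have hker : ∫⁻ s in Ioo |r - t| (r + t), ENNReal.ofReal (sphericalKernel d t r s) * G s ≤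
      ENNReal.ofReal (2 ^ d / r ^ (d - 1)) *
        ∫⁻ s in Ioo |r - t| (r + t), ENNReal.ofReal (s ^ (d - 2)) * G s := by
    rw [← lintegral_const_mul' _ _ ENNReal.ofReal_ne_top]
    refine setLIntegral_mono' measurableSet_Ioo fun s hs => ?_
    rw [← mul_assoc, ← ENNReal.ofReal_mul (by positivity)]
    refine mul_le_mul_left (ENNReal.ofReal_le_ofReal ?_) _
    refine (sphericalKernel_le_pow hd hr0 h1 hs.1 hs.2).trans_eq ?_
    ring
  have hcst : ENNReal.ofReal (2 ^ d / r ^ (d - 1)) * ((b ^ k : ℝ≥0) : ℝ≥0∞) ≤ 2 ^ d := by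
    rw [hbk, ← ENNReal.ofReal_mul (by positivity)]
    have : (2 : ℝ≥0∞) ^ d = ENNReal.ofReal (2 ^ d) := by
      rw [ENNReal.ofReal_pow (by norm_num)]; simp
    rw [this]
    refine ENNReal.ofReal_le_ofReal ?_
    rw [div_mul_eq_mul_div, div_le_iff₀ (by positivity)]
    exact mul_le_mul_of_nonneg_left (pow_le_pow_left₀ (two_zpow_pos k).le hr.1 _) (by positivity)
  calc _ ≤ kernelConst d * (ENNReal.ofReal (2 ^ d / r ^ (d - 1)) *
        (2 ^ (d - 2) * windowSum (shellNorm d p G) k h)) * ((b ^ k : ℝ≥0) : ℝ≥0∞) := by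
        rw [radialMean]
        exact mul_le_mul_left (mul_le_mul_right (hker.trans (mul_le_mul_right hintegral _)) _) _
    _ = kernelConst d * (ENNReal.ofReal (2 ^ d / r ^ (d - 1)) * ((b ^ k : ℝ≥0) : ℝ≥0∞)) *
        (2 ^ (d - 2) * windowSum (shellNorm d p G) k h) := by ring
    _ ≤ kernelConst d * 2 ^ d * (2 ^ (d - 2) * windowSum (shellNorm d p G) k h) :=
        mul_le_mul_left (mul_le_mul_right hcst _) _
    _ = _ := by
        rw [nearConst]; push_cast
        rw [ENNReal.coe_toNNReal (kernelConst_ne_top hd)]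
        ring

/-- The distances at which some mean over a sphere of comparable radius in `E` exceeds `α`. -/
def nearLevel (d : ℕ) (E : Set ℝ) (G : ℝ → ℝ≥0∞) (α : ℝ≥0∞) : Set ℝ :=
  {r | 0 < r ∧ ∃ t ∈ E, r / 2 < t ∧ t < 2 * r ∧ α < radialMean d G t r}

/-- The points of a shell close to `E` at the scale given by `h`. -/
def proximitySet (E : Set ℝ) (k : ℤ) (h : ℕ) : Set ℝ :=
  {r ∈ shell k | h ≠ 0 → ∃ t ∈ E, r / 2 < t ∧ t < 2 * r ∧ |r - t| < (2 : ℝ) ^ (k - 2 ^ (h - 1))}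

/-- The normalized size of `proximitySet`. -/
def proximityDensity (p : ℝ) (E : Set ℝ) (k : ℤ) (h : ℕ) : ℝ≥0∞ :=
  ((2 : ℝ≥0∞) ^ h) ^ (p - 1) * (volume (proximitySet E k h) / ENNReal.ofReal (2 ^ k))

theorem volume_proximitySet (p : ℝ) (E : Set ℝ) (k : ℤ) (h : ℕ) :
    volume (proximitySet E k h) =
      ENNReal.ofReal (2 ^ k) * (((2 : ℝ≥0∞) ^ h) ^ (-(p - 1)) * proximityDensity p E k h) := by
  have h0 : (2 : ℝ≥0∞) ^ h ≠ 0 := by positivity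
  have ht : (2 : ℝ≥0∞) ^ h ≠ ∞ := ENNReal.pow_ne_top (by simp)
  have hk : ENNReal.ofReal (2 ^ k) ≠ 0 := by simpa using two_zpow_pos k
  rw [proximityDensity, ← mul_assoc (((2 : ℝ≥0∞) ^ h) ^ (-(p - 1))), ← ENNReal.rpow_add _ _ h0 ht,
    neg_add_cancel, ENNReal.rpow_zero, one_mul, ENNReal.mul_div_cancel hk ENNReal.ofReal_ne_top]

/-- If the window of depth `2^(h-1)` is too light, a radius with `|r - t| ≥ 2^(k - 2^(h-1))` cannot
produce a mean above the height. For `h = 0` only membership in the shell is claimed. -/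
theorem nearLevel_inter_shell_subset (hd : 3 ≤ d) (hp : p = (d : ℝ) / ((d : ℝ) - 1))
    (hm : Measurable G) (hG : profileMass d p G ≠ ∞) (E : Set ℝ) (α : ℝ≥0) {k : ℤ} {h : ℕ}
    (hh : h ≠ 0 → windowSum (shellNorm d p G) k (h - 1) ≤ α * (2 ^ (d - 1)) ^ k) :
    nearLevel d E G ((nearConst d * α : ℝ≥0) : ℝ≥0∞) ∩ shell k ⊆ proximitySet E k h := by
  rintro r ⟨⟨hr, t, htE, h1, h2, hα⟩, hk⟩
  refine ⟨hk, fun h0 => ⟨t, htE, h1, h2, ?_⟩⟩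
  by_contra hcon
  have h3 := radialMean_near_mul_le hd hp hm hG hk h1 h2 (not_lt.1 hcon)
  have hb0 : (((2 ^ (d - 1) : ℝ≥0) ^ k : ℝ≥0) : ℝ≥0∞) ≠ 0 := by
    rw [ENNReal.coe_ne_zero]; positivity
  have h4 := (ENNReal.mul_lt_mul_left hb0 ENNReal.coe_ne_top hα).trans_le h3
  rw [← ENNReal.coe_mul, ← ENNReal.coe_mul, ENNReal.coe_lt_coe, mul_assoc,
    mul_lt_mul_iff_right₀ (nearConst_pos hd)] at h4
  exact absurd h4 (not_lt.2 (hh h0))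

/-- On each shell `h` is the first index whose window exceeds the level, so the preceding window is
too light and `r` lies in the proximity set for `h`. The measure of the shell in `ℝ^d` is of order
`2^(kd) = (2^(k(d-1)))^p`, which turns `α^p` into the `p`-th power of the level. -/
theorem volume_nearLevel_le (hd : 3 ≤ d) (hp : p = (d : ℝ) / ((d : ℝ) - 1))
    (hm : Measurable G) (hG : profileMass d p G ≠ ∞) (E : Set ℝ) {C : ℝ≥0∞} (hC : C ≠ ∞)
    (he : ∀ k h, proximityDensity p E k h ≤ C) (α : ℝ≥0) :
    (α : ℝ≥0∞) ^ p * volume {x : EuclideanSpace ℝ (Fin d) |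
        ‖x‖ ∈ nearLevel d E G ((nearConst d * α : ℝ≥0) : ℝ≥0∞)} ≤
      (volume : Measure (EuclideanSpace ℝ (Fin d))).toSphere univ * 2 ^ (d - 1) *
        levelSum p (2 ^ (d - 1)) (shellNorm d p G) (proximityDensity p E) α := by
  classical
  have hp1 := one_lt_criticalExponent hd hp
  have hD : (3 : ℝ) ≤ d := by exact_mod_cast hd
  have hp0 : 0 < p := by linarith
  set U := nearLevel d E G ((nearConst d * α : ℝ≥0) : ℝ≥0∞) with hU
  set γ := shellNorm d p G with hγ
  have hpow : ∀ k : ℤ, ((((2 ^ (d - 1) : ℝ≥0) ^ k) ^ p : ℝ≥0) : ℝ≥0∞) =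
      ENNReal.ofReal ((2 ^ k) ^ (d - 1)) * ENNReal.ofReal (2 ^ k) := by
    intro k
    have h1 : ((2 ^ (d - 1) : ℝ≥0) ^ k) ^ p = ((2 : ℝ≥0) ^ k) ^ d := by
      rw [← zpow_natCast, ← zpow_mul, mul_comm, zpow_mul, zpow_natCast, ← NNReal.rpow_natCast,
        ← NNReal.rpow_mul, Nat.cast_sub (by omega), hp, Nat.cast_one,
        mul_div_cancel₀ _ (by linarith), NNReal.rpow_natCast]
    rw [h1, ← ENNReal.ofReal_mul (by positivity), ← pow_succ, ← ENNReal.ofReal_coe_nnreal,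
      Nat.sub_add_cancel (by omega)]
    push_cast; rfl
  have key : ∀ k : ℤ, (α : ℝ≥0∞) ^ p * (ENNReal.ofReal ((2 ^ (k + 1)) ^ (d - 1)) *
      volume (U ∩ shell k)) ≤ 2 ^ (d - 1) * (if ∃ h, α * (2 ^ (d - 1)) ^ k < windowSum γ k h then
    (levelWeight p (α * (2 ^ (d - 1)) ^ k) (levelIndex γ (α * (2 ^ (d - 1)) ^ k) k) : ℝ≥0∞) *
      proximityDensity p E k (levelIndex γ (α * (2 ^ (d - 1)) ^ k) k) else 0) := by
    intro k
    split_ifs with hh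
    · set h := levelIndex γ (α * (2 ^ (d - 1)) ^ k) k with hhdef
      have hsub : U ∩ shell k ⊆ proximitySet E k h :=
        nearLevel_inter_shell_subset hd hp hm hG E α fun h0 =>
          windowSum_le_of_lt_levelIndex (Nat.sub_lt (Nat.pos_of_ne_zero h0) one_pos)
      have h2 : ((2 : ℝ≥0) ^ h) ≠ 0 := by positivity
      have e1 : ENNReal.ofReal (((2 : ℝ) ^ (k + 1)) ^ (d - 1)) =
          2 ^ (d - 1) * ENNReal.ofReal ((2 ^ k) ^ (d - 1)) := by
        rw [two_zpow_succ, mul_pow, ENNReal.ofReal_mul (by positivity),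
          ENNReal.ofReal_pow (by norm_num)]; simp
      refine (mul_le_mul_right (mul_le_mul_right (measure_mono hsub) _) _).trans_eq ?_
      rw [volume_proximitySet p, levelWeight, NNReal.mul_rpow, ENNReal.coe_mul, ENNReal.coe_mul,
        hpow, ENNReal.coe_rpow_of_nonneg _ hp0.le, ENNReal.coe_rpow_of_ne_zero h2, e1]
      push_cast
      ring
    -- If no window exceeds the level, the inclusion into the proximity set holds for every `h`. The
    -- measures of these sets tend to zero because the densities are bounded and `p > 1`.
    · have hz : volume (U ∩ shell k) = 0 := by
        have hlim : Filter.Tendsto (fun h : ℕ => ENNReal.ofReal (2 ^ k) *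
            (((2 : ℝ≥0∞) ^ (-(p - 1))) ^ h * C)) Filter.atTop (nhds 0) := by
          have h1 : (2 : ℝ≥0∞) ^ (-(p - 1)) < 1 :=
            ENNReal.rpow_lt_one_of_one_lt_of_neg (by norm_num) (by linarith)
          have h2 := ENNReal.tendsto_pow_atTop_nhds_zero_of_lt_one h1
          have h3 := ENNReal.Tendsto.mul_const h2 (b := C) (Or.inr hC)
          have h4 := ENNReal.Tendsto.const_mul h3 (a := ENNReal.ofReal (2 ^ k))
            (Or.inr ENNReal.ofReal_ne_top)
          simpa using h4
        refine le_antisymm (ge_of_tendsto' hlim fun h => ?_) zero_le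
        have hsub : U ∩ shell k ⊆ proximitySet E k h :=
          nearLevel_inter_shell_subset hd hp hm hG E α fun h0 => not_lt.1 fun hlt => hh ⟨_, hlt⟩
        refine (measure_mono hsub).trans ?_
        rw [volume_proximitySet p]
        refine mul_le_mul_right (mul_le_mul' (le_of_eq ?_) (he k h)) _
        rw [← ENNReal.rpow_natCast, ← ENNReal.rpow_natCast, ← ENNReal.rpow_mul, ← ENNReal.rpow_mul,
          mul_comm]
      simp [hz]
  calc _ ≤ (α : ℝ≥0∞) ^ p * ((volume : Measure (EuclideanSpace ℝ (Fin d))).toSphere univ *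
        ∑' k : ℤ, ENNReal.ofReal ((2 ^ (k + 1)) ^ (d - 1)) * volume (U ∩ shell k)) :=
        mul_le_mul_right (volume_norm_mem_le (by omega) fun r hr => hr.1) _
    _ = (volume : Measure (EuclideanSpace ℝ (Fin d))).toSphere univ *
        ∑' k : ℤ, (α : ℝ≥0∞) ^ p * (ENNReal.ofReal ((2 ^ (k + 1)) ^ (d - 1)) *
          volume (U ∩ shell k)) := by rw [ENNReal.tsum_mul_left]; ring
    _ ≤ _ := by
        rw [mul_assoc, levelSum, ← ENNReal.tsum_mul_left (a := (2 : ℝ≥0∞) ^ (d - 1))]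
        exact mul_le_mul_right (ENNReal.tsum_le_tsum key) _

end SphericalMaximal
end

noncomputable section
namespace SphericalMaximal

/-! ### Entropy numbers and neighbourhoods -/

theorem volume_thickening_le {A : Set ℝ} {a ρ : ℝ} (ha : 0 < a) (hρ : 0 < ρ) :
    volume {r : ℝ | ∃ t ∈ A, |r - t| < ρ} ≤ entropyNumber A a * ENNReal.ofReal (a + 2 * ρ) := by
  have hc0 : ENNReal.ofReal (a + 2 * ρ) ≠ 0 := by
    rw [ne_eq, ENNReal.ofReal_eq_zero, not_le]; positivity
  rw [← ENNReal.div_le_iff_le_mul (Or.inl hc0) (Or.inl ENNReal.ofReal_ne_top)]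
  refine le_iInf₂ fun S hS => ?_
  rw [ENNReal.div_le_iff_le_mul (Or.inl hc0) (Or.inl ENNReal.ofReal_ne_top)]
  calc _ ≤ volume (⋃ c ∈ S, Ioo (c - ρ) (c + a + ρ)) := by
        refine measure_mono ?_
        rintro r ⟨t, ht, hr⟩
        obtain ⟨c, hc, hct⟩ := mem_iUnion₂.1 (hS ht)
        refine mem_iUnion₂.2 ⟨c, hc, ?_⟩
        have := abs_lt.1 hr
        exact ⟨by linarith [hct.1], by linarith [hct.2]⟩
    _ ≤ ∑ c ∈ S, volume (Ioo (c - ρ) (c + a + ρ)) := measure_biUnion_finset_le _ _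
    _ = _ := by
        rw [Finset.sum_congr rfl fun c _ => show volume (Ioo (c - ρ) (c + a + ρ)) =
          ENNReal.ofReal (a + 2 * ρ) by rw [Real.volume_Ioo]; congr 1; ring]
        simp

/-- A radius in `(r/2, 2r)` lies in one of the dyadic pieces with index `k - 1`, `k`, `k + 1`. The
covering intervals have length at most `2 * 2^k δ` and are widened by `2^k δ` on both sides, hence
the factor `4`. -/
theorem volume_proximitySet_le (E : Set ℝ) (k : ℤ) {h : ℕ} (hh : h ≠ 0) {δ : ℝ} (hδ : 0 < δ)
    (hδh : (2 : ℝ) ^ (k - 2 ^ (h - 1)) = 2 ^ k * δ) :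
    volume (proximitySet E k h) ≤ 4 * ENNReal.ofReal δ * ENNReal.ofReal (2 ^ k) *
      ∑ i ∈ Finset.Icc (-1 : ℤ) 1, entropyNumber (dyadicPiece E (k + i)) (2 ^ (k + i) * δ) := by
  have hk := two_zpow_pos k
  have hi : ∀ i ∈ Finset.Icc (-1 : ℤ) 1, (2 : ℝ) ^ (k + i) ≤ 2 * 2 ^ k := by
    intro i hi
    rw [← two_zpow_succ]
    exact zpow_le_zpow_right₀ one_le_two (by have := Finset.mem_Icc.1 hi; omega)
  calc _ ≤ volume (⋃ i ∈ Finset.Icc (-1 : ℤ) 1,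
        {r : ℝ | ∃ t ∈ dyadicPiece E (k + i), |r - t| < 2 ^ k * δ}) := by
        refine measure_mono ?_
        rintro r ⟨hr, hr'⟩
        obtain ⟨t, htE, h1, h2, h3⟩ := hr' hh
        rw [hδh] at h3
        obtain ⟨j, hj⟩ := exists_mem_shell (show 0 < t by linarith [hr.1])
        have hr2 := hr.2
        have a1 : j < k + 2 := (zpow_lt_zpow_iff_right₀ one_lt_two).1 (show (2 : ℝ) ^ j < _ by
          rw [show k + 2 = k + 1 + 1 by ring, two_zpow_succ (k + 1)]; linarith [hj.1])
        have a2 : k < j + 2 := (zpow_lt_zpow_iff_right₀ one_lt_two).1 (show (2 : ℝ) ^ k < _ by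
          rw [show j + 2 = j + 1 + 1 by ring, two_zpow_succ (j + 1)]; linarith [hj.2, hr.1])
        refine mem_biUnion (x := j - k) ?_ ⟨t, ⟨?_, htE⟩, h3⟩
        · simp only [Finset.coe_Icc, mem_Icc]; omega
        · rw [add_sub_cancel]; exact ⟨hj.1, hj.2.le⟩
    _ ≤ ∑ i ∈ Finset.Icc (-1 : ℤ) 1, volume
        {r : ℝ | ∃ t ∈ dyadicPiece E (k + i), |r - t| < 2 ^ k * δ} :=
        measure_biUnion_finset_le _ _
    _ ≤ ∑ i ∈ Finset.Icc (-1 : ℤ) 1, entropyNumber (dyadicPiece E (k + i)) (2 ^ (k + i) * δ) *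
        ENNReal.ofReal (4 * δ * 2 ^ k) := by
        refine Finset.sum_le_sum fun i hi' => (volume_thickening_le
          (mul_pos (two_zpow_pos (k + i)) hδ) (mul_pos hk hδ)).trans (mul_le_mul_right
            (ENNReal.ofReal_le_ofReal ?_) _)
        nlinarith [hi i hi']
    _ = _ := by
        rw [← Finset.sum_mul, mul_comm, ENNReal.ofReal_mul (by positivity),
          ENNReal.ofReal_mul (by positivity)]
        simp

variable {d : ℕ} {p : ℝ}

theorem criticalExponent_sub_one (hd : 3 ≤ d) (hp : p = (d : ℝ) / ((d : ℝ) - 1)) :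
    p - 1 = 1 / ((d : ℝ) - 1) := by
  have : (3 : ℝ) ≤ d := by exact_mod_cast hd
  rw [hp, div_sub_one (by linarith)]; congr 1; ring

theorem proximityDensity_le_rpow (E : Set ℝ) (k : ℤ) (h : ℕ) :
    proximityDensity p E k h ≤ ((2 : ℝ≥0∞) ^ h) ^ (p - 1) := by
  refine mul_le_of_le_one_right' (ENNReal.div_le_of_le_mul ?_)
  rw [one_mul, ← volume_shell]
  exact measure_mono fun r hr => hr.1

/-- The entropy hypotheses concern `δ < 1/2` only, whereas the scale for `h ≤ 1` is `1/2`. These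
indices are covered by the trivial bound. -/
theorem proximityDensity_le_two (hd : 3 ≤ d) (hp : p = (d : ℝ) / ((d : ℝ) - 1)) (E : Set ℝ) (k : ℤ)
    {h : ℕ} (hh : h ≤ 1) : proximityDensity p E k h ≤ 2 := by
  have hD : (3 : ℝ) ≤ d := by exact_mod_cast hd
  have h1 : p - 1 ≤ 1 := by
    rw [criticalExponent_sub_one hd hp, div_le_one (by linarith)]; linarith
  have h0 : 0 ≤ p - 1 := by linarith [one_lt_criticalExponent hd hp]
  calc _ ≤ ((2 : ℝ≥0∞) ^ h) ^ (p - 1) := proximityDensity_le_rpow E k h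
    _ ≤ ((2 : ℝ≥0∞) ^ 1) ^ (p - 1) :=
      ENNReal.rpow_le_rpow (pow_le_pow_right₀ (by norm_num) hh) h0
    _ ≤ ((2 : ℝ≥0∞) ^ 1) ^ (1 : ℝ) := ENNReal.rpow_le_rpow_of_exponent_le (by norm_num) h1
    _ = 2 := by simp

/-- The scale `2^(-2^(h-1))`. -/
def entropyScale (h : ℕ) : ℝ := (2⁻¹ : ℝ) ^ (2 ^ (h - 1))

theorem entropyScale_pos (h : ℕ) : 0 < entropyScale h := by unfold entropyScale; positivity

theorem entropyScale_lt {h : ℕ} (hh : 2 ≤ h) : entropyScale h < 1 / 2 := by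
  have h1 : 1 < 2 ^ (h - 1) := Nat.one_lt_two_pow (by omega)
  calc entropyScale h < (2⁻¹ : ℝ) ^ 1 := pow_lt_pow_right_of_lt_one₀ (by norm_num) (by norm_num) h1
    _ = _ := by norm_num

theorem log_inv_entropyScale (h : ℕ) :
    Real.log (1 / entropyScale h) = 2 ^ (h - 1) * Real.log 2 := by
  rw [entropyScale, one_div, ← inv_pow, inv_inv, Real.log_pow]; push_cast; ring

theorem two_zpow_sub_eq (k : ℤ) (h : ℕ) :
    (2 : ℝ) ^ (k - 2 ^ (h - 1)) = 2 ^ k * entropyScale h := by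
  rw [entropyScale, zpow_sub₀ two_ne_zero, div_eq_mul_inv, inv_pow, ← zpow_natCast]
  push_cast; rfl

theorem proximityDensity_le_sum (E : Set ℝ) (k : ℤ) {h : ℕ} (hh : h ≠ 0) :
    proximityDensity p E k h ≤ ((2 : ℝ≥0∞) ^ h) ^ (p - 1) * (4 * ENNReal.ofReal (entropyScale h)) *
      ∑ i ∈ Finset.Icc (-1 : ℤ) 1,
        entropyNumber (dyadicPiece E (k + i)) (2 ^ (k + i) * entropyScale h) := by
  have hk : ENNReal.ofReal (2 ^ k) ≠ 0 := by simpa using two_zpow_pos k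
  rw [proximityDensity, mul_assoc]
  refine mul_le_mul_right ?_ _
  rw [ENNReal.div_le_iff_le_mul (Or.inl hk) (Or.inl ENNReal.ofReal_ne_top)]
  refine (volume_proximitySet_le E k hh (entropyScale_pos h) (two_zpow_sub_eq k h)).trans_eq ?_
  ring

/-- The bound for the entropy numbers at the scale given by `h`. -/
def entropyBound (d : ℕ) (C : ℝ≥0) (h : ℕ) : ℝ≥0∞ :=
  ENNReal.ofReal (C * (entropyScale h)⁻¹ *
    Real.log (1 / entropyScale h) ^ (-(1 / ((d : ℝ) - 1))))

/-- The reason for doubly exponential scales: `log(1/δ) = 2^(h-1) log 2`, so the power `-1/(d-1) =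
-(p-1)` of the logarithm cancels `(2^h)^(p-1)` up to a constant independent of `h`. -/
theorem scale_mul_entropyBound (hd : 3 ≤ d) (hp : p = (d : ℝ) / ((d : ℝ) - 1)) (C : ℝ≥0) {h : ℕ}
    (hh : h ≠ 0) :
    ((2 : ℝ≥0∞) ^ h) ^ (p - 1) * (4 * ENNReal.ofReal (entropyScale h)) * entropyBound d C h =
      ENNReal.ofReal (4 * C * (2 / Real.log 2) ^ (p - 1)) := by
  have hs := entropyScale_pos h
  have hl : 0 < Real.log 2 := Real.log_pos one_lt_two
  have h0 : 0 ≤ p - 1 := by linarith [one_lt_criticalExponent hd hp]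
  have e1 : ((2 : ℝ≥0∞) ^ h) ^ (p - 1) = ENNReal.ofReal (((2 : ℝ) ^ h) ^ (p - 1)) := by
    rw [← ENNReal.ofReal_rpow_of_nonneg (by positivity) h0, ENNReal.ofReal_pow (by norm_num)]
    simp
  have e2 : 4 * ENNReal.ofReal (entropyScale h) = ENNReal.ofReal (4 * entropyScale h) := by
    rw [ENNReal.ofReal_mul (by norm_num)]; simp
  rw [e1, e2, entropyBound, ← ENNReal.ofReal_mul (by positivity),
    ← ENNReal.ofReal_mul (by positivity), log_inv_entropyScale, ← criticalExponent_sub_one hd hp]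
  congr 1
  obtain ⟨n, rfl⟩ : ∃ n, h = n + 1 := ⟨h - 1, by omega⟩
  have e3 : ((2 : ℝ) ^ (n + 1)) ^ (p - 1) = (2 / Real.log 2) ^ (p - 1) *
      (2 ^ n * Real.log 2) ^ (p - 1) := by
    rw [← Real.mul_rpow (by positivity) (by positivity)]
    congr 1; field_simp; ring
  rw [e3, Nat.add_sub_cancel, Real.rpow_neg (by positivity)]
  field_simp

theorem exists_proximityDensity_le_of_uniform (hd : 3 ≤ d) (hp : p = (d : ℝ) / ((d : ℝ) - 1))
    {E : Set ℝ} (hE : UniformEntropyBound d E) :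
    ∃ C : ℝ≥0∞, C ≠ ∞ ∧ ∀ k h, proximityDensity p E k h ≤ C := by
  obtain ⟨C, hC⟩ := hE
  refine ⟨2 + 3 * ENNReal.ofReal (4 * C * (2 / Real.log 2) ^ (p - 1)), ?_, fun k h => ?_⟩
  · exact ENNReal.add_ne_top.2 ⟨by simp, ENNReal.mul_ne_top (by simp) ENNReal.ofReal_ne_top⟩
  rcases Nat.lt_or_ge h 2 with hh | hh
  · exact (proximityDensity_le_two hd hp E k (by omega)).trans le_self_add
  · refine (proximityDensity_le_sum E k (by omega)).trans (le_trans ?_ le_add_self)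
    rw [← scale_mul_entropyBound hd hp C (by omega : h ≠ 0)]
    have h1 : ∑ i ∈ Finset.Icc (-1 : ℤ) 1,
        entropyNumber (dyadicPiece E (k + i)) (2 ^ (k + i) * entropyScale h) ≤
        3 * entropyBound d C h := by
      refine (Finset.sum_le_card_nsmul _ _ (entropyBound d C h) fun i _ => ?_).trans_eq ?_
      · exact (le_iSup (fun k : ℤ => entropyNumber (dyadicPiece E k) (2 ^ k * entropyScale h))
          (k + i)).trans (hC _ (entropyScale_pos h) (entropyScale_lt hh))
      · simp
    refine (mul_le_mul_right h1 _).trans_eq ?_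
    ring

theorem sum_Icc_le_of_intervals {F : ℤ → ℝ≥0∞} {L : ℝ} (hL : 0 < L) {M : ℝ≥0∞}
    (hM : ∀ a : ℝ, ∑' k : {k : ℤ // (k : ℝ) ∈ Icc a (a + L)}, F k ≤ M) {n : ℕ} {a b : ℤ}
    (hab : (b : ℝ) - a < n * L) : ∑ k ∈ Finset.Icc a b, F k ≤ n * M := by
  classical
  have hM' : ∀ x : ℝ, ∑' k : ℤ, {k : ℤ | (k : ℝ) ∈ Icc x (x + L)}.indicator F k ≤ M := by
    intro x
    rw [← tsum_subtype]
    exact hM x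
  calc _ ≤ ∑ k ∈ Finset.Icc a b, ∑ i ∈ Finset.range n,
        {k : ℤ | (k : ℝ) ∈ Icc (a + i * L : ℝ) (a + i * L + L)}.indicator F k := by
        refine Finset.sum_le_sum fun k hk => ?_
        obtain ⟨h1, h2⟩ := Finset.mem_Icc.1 hk
        have h1' : (a : ℝ) ≤ k := by exact_mod_cast h1
        have h2' : (k : ℝ) ≤ b := by exact_mod_cast h2
        have hx : 0 ≤ ((k : ℝ) - a) / L := by
          apply div_nonneg _ hL.le; linarith
        have hf1 := Nat.floor_le hx
        have hf2 := Nat.lt_floor_add_one (((k : ℝ) - a) / L)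
        rw [le_div_iff₀ hL] at hf1
        rw [div_lt_iff₀ hL] at hf2
        set i := ⌊((k : ℝ) - a) / L⌋₊
        have hin : i < n := by
          have : (i : ℝ) * L < n * L := by linarith
          exact_mod_cast lt_of_mul_lt_mul_right this hL.le
        refine le_trans (le_of_eq ?_) (Finset.single_le_sum (f := fun i : ℕ =>
          {k : ℤ | (k : ℝ) ∈ Icc (a + i * L : ℝ) (a + i * L + L)}.indicator F k)
          (fun _ _ => zero_le) (Finset.mem_range.2 hin))
        rw [indicator_of_mem]
        exact ⟨by linarith, by linarith⟩
    _ = ∑ i ∈ Finset.range n, ∑ k ∈ Finset.Icc a b,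
        {k : ℤ | (k : ℝ) ∈ Icc (a + i * L : ℝ) (a + i * L + L)}.indicator F k := Finset.sum_comm
    _ ≤ ∑ i ∈ Finset.range n, M :=
        Finset.sum_le_sum fun i _ => (ENNReal.sum_le_tsum _).trans (hM' _)
    _ = _ := by simp

theorem sum_three_rpow_le {s : ℝ} (hs : 0 ≤ s) (F : ℤ → ℝ≥0∞) :
    (∑ i ∈ Finset.Icc (-1 : ℤ) 1, F i) ^ s ≤ 3 ^ s * ∑ i ∈ Finset.Icc (-1 : ℤ) 1, F i ^ s := by
  obtain ⟨i, hi, hmax⟩ := Finset.exists_max_image (Finset.Icc (-1 : ℤ) 1) F ⟨0, by simp⟩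
  calc _ ≤ (3 * F i) ^ s := by
        refine ENNReal.rpow_le_rpow ((Finset.sum_le_card_nsmul _ _ _ hmax).trans_eq ?_) hs
        simp
    _ = 3 ^ s * F i ^ s := ENNReal.mul_rpow_of_nonneg _ _ hs
    _ ≤ _ := mul_le_mul_right (Finset.single_le_sum (f := fun i => F i ^ s)
        (fun _ _ => zero_le) hi) _

/-- This is the hypothesis of the embedding theorem. The intervals `I` of length `log(1/δ) = 2^(h-1)
log 2` match the ranges of length `2^h + 2`, so boundedly many of them suffice. -/
theorem exists_sum_proximityDensity_le (hd : 3 ≤ d) (hp : p = (d : ℝ) / ((d : ℝ) - 1)) {q : ℝ}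
    (hq : p < q) {E : Set ℝ} (hE : SummedEntropyBound d E p q) :
    ∃ W : ℝ≥0∞, W ≠ ∞ ∧ ∀ (h : ℕ) (j : ℤ),
      ∑ k ∈ Finset.Icc (j - 2) (j + 2 ^ h), proximityDensity p E k h ^ (q / p) ≤ W := by
  have hp1 := one_lt_criticalExponent hd hp
  have hp0 : 0 < p := by linarith
  have hs0 : 0 < q / p := div_pos (by linarith) hp0
  obtain ⟨C, hC⟩ := hE
  set s := q / p with hs
  set K := ENNReal.ofReal (4 * C * (2 / Real.log 2) ^ (p - 1)) with hK
  refine ⟨5 * 2 ^ s + 3 ^ s * (3 * (8 * K ^ s)), ?_, fun h j => ?_⟩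
  · have h2 := ENNReal.rpow_ne_top_of_nonneg hs0.le (by simp : (2 : ℝ≥0∞) ≠ ∞)
    have h3 := ENNReal.rpow_ne_top_of_nonneg hs0.le (by simp : (3 : ℝ≥0∞) ≠ ∞)
    have hK := ENNReal.rpow_ne_top_of_nonneg hs0.le (ENNReal.ofReal_ne_top : K ≠ ∞)
    finiteness
  rcases Nat.lt_or_ge h 2 with hh | hh
  · refine le_trans ?_ le_self_add
    refine (Finset.sum_le_card_nsmul _ _ (2 ^ s) fun k _ => ENNReal.rpow_le_rpow
      (proximityDensity_le_two hd hp E k (by omega)) hs0.le).trans ?_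
    rw [nsmul_eq_mul]
    refine mul_le_mul_left ?_ _
    have h2 : (2 : ℤ) ^ h ≤ 2 := by
      calc (2 : ℤ) ^ h ≤ 2 ^ 1 := pow_le_pow_right₀ (by norm_num) (by omega)
        _ = 2 := by norm_num
    have : (Finset.Icc (j - 2) (j + 2 ^ h)).card ≤ 5 := by
      rw [Int.card_Icc]; omega
    exact_mod_cast this
  · refine le_trans ?_ le_add_self
    set δ := entropyScale h with hδ
    set κ := ((2 : ℝ≥0∞) ^ h) ^ (p - 1) * (4 * ENNReal.ofReal δ) with hκ
    set N : ℤ → ℝ≥0∞ := fun k => entropyNumber (dyadicPiece E k) (2 ^ k * δ) with hN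
    have hl : 0.69 < Real.log 2 := by linarith [Real.log_two_gt_d9]
    have hlog : Real.log δ⁻¹ = 2 ^ (h - 1) * Real.log 2 := by
      rw [← one_div]; exact log_inv_entropyScale h
    have hL : 0 < Real.log δ⁻¹ := by rw [hlog]; positivity
    have hM : ∀ a : ℝ, ∑' k : {k : ℤ // (k : ℝ) ∈ Icc a (a + Real.log δ⁻¹)}, N k ^ s ≤
        entropyBound d C h ^ s := by
      intro a
      have h1 := (le_iSup (fun a : ℝ => (∑' k : {k : ℤ // (k : ℝ) ∈ Icc a (a + Real.log δ⁻¹)},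
        N k ^ s) ^ (p / q)) a).trans (hC _ (entropyScale_pos h) (entropyScale_lt hh))
      have h2 := ENNReal.rpow_le_rpow h1 hs0.le
      rwa [← ENNReal.rpow_mul, hs, div_mul_div_cancel₀ (by linarith : q ≠ 0), div_self hp0.ne',
        ENNReal.rpow_one] at h2
    have hsum : ∀ i ∈ Finset.Icc (-1 : ℤ) 1,
        ∑ k ∈ Finset.Icc (j - 2) (j + 2 ^ h), N (k + i) ^ s ≤ 8 * entropyBound d C h ^ s := by
      intro i hi
      have hmap : ∑ k ∈ Finset.Icc (j - 2) (j + 2 ^ h), N (k + i) ^ s =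
          ∑ k ∈ Finset.Icc (j - 2 + i) (j + 2 ^ h + i), N k ^ s := by
        rw [← Finset.map_add_right_Icc, Finset.sum_map]; rfl
      rw [hmap]
      -- Eight intervals suffice, because `8 * 2^(h-1) log 2 > 2.7 * 2^h` while `2^h + 2 ≤ 1.5 *
      -- 2^h` for `h ≥ 2`.
      refine (sum_Icc_le_of_intervals hL hM (n := 8) ?_).trans_eq (by norm_num)
      obtain ⟨n, rfl⟩ : ∃ n, h = n + 1 := ⟨h - 1, by omega⟩
      have hpow : (2 : ℝ) ^ 1 ≤ 2 ^ n := pow_le_pow_right₀ (by norm_num) (by omega)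
      rw [hlog, Nat.add_sub_cancel]
      push_cast
      rw [pow_succ]
      nlinarith
    calc _ ≤ ∑ k ∈ Finset.Icc (j - 2) (j + 2 ^ h),
          κ ^ s * (3 ^ s * ∑ i ∈ Finset.Icc (-1 : ℤ) 1, N (k + i) ^ s) := by
          refine Finset.sum_le_sum fun k _ => ?_
          refine (ENNReal.rpow_le_rpow (proximityDensity_le_sum E k (by omega)) hs0.le).trans ?_
          rw [ENNReal.mul_rpow_of_nonneg _ _ hs0.le]
          exact mul_le_mul_right (sum_three_rpow_le hs0.le _) _
      _ = κ ^ s * (3 ^ s * ∑ i ∈ Finset.Icc (-1 : ℤ) 1,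
          ∑ k ∈ Finset.Icc (j - 2) (j + 2 ^ h), N (k + i) ^ s) := by
          rw [← Finset.mul_sum, ← Finset.mul_sum, Finset.sum_comm]
      _ ≤ κ ^ s * (3 ^ s * (3 * (8 * entropyBound d C h ^ s))) := by
          refine mul_le_mul_right (mul_le_mul_right
            ((Finset.sum_le_card_nsmul _ _ _ hsum).trans_eq ?_) _) _
          simp
      _ = _ := by
          have hK2 : K = κ * entropyBound d C h :=
            (scale_mul_entropyBound hd hp C (by omega : h ≠ 0)).symm
          rw [hK2, ENNReal.mul_rpow_of_nonneg κ (entropyBound d C h) hs0.le]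
          ring

theorem proximityDensity_le_of_sum {E : Set ℝ} {s : ℝ} (hs : 0 < s) {W : ℝ≥0∞}
    (hW : ∀ (h : ℕ) (j : ℤ),
      ∑ k ∈ Finset.Icc (j - 2) (j + 2 ^ h), proximityDensity p E k h ^ s ≤ W) (k : ℤ) (h : ℕ) :
    proximityDensity p E k h ≤ W ^ (1 / s) := by
  have h2 : (0 : ℤ) < 2 ^ h := by positivity
  have h1 := (Finset.single_le_sum (f := fun k => proximityDensity p E k h ^ s)
    (fun _ _ => zero_le) (Finset.mem_Icc.2 (by omega) : k ∈ Finset.Icc (k - 2) (k + 2 ^ h))).trans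
    (hW h k)
  have h3 := ENNReal.rpow_le_rpow h1 (one_div_pos.2 hs).le
  rwa [← ENNReal.rpow_mul, mul_one_div_cancel hs.ne', ENNReal.rpow_one] at h3

end SphericalMaximal
end

noncomputable section
namespace SphericalMaximal

/-! ### The Lorentz quasinorm in terms of dyadic levels -/

theorem lintegral_rpow_lt (v : ℝ≥0∞) {s : ℝ} (hs : 0 < s) :
    ENNReal.ofReal s * ∫⁻ t in Ioi (0 : ℝ),
      (if ENNReal.ofReal t < v then ENNReal.ofReal t ^ (s - 1) else 0) = v ^ s := by
  have hfin : ∀ w : ℝ≥0, ENNReal.ofReal s * ∫⁻ t in Ioi (0 : ℝ),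
      (if ENNReal.ofReal t < w then ENNReal.ofReal t ^ (s - 1) else 0) = (w : ℝ≥0∞) ^ s := by
    intro w
    have h := lintegral_rpow_eq_lintegral_meas_lt_mul (Measure.dirac ()) (f := fun _ => (w : ℝ))
      (Filter.Eventually.of_forall fun _ => w.coe_nonneg) aemeasurable_const hs
    rw [lintegral_dirac, ← ENNReal.ofReal_rpow_of_nonneg w.coe_nonneg hs.le, ENNReal.ofReal_coe_nnreal] at h
    rw [h]
    congr 1
    refine setLIntegral_congr_fun measurableSet_Ioi fun t ht => ?_
    have ht : (0 : ℝ) < t := ht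
    by_cases hw : t < w
    · have : ENNReal.ofReal t < w := by
        rw [← ENNReal.ofReal_coe_nnreal, ENNReal.ofReal_lt_ofReal_iff (ht.trans hw)]; exact hw
      simp [this, hw, ENNReal.ofReal_rpow_of_pos ht]
    · have : ¬ ENNReal.ofReal t < w := by
        rw [← ENNReal.ofReal_coe_nnreal, not_lt]
        exact ENNReal.ofReal_le_ofReal (not_lt.1 hw)
      simp [this, hw]
  induction v with
  | coe w => exact hfin w
  | top =>
    rw [ENNReal.top_rpow_of_pos hs, eq_top_iff]
    have hlim : Filter.Tendsto (fun n : ℕ => ((n : ℝ≥0) : ℝ≥0∞) ^ s) Filter.atTop (nhds ∞) := by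
      have := (ENNReal.continuous_rpow_const (y := s)).tendsto ∞
      rw [ENNReal.top_rpow_of_pos hs] at this
      exact this.comp (by simpa using ENNReal.tendsto_nat_nhds_top)
    refine le_of_tendsto' hlim fun n => ?_
    rw [← hfin]
    refine mul_le_mul_right (lintegral_mono fun t => ?_) _
    split_ifs with h1 h2
    · exact le_rfl
    · exact absurd ENNReal.ofReal_lt_top h2
    · exact zero_le
    · exact zero_le

section Lorentz

variable {Ω : Type*} [MeasurableSpace Ω] (μ : Measure Ω) {p q : ℝ} (g : Ω → ℝ≥0∞)

theorem lt_measure_of_lt_rearrangement {t α : ℝ≥0∞} (h : α < rearrangement μ g t) :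
    t < μ {x | α < g x} := by
  by_contra hcon
  have hle : rearrangement μ g t ≤ α := sInf_le (not_lt.1 hcon)
  exact absurd hle (not_le.2 h)

theorem le_rearrangement_of_lt_measure {t α : ℝ≥0∞} (h : t < μ {x | α < g x}) :
    α ≤ rearrangement μ g t := by
  refine le_sInf fun β hβ => not_lt.1 fun hlt => ?_
  exact absurd (h.trans_le (measure_mono fun x (hx : α < g x) => hlt.trans hx)) (not_lt.2 hβ)

theorem lorentzNorm_rpow (hq : 0 < q) :
    lorentzNorm μ p q g ^ q = ENNReal.ofReal (q / p) * ∫⁻ t in Ioi (0 : ℝ),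
      ENNReal.ofReal t ^ (q / p - 1) * rearrangement μ g (ENNReal.ofReal t) ^ q := by
  rw [lorentzNorm, ← ENNReal.rpow_mul, one_div_mul_cancel hq.ne', ENNReal.rpow_one]
  congr 1
  refine setLIntegral_congr_fun measurableSet_Ioi fun t ht => ?_
  have h0 : ENNReal.ofReal t ≠ 0 := by simpa using ht
  rw [ENNReal.mul_rpow_of_nonneg _ _ hq.le, ← ENNReal.rpow_mul,
    ENNReal.rpow_sub _ _ h0 ENNReal.ofReal_ne_top, ENNReal.rpow_one, one_div_mul_eq_div]
  simp only [ENNReal.div_eq_inv_mul]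
  ring

theorem rpow_le_tsum_dyadicScale (X : ℝ≥0∞) (hq : 0 < q) :
    X ^ q ≤ ∑' m : ℤ, (if (dyadicScale 1 m : ℝ≥0∞) < X then (2 : ℝ≥0∞) ^ q *
      (dyadicScale 1 m : ℝ≥0∞) ^ q else 0) := by
  have key : ∀ x : ℝ≥0, (x : ℝ≥0∞) ≤ X → (x : ℝ≥0∞) ^ q ≤
      ∑' m : ℤ, (if (dyadicScale 1 m : ℝ≥0∞) < X then (2 : ℝ≥0∞) ^ q *
      (dyadicScale 1 m : ℝ≥0∞) ^ q else 0) := by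
    intro x hx
    rcases eq_or_ne x 0 with rfl | h0
    · simp [ENNReal.zero_rpow_of_pos hq]
    obtain ⟨m, h1, h2⟩ := exists_mem_Ioc_zpow (pos_iff_ne_zero.2 h0) (one_lt_two : (1 : ℝ≥0) < 2)
    refine le_trans ?_ (ENNReal.le_tsum m)
    have h3 : (dyadicScale 1 m : ℝ≥0∞) < x := by
      rw [ENNReal.coe_lt_coe, dyadicScale, one_mul]; exact h1
    rw [if_pos (h3.trans_le hx), ← ENNReal.mul_rpow_of_nonneg _ _ hq.le]
    refine ENNReal.rpow_le_rpow ?_ hq.le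
    rw [zpow_add_one₀ two_ne_zero] at h2
    have : (2 : ℝ≥0∞) * dyadicScale 1 m = ((2 * dyadicScale 1 m : ℝ≥0) : ℝ≥0∞) := by push_cast; rfl
    rw [this, ENNReal.coe_le_coe, dyadicScale, one_mul, mul_comm]
    exact h2
  induction X with
  | coe x => exact key x le_rfl
  | top =>
    rw [ENNReal.top_rpow_of_pos hq]
    have hlim : Filter.Tendsto (fun n : ℕ => ((n : ℝ≥0) : ℝ≥0∞) ^ q) Filter.atTop (nhds ∞) := by
      have := (ENNReal.continuous_rpow_const (y := q)).tendsto ∞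
      rw [ENNReal.top_rpow_of_pos hq] at this
      exact this.comp (by simpa using ENNReal.tendsto_nat_nhds_top)
    exact le_of_tendsto' hlim fun n => key n le_top

theorem measurable_ite_rpow (v : ℝ≥0∞) (s : ℝ) : Measurable fun t : ℝ =>
    (if ENNReal.ofReal t < v then ENNReal.ofReal t ^ s else 0) :=
  Measurable.ite (measurableSet_lt (by fun_prop) measurable_const) (by fun_prop) measurable_const

theorem tsum_levels_eq (hp : 0 < p) (hq : 0 < q) :
    ∑' m : ℤ, (dyadicScale 1 m : ℝ≥0∞) ^ q * μ {x | (dyadicScale 1 m : ℝ≥0∞) < g x} ^ (q / p) =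
    ENNReal.ofReal (q / p) * ∫⁻ t in Ioi (0 : ℝ), ∑' m : ℤ, (dyadicScale 1 m : ℝ≥0∞) ^ q *
      (if ENNReal.ofReal t < μ {x | (dyadicScale 1 m : ℝ≥0∞) < g x} then
        ENNReal.ofReal t ^ (q / p - 1) else 0) := by
  rw [lintegral_tsum fun m => ((measurable_ite_rpow _ _).const_mul _).aemeasurable,
    ← ENNReal.tsum_mul_left]
  refine tsum_congr fun m => ?_
  rw [lintegral_const_mul _ (measurable_ite_rpow _ _), mul_left_comm,
    lintegral_rpow_lt _ (div_pos hq hp)]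

/-- The rearrangement and the distribution function are inverse to each other: `α < g^*(t)` forces
`t < μ {g > α}`. Each value `g^*(t)` is therefore resolved into dyadic heights, and the integration
in `t` is done for each height. -/
theorem lorentzNorm_rpow_le (hp : 0 < p) (hq : 0 < q) :
    lorentzNorm μ p q g ^ q ≤ 2 ^ q * ∑' m : ℤ, (dyadicScale 1 m : ℝ≥0∞) ^ q *
      μ {x | (dyadicScale 1 m : ℝ≥0∞) < g x} ^ (q / p) := by
  rw [tsum_levels_eq μ g hp hq, lorentzNorm_rpow μ g hq, mul_left_comm,
    ← lintegral_const_mul' _ _ (ENNReal.rpow_ne_top_of_nonneg hq.le (by simp))]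
  refine mul_le_mul_right (lintegral_mono fun t => ?_) _
  refine (mul_le_mul_right (rpow_le_tsum_dyadicScale _ hq) _).trans ?_
  rw [← ENNReal.tsum_mul_left, ← ENNReal.tsum_mul_left]
  refine ENNReal.tsum_le_tsum fun m => ?_
  split_ifs with h1 h2 h2
  · exact le_of_eq (by ring)
  · exact absurd (lt_measure_of_lt_rearrangement μ g h1) h2
  · simp
  · simp

theorem tsum_levels_le (hp : 0 < p) (hq : 0 < q) :
    ∑' m : ℤ, (dyadicScale 1 m : ℝ≥0∞) ^ q * μ {x | (dyadicScale 1 m : ℝ≥0∞) < g x} ^ (q / p) ≤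
      geomConst q * 2 ^ q * lorentzNorm μ p q g ^ q := by
  rw [tsum_levels_eq μ g hp hq, lorentzNorm_rpow μ g hq, mul_left_comm,
    ← lintegral_const_mul' _ _ (ENNReal.mul_ne_top (geomConst_ne_top hq)
      (ENNReal.rpow_ne_top_of_nonneg hq.le (by simp)))]
  refine mul_le_mul_right (lintegral_mono fun t => ?_) _
  set X := rearrangement μ g (ENNReal.ofReal t) with hX
  -- From `t < μ {g > α}` only `α ≤ g^*(t)` follows, not the strict inequality. The factor `2`
  -- restores strictness.
  calc _ ≤ ∑' m : ℤ, ENNReal.ofReal t ^ (q / p - 1) *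
        (if (dyadicScale 1 m : ℝ≥0∞) < 2 * X then (dyadicScale 1 m : ℝ≥0∞) ^ q else 0) := by
        refine ENNReal.tsum_le_tsum fun m => ?_
        have h0 : (dyadicScale 1 m : ℝ≥0∞) ≠ 0 := by
          simpa using (dyadicScale_pos one_pos m).ne'
        split_ifs with h1 h2 h2
        · exact le_of_eq (mul_comm _ _)
        · refine absurd ?_ h2
          calc (dyadicScale 1 m : ℝ≥0∞) < 2 * dyadicScale 1 m := by
                rw [two_mul]; exact ENNReal.lt_add_right ENNReal.coe_ne_top h0
            _ ≤ 2 * X := mul_le_mul_right (le_rearrangement_of_lt_measure μ g h1) _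
        · simp
        · simp
    _ ≤ ENNReal.ofReal t ^ (q / p - 1) * (geomConst q * (2 * X) ^ q) := by
        rw [ENNReal.tsum_mul_left]
        exact mul_le_mul_right (tsum_dyadicScale_rpow_le hq one_pos _) _
    _ = _ := by
        rw [ENNReal.mul_rpow_of_nonneg _ _ hq.le]; ring

end Lorentz

end SphericalMaximal
end

noncomputable section
namespace SphericalMaximal

/-! ### Sufficiency of the entropy conditions -/

variable {d : ℕ} {p : ℝ} {G : ℝ → ℝ≥0∞} {E : Set ℝ}

theorem volume_maximalFunction_le (hd : 3 ≤ d) (hE : E ⊆ Ioi 0)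
    {f : EuclideanSpace ℝ (Fin d) → ℂ}
    (hfG : ∀ x ≠ 0, ∀ t > 0, absSphericalMean t f x ≤ radialMean d G t ‖x‖) (α : ℝ≥0∞) :
    volume {x | α < maximalFunction E f x} ≤
      volume {x : EuclideanSpace ℝ (Fin d) | ‖x‖ ∈ smallRadiusLevel d G α} +
      volume {x : EuclideanSpace ℝ (Fin d) | ‖x‖ ∈ largeRadiusLevel d G α} +
      volume {x : EuclideanSpace ℝ (Fin d) | ‖x‖ ∈ nearLevel d E G α} := by
  have : Nonempty (Fin d) := ⟨⟨0, by omega⟩⟩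
  calc _ ≤ volume (((({0} : Set (EuclideanSpace ℝ (Fin d))) ∪
        {x : EuclideanSpace ℝ (Fin d) | ‖x‖ ∈ smallRadiusLevel d G α}) ∪
        {x : EuclideanSpace ℝ (Fin d) | ‖x‖ ∈ largeRadiusLevel d G α}) ∪
        {x : EuclideanSpace ℝ (Fin d) | ‖x‖ ∈ nearLevel d E G α}) := by
        refine measure_mono fun x hx => ?_
        rcases eq_or_ne x 0 with h0 | h0
        · exact Or.inl (Or.inl (Or.inl h0))
        have hr : 0 < ‖x‖ := norm_pos_iff.2 h0
        have hx' : α < ⨆ t ∈ E, absSphericalMean t f x := hx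
        obtain ⟨t, ht⟩ := lt_iSup_iff.1 hx'
        obtain ⟨htE, hα⟩ := lt_iSup_iff.1 ht
        have ht0 : 0 < t := hE htE
        have hα' := hα.trans_le (hfG x h0 t ht0)
        rcases le_or_gt t (‖x‖ / 2) with h1 | h1
        · exact Or.inl (Or.inl (Or.inr ⟨hr, t, ht0, h1, hα'⟩))
        rcases le_or_gt (2 * ‖x‖) t with h2 | h2
        · exact Or.inl (Or.inr ⟨hr, t, h2, hα'⟩)
        · exact Or.inr ⟨hr, t, htE, h1, h2, hα'⟩
    _ ≤ _ := by
        refine (measure_union_le _ _).trans (add_le_add_left ?_ _)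
        refine (measure_union_le _ _).trans (add_le_add_left ?_ _)
        refine (measure_union_le _ _).trans ?_
        rw [measure_singleton, zero_add]

theorem weakType_of_uniformEntropyBound (hd : 3 ≤ d) (hp : p = (d : ℝ) / ((d : ℝ) - 1))
    (hE : E ⊆ Ioi 0) (hent : UniformEntropyBound d E) : WeakTypeOnRadial d E p := by
  have hp1 := one_lt_criticalExponent hd hp
  have hp0 : 0 < p := by linarith
  obtain ⟨C, hC, he⟩ := exists_proximityDensity_le_of_uniform hd hp hent
  set σ := (volume : Measure (EuclideanSpace ℝ (Fin d))).toSphere univ with hσ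
  have hσ0 : σ ≠ 0 := toSphere_univ_ne_zero (by omega)
  have hσt : σ ≠ ∞ := toSphere_univ_ne_top
  set c := nearConst d with hc
  have hc0 : 0 < c := nearConst_pos hd
  set K : ℝ≥0∞ := (smallRadiusConst d p + largeRadiusConst d p +
    (c : ℝ≥0∞) ^ p * (σ * 2 ^ (d - 1) * (C * lacunaryConst p))) * σ⁻¹ with hK
  have hKt : K ≠ ∞ := by
    have h1 := smallRadiusConst_ne_top hd hp1
    have h2 := largeRadiusConst_ne_top hd hp1
    have h3 : (c : ℝ≥0∞) ^ p ≠ ∞ := ENNReal.rpow_ne_top_of_nonneg hp0.le ENNReal.coe_ne_top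
    have h4 : σ⁻¹ ≠ ∞ := ENNReal.inv_ne_top.2 hσ0
    rw [hK]
    finiteness
  refine ⟨K.toNNReal, fun f hf hfp α hα => ?_⟩
  obtain ⟨G, hm, hN, hfG⟩ := exists_measurable_profile hd hp0 hf hfp
  change _ = σ * profileMass d p G at hN
  have hmass : profileMass d p G = σ⁻¹ * eLpNorm f (ENNReal.ofReal p) volume ^ p := by
    rw [hN, ← mul_assoc, ENNReal.inv_mul_cancel hσ0 hσt, one_mul]
  have hGt : profileMass d p G ≠ ∞ := by
    rw [hmass]
    exact ENNReal.mul_ne_top (ENNReal.inv_ne_top.2 hσ0)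
      (ENNReal.rpow_ne_top_of_nonneg hp0.le hfp.2.ne)
  set a : ℝ≥0 := α.toNNReal with ha
  have ha0 : 0 < a := Real.toNNReal_pos.2 hα
  have hαa : ENNReal.ofReal α = a := rfl
  have ha0' : (a : ℝ≥0∞) ^ p ≠ 0 := by
    simp [ENNReal.rpow_eq_zero_iff, ha0.ne', hp0.not_gt]
  have hat : (a : ℝ≥0∞) ^ p ≠ ∞ := ENNReal.rpow_ne_top_of_nonneg hp0.le ENNReal.coe_ne_top
  rw [ENNReal.coe_toNNReal hKt, hαa, ENNReal.le_div_iff_mul_le (Or.inl ha0') (Or.inl hat), mul_comm]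
  -- The progression of heights is started at the given height, so that the term of index zero is
  -- the one wanted.
  have hscale : dyadicScale a 0 = a := by simp [dyadicScale]
  have hA := (ENNReal.le_tsum (f := fun m => (dyadicScale a m : ℝ≥0∞) ^ p *
      volume {x : EuclideanSpace ℝ (Fin d) | ‖x‖ ∈ smallRadiusLevel d G (dyadicScale a m)})
      0).trans (tsum_smallRadiusLevel_le hd hp1 hm ha0)
  have hB := (ENNReal.le_tsum (f := fun m => (dyadicScale a m : ℝ≥0∞) ^ p *
      volume {x : EuclideanSpace ℝ (Fin d) | ‖x‖ ∈ largeRadiusLevel d G (dyadicScale a m)})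
      0).trans (tsum_largeRadiusLevel_le hd hp1 hm ha0)
  simp only [hscale] at hA hB
  have h4 : (4 : ℝ≥0) ≤ 2 ^ (d - 1) := by
    calc (4 : ℝ≥0) = 2 ^ 2 := by norm_num
      _ ≤ _ := pow_le_pow_right₀ (by norm_num) (by omega)
  have hD : (a : ℝ≥0∞) ^ p * volume {x : EuclideanSpace ℝ (Fin d) | ‖x‖ ∈ nearLevel d E G a} ≤
      (c : ℝ≥0∞) ^ p * (σ * 2 ^ (d - 1) * (C * lacunaryConst p)) * profileMass d p G := by
    have h1 := (volume_nearLevel_le hd hp hm hGt E hC he (a / c)).trans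
      (mul_le_mul_right (levelSum_le (shellNorm d p G) hp1.le h4 _ he (a / c)) _)
    rw [← hc, mul_div_cancel₀ _ hc0.ne', tsum_shellNorm_rpow hp0 hGt] at h1
    have h2 : (a : ℝ≥0∞) ^ p = (c : ℝ≥0∞) ^ p * ((a / c : ℝ≥0) : ℝ≥0∞) ^ p := by
      rw [← ENNReal.mul_rpow_of_nonneg _ _ hp0.le, ← ENNReal.coe_mul, mul_div_cancel₀ _ hc0.ne']
    rw [h2, mul_assoc]
    refine (mul_le_mul_right h1 _).trans_eq ?_
    ring
  calc _ ≤ (a : ℝ≥0∞) ^ p * _ :=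
        mul_le_mul_right (volume_maximalFunction_le hd hE hfG a) _
    _ ≤ smallRadiusConst d p * profileMass d p G + largeRadiusConst d p * profileMass d p G +
        (c : ℝ≥0∞) ^ p * (σ * 2 ^ (d - 1) * (C * lacunaryConst p)) * profileMass d p G := by
        rw [mul_add, mul_add]
        exact add_le_add (add_le_add hA hB) hD
    _ = _ := by rw [hmass, hK]; ring

theorem tsum_rpow_le_rpow_tsum {ι : Type*} (x : ι → ℝ≥0∞) {s : ℝ} (hs : 1 ≤ s) :
    ∑' i, x i ^ s ≤ (∑' i, x i) ^ s := by
  have hs1 : 0 ≤ s - 1 := by linarith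
  have hsplit : ∀ y : ℝ≥0∞, y ^ s = y * y ^ (s - 1) := by
    intro y
    conv_rhs => rw [← ENNReal.rpow_one y, ← ENNReal.rpow_mul, one_mul,
      ← ENNReal.rpow_add_of_nonneg _ _ zero_le_one hs1, add_sub_cancel]
  rw [hsplit (∑' i, x i), ← ENNReal.tsum_mul_right]
  refine ENNReal.tsum_le_tsum fun i => ?_
  rw [hsplit]
  exact mul_le_mul_right (ENNReal.rpow_le_rpow (ENNReal.le_tsum i) hs1) _

theorem add_three_rpow_le (x y z : ℝ≥0∞) {s : ℝ} (hs : 0 ≤ s) :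
    (x + y + z) ^ s ≤ 3 ^ s * (x ^ s + y ^ s + z ^ s) := by
  have h := sum_three_rpow_le hs fun i : ℤ => if i = -1 then x else if i = 0 then y else z
  have e : Finset.Icc (-1 : ℤ) 1 = {-1, 0, 1} := by decide
  simpa [e, add_assoc] using h

theorem boundedToLorentz_of_summedEntropyBound (hd : 3 ≤ d) (hp : p = (d : ℝ) / ((d : ℝ) - 1))
    (hE : E ⊆ Ioi 0) {q : ℝ} (hq : p < q) (hent : SummedEntropyBound d E p q) :
    BoundedRadialToLorentz d E p q := by
  have hp1 := one_lt_criticalExponent hd hp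
  have hp0 : 0 < p := by linarith
  have hq0 : 0 < q := by linarith
  set s := q / p with hs
  have hs1 : 1 < s := by rw [hs, one_lt_div hp0]; exact hq
  have hs0 : 0 < s := by linarith
  obtain ⟨W, hW, hw⟩ := exists_sum_proximityDensity_le hd hp hq hent
  rw [← hs] at hw
  have he := proximityDensity_le_of_sum hs0 hw
  have hC : W ^ (1 / s) ≠ ∞ := ENNReal.rpow_ne_top_of_nonneg (by positivity) hW
  set σ := (volume : Measure (EuclideanSpace ℝ (Fin d))).toSphere univ with hσ
  have hσ0 : σ ≠ 0 := toSphere_univ_ne_zero (by omega)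
  have hσt : σ ≠ ∞ := toSphere_univ_ne_top
  set c := nearConst d with hc
  have hc0 : 0 < c := nearConst_pos hd
  set K₀ : ℝ≥0∞ := smallRadiusConst d p ^ s + largeRadiusConst d p ^ s +
    ((c : ℝ≥0∞) ^ p * (σ * 2 ^ (d - 1))) ^ s * (levelConst p s * W) with hK₀
  set K : ℝ≥0∞ := 2 ^ q * (3 ^ s * K₀) * σ⁻¹ ^ s with hK
  have hKt : K ≠ ∞ := by
    have h1 := ENNReal.rpow_ne_top_of_nonneg hs0.le (smallRadiusConst_ne_top hd hp1)
    have h2 := ENNReal.rpow_ne_top_of_nonneg hs0.le (largeRadiusConst_ne_top hd hp1)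
    have h3 : (c : ℝ≥0∞) ^ p ≠ ∞ := ENNReal.rpow_ne_top_of_nonneg hp0.le ENNReal.coe_ne_top
    have h4 : σ⁻¹ ^ s ≠ ∞ := ENNReal.rpow_ne_top_of_nonneg hs0.le (ENNReal.inv_ne_top.2 hσ0)
    have h5 := levelConst_ne_top hp1 hs1
    have h6 : ((c : ℝ≥0∞) ^ p * (σ * 2 ^ (d - 1))) ^ s ≠ ∞ :=
      ENNReal.rpow_ne_top_of_nonneg hs0.le (by finiteness)
    have h7 : (2 : ℝ≥0∞) ^ q ≠ ∞ := ENNReal.rpow_ne_top_of_nonneg hq0.le (by simp)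
    have h8 : (3 : ℝ≥0∞) ^ s ≠ ∞ := ENNReal.rpow_ne_top_of_nonneg hs0.le (by simp)
    rw [hK, hK₀]
    finiteness
  refine ⟨(K ^ (1 / q)).toNNReal, fun f hf hfp => ?_⟩
  obtain ⟨G, hm, hN, hfG⟩ := exists_measurable_profile hd hp0 hf hfp
  change _ = σ * profileMass d p G at hN
  set nf := eLpNorm f (ENNReal.ofReal p) volume with hnf
  have hmass : profileMass d p G = σ⁻¹ * nf ^ p := by
    rw [hN, ← mul_assoc, ENNReal.inv_mul_cancel hσ0 hσt, one_mul]
  have hGt : profileMass d p G ≠ ∞ := by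
    rw [hmass]
    exact ENNReal.mul_ne_top (ENNReal.inv_ne_top.2 hσ0)
      (ENNReal.rpow_ne_top_of_nonneg hp0.le hfp.2.ne)
  have h4 : (4 : ℝ≥0) ≤ 2 ^ (d - 1) := by
    calc (4 : ℝ≥0) = 2 ^ 2 := by norm_num
      _ ≤ _ := pow_le_pow_right₀ (by norm_num) (by omega)
  set α : ℤ → ℝ≥0 := dyadicScale 1 with hα
  set x : ℤ → ℝ≥0∞ := fun m => (α m : ℝ≥0∞) ^ p *
    volume {x : EuclideanSpace ℝ (Fin d) | ‖x‖ ∈ smallRadiusLevel d G (α m)} with hx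
  set y : ℤ → ℝ≥0∞ := fun m => (α m : ℝ≥0∞) ^ p *
    volume {x : EuclideanSpace ℝ (Fin d) | ‖x‖ ∈ largeRadiusLevel d G (α m)} with hy
  set z : ℤ → ℝ≥0∞ := fun m => (α m : ℝ≥0∞) ^ p *
    volume {x : EuclideanSpace ℝ (Fin d) | ‖x‖ ∈ nearLevel d E G (α m)} with hz
  have hX : ∑' m, x m ^ s ≤ smallRadiusConst d p ^ s * profileMass d p G ^ s := by
    rw [← ENNReal.mul_rpow_of_nonneg _ _ hs0.le]
    exact (tsum_rpow_le_rpow_tsum x hs1.le).trans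
      (ENNReal.rpow_le_rpow (tsum_smallRadiusLevel_le hd hp1 hm one_pos) hs0.le)
  have hY : ∑' m, y m ^ s ≤ largeRadiusConst d p ^ s * profileMass d p G ^ s := by
    rw [← ENNReal.mul_rpow_of_nonneg _ _ hs0.le]
    exact (tsum_rpow_le_rpow_tsum y hs1.le).trans
      (ENNReal.rpow_le_rpow (tsum_largeRadiusLevel_le hd hp1 hm one_pos) hs0.le)
  have hZ : ∑' m, z m ^ s ≤ ((c : ℝ≥0∞) ^ p * (σ * 2 ^ (d - 1))) ^ s * (levelConst p s * W) *
      profileMass d p G ^ s := by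
    -- The scale `c⁻¹` is chosen so that the heights `nearConst d * dyadicScale c⁻¹ m` are the
    -- powers of two.
    have h1 := tsum_levelSum_rpow_le (shellNorm d p G) hs1 hp1 h4 (proximityDensity p E) W hw
      (c := c⁻¹) (by positivity)
    rw [tsum_shellNorm_rpow hp0 hGt] at h1
    rw [mul_assoc]
    refine le_trans ?_ (mul_le_mul_right h1 _)
    rw [← ENNReal.tsum_mul_left]
    refine ENNReal.tsum_le_tsum fun m => ?_
    rw [← ENNReal.mul_rpow_of_nonneg _ _ hs0.le]
    refine ENNReal.rpow_le_rpow ?_ hs0.le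
    have h2 := volume_nearLevel_le hd hp hm hGt E hC he (dyadicScale c⁻¹ m)
    have h3 : c * dyadicScale c⁻¹ m = α m := by
      simp only [hα, dyadicScale]; rw [← mul_assoc, mul_inv_cancel₀ hc0.ne']
    rw [← hc, h3] at h2
    simp only [hz]
    rw [← h3, ENNReal.coe_mul, ENNReal.mul_rpow_of_nonneg _ _ hp0.le, mul_assoc, mul_assoc,
      ← ENNReal.coe_mul, h3]
    exact mul_le_mul_right h2 _
  have hlev : ∑' m : ℤ, (α m : ℝ≥0∞) ^ q *
      volume {x | (α m : ℝ≥0∞) < maximalFunction E f x} ^ (q / p) ≤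
      3 ^ s * K₀ * profileMass d p G ^ s := by
    calc _ ≤ ∑' m : ℤ, 3 ^ s * (x m ^ s + y m ^ s + z m ^ s) := by
          refine ENNReal.tsum_le_tsum fun m => ?_
          refine le_trans ?_ (add_three_rpow_le _ _ _ hs0.le)
          have h1 : (α m : ℝ≥0∞) ^ q = ((α m : ℝ≥0∞) ^ p) ^ s := by
            rw [← ENNReal.rpow_mul, hs, mul_div_cancel₀ _ hp0.ne']
          rw [h1, ← hs, ← ENNReal.mul_rpow_of_nonneg _ _ hs0.le]
          refine ENNReal.rpow_le_rpow ?_ hs0.le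
          simp only [hx, hy, hz]
          rw [← mul_add, ← mul_add]
          exact mul_le_mul_right (volume_maximalFunction_le hd hE hfG (α m)) _
      _ = 3 ^ s * (∑' m, x m ^ s + ∑' m, y m ^ s + ∑' m, z m ^ s) := by
          rw [ENNReal.tsum_mul_left, ENNReal.tsum_add, ENNReal.tsum_add]
      _ ≤ _ := by
          rw [mul_assoc]
          refine mul_le_mul_right ?_ _
          rw [hK₀, add_mul, add_mul]
          exact add_le_add (add_le_add hX hY) hZ
  have hfinal : lorentzNorm volume p q (maximalFunction E f) ^ q ≤ K * nf ^ q := by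
    refine (lorentzNorm_rpow_le volume _ hp0 hq0).trans ?_
    refine (mul_le_mul_right hlev _).trans_eq ?_
    rw [hmass, ENNReal.mul_rpow_of_nonneg _ _ hs0.le, ← ENNReal.rpow_mul, hs,
      mul_div_cancel₀ _ hp0.ne', hK, hs]
    ring
  rw [ENNReal.coe_toNNReal (ENNReal.rpow_ne_top_of_nonneg (by positivity) hKt)]
  have h := ENNReal.rpow_le_rpow hfinal (one_div_pos.2 hq0).le
  rwa [ENNReal.mul_rpow_of_nonneg _ _ (by positivity), ← ENNReal.rpow_mul, ← ENNReal.rpow_mul,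
    mul_one_div_cancel hq0.ne', ENNReal.rpow_one, ENNReal.rpow_one] at h

end SphericalMaximal
end

noncomputable section
namespace SphericalMaximal

/-! ### Necessity of the entropy conditions -/

variable {d : ℕ} {p : ℝ} {E : Set ℝ}

/-- Take the union of the grid cells of length `a` that meet `A`. These cells cover `A`, so there
are at least `entropyNumber A a` of them, and they are disjoint. -/
theorem exists_measurable_subset_thickening {A : Set ℝ} (hA : Bornology.IsBounded A) {a : ℝ}
    (ha : 0 < a) : ∃ U : Set ℝ, MeasurableSet U ∧ (∀ r ∈ U, ∃ t ∈ A, |r - t| ≤ a) ∧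
      entropyNumber A a * ENNReal.ofReal a ≤ volume U := by
  classical
  set I : Set ℤ := (fun t : ℝ => ⌊t / a⌋) '' A with hI
  have hfin : I.Finite := by
    obtain ⟨M, hM⟩ := hA.subset_closedBall 0
    refine (Set.finite_Icc (⌊-M / a⌋) (⌊M / a⌋)).subset ?_
    rintro _ ⟨t, ht, rfl⟩
    have h1 := hM ht
    rw [Real.closedBall_eq_Icc, zero_sub, zero_add] at h1
    exact ⟨Int.floor_le_floor (div_le_div_of_nonneg_right h1.1 ha.le),
      Int.floor_le_floor (div_le_div_of_nonneg_right h1.2 ha.le)⟩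
  set S : Finset ℤ := hfin.toFinset with hS
  set cell : ℤ → Set ℝ := fun i => Ico (i * a) (i * a + a) with hcell
  have hmem : ∀ t : ℝ, t ∈ cell ⌊t / a⌋ := by
    intro t
    have h1 := Int.floor_le (t / a)
    have h2 := Int.lt_floor_add_one (t / a)
    rw [le_div_iff₀ ha] at h1
    rw [div_lt_iff₀ ha] at h2
    exact ⟨h1, by linarith⟩
  have huniq : ∀ (t : ℝ) (i : ℤ), t ∈ cell i → i = ⌊t / a⌋ := by
    intro t i hi
    symm
    rw [Int.floor_eq_iff, le_div_iff₀ ha, div_lt_iff₀ ha]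
    exact ⟨hi.1, by linarith [hi.2]⟩
  refine ⟨⋃ i ∈ S, cell i, S.measurableSet_biUnion fun i _ => measurableSet_Ico, ?_, ?_⟩
  · intro r hr
    obtain ⟨i, hi, hri⟩ := mem_iUnion₂.1 hr
    obtain ⟨t, ht, rfl⟩ := hfin.mem_toFinset.1 hi
    have h2 := hmem t
    refine ⟨t, ht, abs_le.2 ⟨by linarith [hri.1, h2.2], by linarith [hri.2, h2.1]⟩⟩
  · rw [measure_biUnion_finset (fun i _ j _ hij => Set.disjoint_left.2 fun t hi hj =>
      hij ((huniq t i hi).trans (huniq t j hj).symm)) fun i _ => measurableSet_Ico]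
    have hvol : ∀ i ∈ S, volume (cell i) = ENNReal.ofReal a := by
      intro i _
      simp only [hcell, Real.volume_Ico]; congr 1; ring
    rw [Finset.sum_congr rfl hvol, Finset.sum_const, nsmul_eq_mul]
    refine mul_le_mul_left ?_ _
    have hinj : Function.Injective fun i : ℤ => (i : ℝ) * a := fun i j hij => by
      exact_mod_cast mul_right_cancel₀ ha.ne' hij
    refine (iInf₂_le (S.map ⟨_, hinj⟩) ?_).trans_eq (by simp)
    intro t ht
    refine mem_iUnion₂.2 ⟨⌊t / a⌋ * a, ?_, (hmem t).1, (hmem t).2.le⟩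
    exact Finset.mem_map.2 ⟨⌊t / a⌋, hfin.mem_toFinset.2 ⟨t, ht, rfl⟩, rfl⟩

theorem lintegral_inv_Ioo {a b : ℝ} (ha : 0 < a) (hab : a ≤ b) :
    ∫⁻ s in Ioo a b, ENNReal.ofReal s⁻¹ = ENNReal.ofReal (Real.log (b / a)) := by
  have hintegrable : IntervalIntegrable (fun s : ℝ => s⁻¹) volume a b :=
    intervalIntegral.intervalIntegrable_inv (fun s hs => by
      rw [uIcc_of_le hab] at hs; exact (ha.trans_le hs.1).ne') continuousOn_id
  rw [← integral_inv_of_pos ha (ha.trans_le hab), intervalIntegral.integral_of_le hab,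
    ofReal_integral_eq_lintegral_ofReal hintegrable.1, restrict_Ioo_eq_restrict_Ioc]
  exact (ae_restrict_iff' measurableSet_Ioc).2 (Filter.Eventually.of_forall fun s hs =>
    inv_nonneg.2 (ha.le.trans hs.1.le))

/-- The profile of the test function. -/
def testProfile (d : ℕ) (lo hi : ℝ) : ℝ → ℝ := (Ioo lo hi).indicator fun s => (s ^ (d - 1))⁻¹

theorem measurable_testProfile (d : ℕ) (lo hi : ℝ) : Measurable (testProfile d lo hi) :=
  Measurable.indicator (by fun_prop) measurableSet_Ioo

theorem testProfile_nonneg (d : ℕ) {lo : ℝ} (hlo : 0 ≤ lo) (hi s : ℝ) :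
    0 ≤ testProfile d lo hi s := by
  refine indicator_nonneg (fun s hs => ?_) s
  have : 0 < s := hlo.trans_lt hs.1
  positivity

/-- The test function. -/
def testFunction (d : ℕ) (lo hi : ℝ) (x : EuclideanSpace ℝ (Fin d)) : ℂ :=
  (testProfile d lo hi ‖x‖ : ℂ)

theorem isRadial_testFunction (d : ℕ) (lo hi : ℝ) : IsRadial (testFunction d lo hi) :=
  fun x y h => by simp only [testFunction, h]

/-- Since `(d-1) p = d`, the `p`-th power of the profile times `s^(d-1)` is `1/s`. -/
theorem eLpNorm_testFunction (hd : 3 ≤ d) (hp : p = (d : ℝ) / ((d : ℝ) - 1)) {lo hi : ℝ}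
    (hlo : 0 < lo) (hhi : lo ≤ hi) :
    eLpNorm (testFunction d lo hi) (ENNReal.ofReal p) volume ^ p =
      (volume : Measure (EuclideanSpace ℝ (Fin d))).toSphere univ *
        ENNReal.ofReal (Real.log (hi / lo)) := by
  have hp1 := one_lt_criticalExponent hd hp
  have hp0 : 0 < p := by linarith
  have hD : (3 : ℝ) ≤ d := by exact_mod_cast hd
  have : Nonempty (Fin d) := ⟨⟨0, by omega⟩⟩
  rw [eLpNorm_eq_lintegral_rpow_enorm_toReal (by simpa using hp0) ENNReal.ofReal_ne_top,
    ENNReal.toReal_ofReal hp0.le, ← ENNReal.rpow_mul, one_div_mul_cancel hp0.ne', ENNReal.rpow_one]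
  have h1 := lintegral_fun_norm_eq (volume : Measure (EuclideanSpace ℝ (Fin d)))
    (Φ := fun s => ‖(testProfile d lo hi s : ℂ)‖ₑ ^ p)
    ((Complex.measurable_ofReal.comp (measurable_testProfile d lo hi)).enorm.pow_const p)
  rw [finrank_euclideanSpace_fin] at h1
  refine h1.trans (congrArg _ ?_)
  rw [← lintegral_inv_Ioo hlo hhi, ← lintegral_indicator measurableSet_Ioo,
    ← lintegral_indicator measurableSet_Ioi]
  congr 1; ext s
  by_cases hs : s ∈ Ioo lo hi
  · have hs0 : 0 < s := hlo.trans hs.1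
    rw [indicator_of_mem hs, indicator_of_mem (mem_Ioi.2 hs0), testProfile, indicator_of_mem hs,
      ← ofReal_norm, Complex.norm_real, Real.norm_of_nonneg (by positivity),
      ENNReal.ofReal_rpow_of_nonneg (by positivity) hp0.le,
      ← ENNReal.ofReal_mul (by positivity)]
    congr 1
    have e : ((s ^ (d - 1))⁻¹) ^ p = (s ^ d)⁻¹ := by
      rw [Real.inv_rpow (by positivity), ← Real.rpow_natCast, ← Real.rpow_mul hs0.le,
        Nat.cast_sub (by omega), hp, Nat.cast_one, mul_div_cancel₀ _ (by linarith),
        Real.rpow_natCast]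
    obtain ⟨n, rfl⟩ : ∃ n, d = n + 1 := ⟨d - 1, by omega⟩
    rw [e, Nat.add_sub_cancel, pow_succ]
    field_simp
  · rw [indicator_of_notMem hs]
    refine indicator_apply_eq_zero.2 fun _ => ?_
    rw [testProfile, indicator_of_notMem hs]
    simp [ENNReal.zero_rpow_of_pos hp0]

theorem memLp_testFunction (hd : 3 ≤ d) (hp : p = (d : ℝ) / ((d : ℝ) - 1)) {lo hi : ℝ}
    (hlo : 0 < lo) (hhi : lo ≤ hi) :
    MemLp (testFunction d lo hi) (ENNReal.ofReal p) volume := by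
  have hp0 : 0 < p := by linarith [one_lt_criticalExponent hd hp]
  refine ⟨(Complex.measurable_ofReal.comp ((measurable_testProfile d lo hi).comp
    measurable_norm)).aestronglyMeasurable, ?_⟩
  have h := eLpNorm_testFunction hd hp hlo hhi
  rw [← ENNReal.rpow_lt_top_iff_of_pos hp0, h]
  exact ENNReal.mul_lt_top toSphere_univ_ne_top.lt_top ENNReal.ofReal_lt_top

/-- The constant in the lower bound for the test function. -/
def testConst (d : ℕ) : ℝ := (kernelConst d).toReal * (4⁻¹ ^ d * 4⁻¹ ^ (d - 1)) / 2

theorem testConst_pos (hd : 3 ≤ d) : 0 < testConst d := by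
  have := ENNReal.toReal_pos (kernelConst_ne_zero hd) (kernelConst_ne_top hd)
  unfold testConst; positivity

/-- For `2 |r - t| ≤ s ≤ r` the kernel is at least a multiple of `s^(d-2) / (r^(d-2) t)`, so against
the profile `s^(-(d-1))` the integrand is at least a multiple of `2^(-k(d-1)) / s`. Integrating over
`(2 * 2^k δ, 2^k / 2)` gives `log(1/(4δ))`, which is at least `log(1/δ) / 2` because `δ ≤ 1/16`. -/
theorem le_absSphericalMean_testFunction (hd : 3 ≤ d) {δ lo hi : ℝ} (hδ : 0 < δ) (hδ' : δ ≤ 1 / 16)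
    {k : ℤ} (hlo0 : 0 ≤ lo) (hlo : lo ≤ 2 * 2 ^ k * δ) (hhi : (2 : ℝ) ^ k ≤ hi)
    {x : EuclideanSpace ℝ (Fin d)} {t : ℝ} (ht : t ∈ Icc ((2 : ℝ) ^ k) (2 ^ (k + 1)))
    (hx : |‖x‖ - t| ≤ 2 ^ k * δ) :
    ENNReal.ofReal (testConst d * Real.log (1 / δ) / (2 ^ k) ^ (d - 1)) ≤
      absSphericalMean t (testFunction d lo hi) x := by
  set r := ‖x‖ with hr
  have hk := two_zpow_pos k
  have ht2 := ht.2
  rw [two_zpow_succ] at ht2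
  have ht0 : 0 < t := hk.trans_le ht.1
  obtain ⟨hx1, hx2⟩ := abs_le.1 hx
  have hkδ : 2 ^ k * δ ≤ 2 ^ k / 16 := by nlinarith
  have hrlow : 2 ^ k / 2 ≤ r := by linarith [ht.1]
  have hrhigh : r ≤ 4 * 2 ^ k := by linarith
  have hr0 : 0 < r := by linarith
  have hx0 : x ≠ 0 := norm_pos_iff.1 hr0
  refine le_trans ?_ (radialMean_le_absSphericalMean hd (measurable_testProfile d lo hi)
    (testProfile_nonneg d hlo0 hi) hx0 ht0)
  have hab : 2 * 2 ^ k * δ ≤ 2 ^ k / 2 := by linarith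
  have ha0 : 0 < 2 * 2 ^ k * δ := by positivity
  have hsub : Ioo (2 * 2 ^ k * δ) ((2 : ℝ) ^ k / 2) ⊆ Ioo |r - t| (r + t) := fun s hs =>
    ⟨by linarith [hs.1, abs_nonneg (r - t)], by linarith [hs.2]⟩
  set B : ℝ := 4⁻¹ ^ d * (4⁻¹ ^ (d - 1) / (2 ^ k) ^ (d - 1)) with hB
  have hpt : ∀ s ∈ Ioo (2 * 2 ^ k * δ) ((2 : ℝ) ^ k / 2),
      ENNReal.ofReal B * ENNReal.ofReal s⁻¹ ≤ ENNReal.ofReal (sphericalKernel d t r s) *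
        ENNReal.ofReal (testProfile d lo hi s) := by
    intro s hs
    have hs0 : 0 < s := ha0.trans hs.1
    have hK := le_sphericalKernel hd ht0 hs0 (show 2 * |r - t| ≤ s by linarith [hs.1])
      (by linarith [hs.2])
    have hmem : s ∈ Ioo lo hi := ⟨by linarith [hs.1], by linarith [hs.2]⟩
    rw [testProfile, indicator_of_mem hmem, ← ENNReal.ofReal_mul (by positivity),
      ← ENNReal.ofReal_mul (le_trans (by positivity) hK)]
    refine ENNReal.ofReal_le_ofReal (le_trans ?_ (mul_le_mul_of_nonneg_right hK (by positivity)))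
    obtain ⟨n, rfl⟩ : ∃ n, d = n + 3 := ⟨d - 3, by omega⟩
    rw [hB, show n + 3 - 2 = n + 1 by omega, show n + 3 - 1 = n + 2 by omega,
      show n + 3 - 3 = n by omega]
    have e1 : 4⁻¹ ^ (n + 3) * (s ^ (n + 1) / (r * t) ^ (n + 1) * t ^ n) * (s ^ (n + 2))⁻¹ =
        4⁻¹ ^ (n + 3) * (1 / (r ^ (n + 1) * t)) * s⁻¹ := by
      rw [mul_pow]; field_simp; ring
    rw [e1]
    refine mul_le_mul_of_nonneg_right (mul_le_mul_of_nonneg_left ?_ (by positivity))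
      (by positivity)
    rw [inv_pow, inv_eq_one_div, div_div, ← mul_pow]
    refine one_div_le_one_div_of_le (by positivity) ?_
    rw [pow_succ (4 * (2 : ℝ) ^ k)]
    exact mul_le_mul (pow_le_pow_left₀ hr0.le hrhigh _) (by linarith) ht0.le (by positivity)
  have hlog : Real.log (1 / δ) / 2 ≤ Real.log ((2 : ℝ) ^ k / 2 / (2 * 2 ^ k * δ)) := by
    have e2 : (2 : ℝ) ^ k / 2 / (2 * 2 ^ k * δ) = 1 / (4 * δ) := by field_simp; norm_num
    rw [e2, one_div, one_div, Real.log_inv, Real.log_inv, Real.log_mul (by norm_num) hδ.ne']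
    have h16 : Real.log δ ≤ Real.log (1 / 16) := Real.log_le_log hδ hδ'
    have e3 : Real.log (1 / 16) = -(2 * Real.log 4) := by
      rw [one_div, Real.log_inv, show (16 : ℝ) = 4 ^ 2 by norm_num, Real.log_pow]; norm_num
    rw [e3] at h16
    linarith
  have hlog0 : 0 ≤ Real.log (1 / δ) := Real.log_nonneg (by
    rw [le_div_iff₀ hδ]; linarith)
  calc _ = ENNReal.ofReal ((kernelConst d).toReal * (B * (Real.log (1 / δ) / 2))) := by
        congr 1; rw [testConst, hB]; ring
    _ = kernelConst d * (ENNReal.ofReal B * ENNReal.ofReal (Real.log (1 / δ) / 2)) := by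
        rw [ENNReal.ofReal_mul ENNReal.toReal_nonneg, ENNReal.ofReal_toReal (kernelConst_ne_top hd),
          ENNReal.ofReal_mul (by positivity)]
    _ ≤ kernelConst d * (ENNReal.ofReal B * ∫⁻ s in Ioo (2 * 2 ^ k * δ) ((2 : ℝ) ^ k / 2),
          ENNReal.ofReal s⁻¹) := by
        rw [lintegral_inv_Ioo ha0 hab]
        exact mul_le_mul_right (mul_le_mul_right (ENNReal.ofReal_le_ofReal hlog) _) _
    _ = kernelConst d * ∫⁻ s in Ioo (2 * 2 ^ k * δ) ((2 : ℝ) ^ k / 2),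
          ENNReal.ofReal B * ENNReal.ofReal s⁻¹ := by
        rw [lintegral_const_mul' _ _ ENNReal.ofReal_ne_top]
    _ ≤ kernelConst d * ∫⁻ s in Ioo (2 * 2 ^ k * δ) ((2 : ℝ) ^ k / 2),
          ENNReal.ofReal (sphericalKernel d t r s) * ENNReal.ofReal (testProfile d lo hi s) :=
        mul_le_mul_right (setLIntegral_mono' measurableSet_Ioo hpt) _
    _ ≤ _ := mul_le_mul_right (lintegral_mono_set hsub) _

/-- All points whose norm is in the thickening of `E^k` belong to the level set. With `β = α
2^(k(d-1))` one has `β^p = α^p 2^(kd)`, so the factor multiplying the entropy number does not depend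
on `k`. -/
theorem entropyNumber_le_volume_level (hd : 3 ≤ d) (hp : p = (d : ℝ) / ((d : ℝ) - 1))
    {δ lo hi : ℝ} (hδ : 0 < δ) (hδ' : δ ≤ 1 / 16) {k : ℤ} (hlo0 : 0 ≤ lo)
    (hlo : lo ≤ 2 * 2 ^ k * δ) (hhi : (2 : ℝ) ^ k ≤ hi) {α β : ℝ≥0}
    (hαβ : (α : ℝ) * (2 ^ k) ^ (d - 1) = β) (hβ : (β : ℝ) < testConst d * Real.log (1 / δ)) :
    (β : ℝ≥0∞) ^ p * ((volume : Measure (EuclideanSpace ℝ (Fin d))).toSphere univ *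
      ENNReal.ofReal (δ / 2 ^ (d - 1))) * entropyNumber (dyadicPiece E k) (2 ^ k * δ) ≤
    (α : ℝ≥0∞) ^ p *
      volume {x | (α : ℝ≥0∞) < maximalFunction E (testFunction d lo hi) x} := by
  have hk := two_zpow_pos k
  have hp1 := one_lt_criticalExponent hd hp
  have hp0 : 0 < p := by linarith
  have hD : (3 : ℝ) ≤ d := by exact_mod_cast hd
  obtain ⟨U, hUm, hU, hvol⟩ := exists_measurable_subset_thickening (A := dyadicPiece E k)
    ((Metric.isBounded_Icc _ _).subset inter_subset_left) (mul_pos hk hδ)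
  have hkδ : 2 ^ k * δ ≤ 2 ^ k / 16 := by nlinarith
  have hUk : U ⊆ Ici (2 ^ (k - 1)) := by
    intro r hr
    obtain ⟨t, ht, hrt⟩ := hU r hr
    rw [mem_Ici, zpow_sub_one₀ two_ne_zero]
    have := (abs_le.1 hrt).1
    linarith [ht.1.1]
  have hsub : {x : EuclideanSpace ℝ (Fin d) | ‖x‖ ∈ U} ⊆
      {x | (α : ℝ≥0∞) < maximalFunction E (testFunction d lo hi) x} := by
    intro x hx
    obtain ⟨t, ht, hrt⟩ := hU _ hx
    have h1 := le_absSphericalMean_testFunction hd hδ hδ' hlo0 hlo hhi ht.1 hrt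
    have h2 : (α : ℝ≥0∞) <
        ENNReal.ofReal (testConst d * Real.log (1 / δ) / (2 ^ k) ^ (d - 1)) := by
      rw [← ENNReal.ofReal_coe_nnreal, ENNReal.ofReal_lt_ofReal_iff_of_nonneg α.coe_nonneg,
        lt_div_iff₀ (by positivity), hαβ]
      exact hβ
    exact (h2.trans_le h1).trans_le (le_iSup₂ (f := fun t (_ : t ∈ E) =>
      absSphericalMean t (testFunction d lo hi) x) t ht.2)
  refine le_trans ?_ (mul_le_mul_right ((le_volume_norm_mem_shell (by omega) hUm hUk).trans
    (measure_mono hsub)) _)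
  have hβα : (β : ℝ≥0∞) ^ p = (α : ℝ≥0∞) ^ p * ENNReal.ofReal ((2 ^ k) ^ d) := by
    have e1 : (β : ℝ≥0∞) = α * ENNReal.ofReal ((2 ^ k) ^ (d - 1)) := by
      rw [← ENNReal.ofReal_coe_nnreal, ← ENNReal.ofReal_coe_nnreal,
        ← ENNReal.ofReal_mul α.coe_nonneg, hαβ]
    have e2 : (((2 : ℝ) ^ k) ^ (d - 1)) ^ p = (2 ^ k) ^ d := by
      rw [← Real.rpow_natCast, ← Real.rpow_mul hk.le, Nat.cast_sub (by omega), hp, Nat.cast_one,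
        mul_div_cancel₀ _ (by linarith), Real.rpow_natCast]
    rw [e1, ENNReal.mul_rpow_of_nonneg _ _ hp0.le, ENNReal.ofReal_rpow_of_nonneg (by positivity)
      hp0.le, e2]
  have e3 : ENNReal.ofReal ((2 ^ k) ^ d) * ENNReal.ofReal (δ / 2 ^ (d - 1)) =
      ENNReal.ofReal ((2 ^ (k - 1)) ^ (d - 1)) * ENNReal.ofReal (2 ^ k * δ) := by
    rw [← ENNReal.ofReal_mul (by positivity), ← ENNReal.ofReal_mul (by positivity)]
    congr 1
    obtain ⟨n, rfl⟩ : ∃ n, d = n + 1 := ⟨d - 1, by omega⟩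
    rw [zpow_sub_one₀ two_ne_zero, Nat.add_sub_cancel, mul_pow, pow_succ, inv_pow]
    field_simp
  calc _ = (α : ℝ≥0∞) ^ p * ((volume : Measure (EuclideanSpace ℝ (Fin d))).toSphere univ *
        ((ENNReal.ofReal ((2 ^ k) ^ d) * ENNReal.ofReal (δ / 2 ^ (d - 1))) *
          entropyNumber (dyadicPiece E k) (2 ^ k * δ))) := by rw [hβα]; ring
    _ = (α : ℝ≥0∞) ^ p * ((volume : Measure (EuclideanSpace ℝ (Fin d))).toSphere univ *
        (ENNReal.ofReal ((2 ^ (k - 1)) ^ (d - 1)) *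
          (entropyNumber (dyadicPiece E k) (2 ^ k * δ) * ENNReal.ofReal (2 ^ k * δ)))) := by
        rw [e3]; ring
    _ ≤ _ := mul_le_mul_right (mul_le_mul_right (mul_le_mul_right hvol _) _) _

end SphericalMaximal
end

noncomputable section
namespace SphericalMaximal

variable {d : ℕ} {p : ℝ} {E : Set ℝ}

/-! ### From the maximal inequalities to the entropy bounds. -/

theorem entropyNumber_anti (A : Set ℝ) {a b : ℝ} (hab : a ≤ b) :
    entropyNumber A b ≤ entropyNumber A a :=
  le_iInf₂ fun S hS => iInf₂_le S (hS.trans (iUnion₂_mono fun _ _ =>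
    Icc_subset_Icc_right (by linarith)))

section TestRange

variable {δ : ℝ}

theorem testRange_le (hδ : 0 < δ) (hδ1 : δ ≤ 1 / 16) (a : ℝ) :
    2 * (2 : ℝ) ^ a * δ ≤ 2 ^ (a + Real.log (1 / δ)) := by
  have hL : 0 ≤ Real.log (1 / δ) := Real.log_nonneg (by rw [le_div_iff₀ hδ]; linarith)
  have h1 : (2 : ℝ) ^ a ≤ 2 ^ (a + Real.log (1 / δ)) :=
    Real.rpow_le_rpow_of_exponent_le one_le_two (by linarith)
  have h2 : (0 : ℝ) < 2 ^ a := by positivity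
  nlinarith

theorem log_testRange_le (hδ : 0 < δ) (hδ1 : δ ≤ 1 / 16) (a : ℝ) :
    Real.log ((2 : ℝ) ^ (a + Real.log (1 / δ)) / (2 * 2 ^ a * δ)) ≤ 2 * Real.log (1 / δ) := by
  have hL : 0 ≤ Real.log (1 / δ) := Real.log_nonneg (by rw [le_div_iff₀ hδ]; linarith)
  have h2 : (0 : ℝ) < 2 ^ a := by positivity
  have e : (2 : ℝ) ^ (a + Real.log (1 / δ)) / (2 * 2 ^ a * δ) =
      2 ^ Real.log (1 / δ) * (1 / δ) / 2 := by
    rw [Real.rpow_add two_pos]; field_simp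
  rw [e, Real.log_div (by positivity) two_ne_zero, Real.log_mul (by positivity) (by positivity),
    Real.log_rpow two_pos]
  have h3 := Real.log_two_lt_d9
  have h4 := Real.log_pos one_lt_two
  nlinarith

end TestRange

/-- With `L = log(1/δ)` the hypothesis has the form `L^p δ X ≲ L`, hence `X ≲ δ⁻¹ L^(-(p-1))`. The
test functions are used at `δ/8`, which is at most `1/16` for every `δ < 1/2`. -/
theorem le_entropyBound_of_mul_le (hd : 3 ≤ d) (hp : p = (d : ℝ) / ((d : ℝ) - 1)) {δ : ℝ}
    (hδ : 0 < δ) (hδ2 : δ < 1 / 2) {β K : ℝ≥0}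
    (hβ : testConst d * Real.log (1 / (δ / 8)) / 2 ≤ β) {X : ℝ≥0∞}
    (hX : (β : ℝ≥0∞) ^ p * ((volume : Measure (EuclideanSpace ℝ (Fin d))).toSphere univ *
      ENNReal.ofReal (δ / 8 / 2 ^ (d - 1))) * X ≤
      K * ((volume : Measure (EuclideanSpace ℝ (Fin d))).toSphere univ *
        ENNReal.ofReal (2 * Real.log (1 / (δ / 8))))) :
    X ≤ ENNReal.ofReal ((K * (16 * 2 ^ (d - 1) * (2 / testConst d).toNNReal ^ p) : ℝ≥0) * δ⁻¹ *
      Real.log (1 / δ) ^ (-(1 / ((d : ℝ) - 1)))) := by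
  have hp1 := one_lt_criticalExponent hd hp
  have hp0 : 0 < p := by linarith
  have hτ := testConst_pos hd
  set τ := testConst d
  set σ := (volume : Measure (EuclideanSpace ℝ (Fin d))).toSphere univ with hσ
  have hσ0 : σ ≠ 0 := toSphere_univ_ne_zero (by omega)
  have hσt : σ ≠ ∞ := toSphere_univ_ne_top
  set L := Real.log (1 / δ) with hL
  set L' := Real.log (1 / (δ / 8)) with hL'
  have hL0 : 0 < L := Real.log_pos (by rw [lt_div_iff₀ hδ]; linarith)
  have hLL' : L ≤ L' := Real.log_le_log (by positivity)
    (one_div_le_one_div_of_le (by positivity) (by linarith))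
  have hL'0 : 0 < L' := hL0.trans_le hLL'
  set A : ℝ := (τ * L' / 2) ^ p * (δ / 8 / 2 ^ (d - 1)) with hA
  have hA0 : 0 < A := by positivity
  have h1 : ENNReal.ofReal A * X ≤ ENNReal.ofReal (K * (2 * L')) := by
    have h2 : σ * (ENNReal.ofReal A * X) ≤ σ * ENNReal.ofReal (K * (2 * L')) := by
      calc _ ≤ (β : ℝ≥0∞) ^ p * (σ * ENNReal.ofReal (δ / 8 / 2 ^ (d - 1))) * X := by
            have h3 : ENNReal.ofReal ((τ * L' / 2) ^ p) ≤ (β : ℝ≥0∞) ^ p := by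
              rw [← ENNReal.ofReal_coe_nnreal, ENNReal.ofReal_rpow_of_nonneg β.coe_nonneg hp0.le]
              exact ENNReal.ofReal_le_ofReal (Real.rpow_le_rpow (by positivity) hβ hp0.le)
            rw [hA, ENNReal.ofReal_mul (by positivity)]
            calc _ = ENNReal.ofReal ((τ * L' / 2) ^ p) *
                  (σ * ENNReal.ofReal (δ / 8 / 2 ^ (d - 1)) * X) := by ring
              _ ≤ _ := (mul_le_mul_left h3 _).trans_eq (by ring)
        _ ≤ _ := hX
        _ = _ := by
            rw [ENNReal.ofReal_mul K.coe_nonneg, ENNReal.ofReal_coe_nnreal]; ring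
    exact (ENNReal.mul_le_mul_iff_right hσ0 hσt).1 h2
  have hA0' : ENNReal.ofReal A ≠ 0 := by simpa using hA0
  have h2 : X ≤ ENNReal.ofReal (K * (2 * L') / A) := by
    rw [ENNReal.ofReal_div_of_pos hA0, ENNReal.le_div_iff_mul_le (Or.inl hA0')
      (Or.inl ENNReal.ofReal_ne_top), mul_comm]
    exact h1
  refine h2.trans (ENNReal.ofReal_le_ofReal ?_)
  have e1 : K * (2 * L') / A =
      (K * (16 * 2 ^ (d - 1) * (2 / τ) ^ p)) * δ⁻¹ * L' ^ (-(p - 1)) := by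
    have e2 : L' ^ (-(p - 1)) = L' / L' ^ p := by
      rw [neg_sub, Real.rpow_sub hL'0, Real.rpow_one]
    have e3 : (τ * L' / 2) ^ p = L' ^ p / (2 / τ) ^ p := by
      rw [← Real.div_rpow hL'0.le (by positivity)]
      congr 1; field_simp
    rw [hA, e2, e3]
    field_simp
    ring
  rw [e1, ← criticalExponent_sub_one hd hp]
  push_cast
  rw [Real.coe_toNNReal _ (by positivity)]
  refine mul_le_mul_of_nonneg_left ?_ (by positivity)
  exact Real.rpow_le_rpow_of_nonpos hL0 hLL' (by linarith)

theorem log_inv_eighth_pos {δ : ℝ} (hδ : 0 < δ) (hδ2 : δ < 1 / 2) :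
    0 < Real.log (1 / (δ / 8)) := Real.log_pos (by rw [lt_div_iff₀ (by positivity)]; linarith)

theorem eLpNorm_testFunction_le (hd : 3 ≤ d) (hp : p = (d : ℝ) / ((d : ℝ) - 1)) {δ : ℝ}
    (hδ : 0 < δ) (hδ1 : δ ≤ 1 / 16) (a : ℝ) :
    eLpNorm (testFunction d (2 * 2 ^ a * δ) (2 ^ (a + Real.log (1 / δ)))) (ENNReal.ofReal p)
      volume ^ p ≤ (volume : Measure (EuclideanSpace ℝ (Fin d))).toSphere univ *
        ENNReal.ofReal (2 * Real.log (1 / δ)) := by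
  rw [eLpNorm_testFunction hd hp (by positivity) (testRange_le hδ hδ1 a)]
  exact mul_le_mul_right (ENNReal.ofReal_le_ofReal (log_testRange_le hδ hδ1 a)) _

theorem uniformEntropyBound_of_weakType (hd : 3 ≤ d) (hp : p = (d : ℝ) / ((d : ℝ) - 1))
    (h : WeakTypeOnRadial d E p) : UniformEntropyBound d E := by
  have hp0 : 0 < p := by linarith [one_lt_criticalExponent hd hp]
  have hτ := testConst_pos hd
  obtain ⟨C, hC⟩ := h
  refine ⟨C * (16 * 2 ^ (d - 1) * (2 / testConst d).toNNReal ^ p), fun δ hδ hδ2 =>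
    iSup_le fun k => ?_⟩
  have hk := two_zpow_pos k
  have hδ' : 0 < δ / 8 := by positivity
  have hδ1 : δ / 8 ≤ 1 / 16 := by linarith
  have hL := log_inv_eighth_pos hδ hδ2
  set ω := testConst d * Real.log (1 / (δ / 8)) with hω
  have hω0 : 0 < ω := by positivity
  have hak : (2 : ℝ) ^ (k : ℝ) = 2 ^ k := Real.rpow_intCast 2 k
  -- Half of the lower bound for the means, so that the height is strictly exceeded.
  set α : ℝ := ω / 2 / (2 ^ k) ^ (d - 1) with hα
  have hα0 : 0 < α := by positivity
  have hω2 : ((ω / 2).toNNReal : ℝ) = ω / 2 := Real.coe_toNNReal _ (by positivity)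
  refine (entropyNumber_anti _ (show 2 ^ k * (δ / 8) ≤ 2 ^ k * δ by nlinarith)).trans ?_
  refine le_entropyBound_of_mul_le hd hp hδ hδ2 (β := (ω / 2).toNNReal) hω2.ge ?_
  have hlevel := entropyNumber_le_volume_level (E := E) hd hp hδ' hδ1 (k := k)
    (lo := 2 * 2 ^ (k : ℝ) * (δ / 8)) (hi := 2 ^ ((k : ℝ) + Real.log (1 / (δ / 8))))
    (by positivity) (by rw [hak]) (by
      rw [← hak]; exact Real.rpow_le_rpow_of_exponent_le one_le_two (by linarith))
    (α := α.toNNReal) (β := (ω / 2).toNNReal) (by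
      rw [Real.coe_toNNReal _ hα0.le, hω2, hα]; field_simp)
    (by rw [hω2]; linarith)
  refine hlevel.trans ?_
  have hw := hC _ (isRadial_testFunction d (2 * 2 ^ (k : ℝ) * (δ / 8))
    (2 ^ ((k : ℝ) + Real.log (1 / (δ / 8)))))
    (memLp_testFunction hd hp (by positivity) (testRange_le hδ' hδ1 k)) α hα0
  have hαp0 : ENNReal.ofReal α ^ p ≠ 0 := by
    simp [ENNReal.rpow_eq_zero_iff, hα0, hp0.not_gt]
  rw [ENNReal.le_div_iff_mul_le (Or.inl hαp0)
    (Or.inl (ENNReal.rpow_ne_top_of_nonneg hp0.le ENNReal.ofReal_ne_top)), mul_comm] at hw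
  exact hw.trans (mul_le_mul_right (eLpNorm_testFunction_le hd hp hδ' hδ1 k) _)

/-- A single test function whose support covers the scales `2^k` for all `k` in the interval
produces one large level set for each `k`. These occur at distinct dyadic heights, so their
contributions add up in the level form of the Lorentz quasinorm (`tsum_levels_le`). -/
theorem summedEntropyBound_of_boundedToLorentz (hd : 3 ≤ d) (hp : p = (d : ℝ) / ((d : ℝ) - 1))
    {q : ℝ} (hq : p < q) (h : BoundedRadialToLorentz d E p q) : SummedEntropyBound d E p q := by
  have hp0 : 0 < p := by linarith [one_lt_criticalExponent hd hp]
  have hq0 : 0 < q := by linarith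
  have hτ := testConst_pos hd
  obtain ⟨C, hC⟩ := h
  set s := q / p with hs
  have hs0 : 0 < s := by positivity
  have hps : p * s = q := by rw [hs, mul_div_cancel₀ _ hp0.ne']
  have hpq : p / q = 1 / s := by rw [hs, one_div_div]
  set K₁ : ℝ≥0∞ := (geomConst q * 2 ^ q) ^ (1 / s) * (C : ℝ≥0∞) ^ p with hK₁
  have hK₁t : K₁ ≠ ∞ := ENNReal.mul_ne_top (ENNReal.rpow_ne_top_of_nonneg (by positivity)
    (ENNReal.mul_ne_top (geomConst_ne_top hq0) (ENNReal.rpow_ne_top_of_nonneg hq0.le (by simp))))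
    (ENNReal.rpow_ne_top_of_nonneg hp0.le ENNReal.coe_ne_top)
  refine ⟨K₁.toNNReal * (16 * 2 ^ (d - 1) * (2 / testConst d).toNNReal ^ p), fun δ hδ hδ2 =>
    iSup_le fun a => ?_⟩
  have hδ' : 0 < δ / 8 := by positivity
  have hδ1 : δ / 8 ≤ 1 / 16 := by linarith
  have hL := log_inv_eighth_pos hδ hδ2
  have hLL' : Real.log δ⁻¹ ≤ Real.log (1 / (δ / 8)) := by
    rw [← one_div]
    exact Real.log_le_log (by positivity) (one_div_le_one_div_of_le (by positivity) (by linarith))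
  set L' := Real.log (1 / (δ / 8)) with hL'
  set ω := testConst d * L' with hω
  have hω0 : 0 < ω := by positivity
  -- The lower bound `ω` is rounded down to a strictly smaller power of two, so that all heights
  -- used are dyadic.
  obtain ⟨m₀, hm1, hm2⟩ := exists_mem_Ioc_zpow hω0 (one_lt_two : (1 : ℝ) < 2)
  rw [two_zpow_succ] at hm2
  set β : ℝ≥0 := 2 ^ m₀ with hβ
  have hβr : (β : ℝ) = 2 ^ m₀ := by rw [hβ]; push_cast; rfl
  set f := testFunction d (2 * 2 ^ a * (δ / 8)) (2 ^ (a + L')) with hf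
  set M := maximalFunction E f with hM
  set σ := (volume : Measure (EuclideanSpace ℝ (Fin d))).toSphere univ with hσ
  set κ : ℝ≥0∞ := (β : ℝ≥0∞) ^ p * (σ * ENNReal.ofReal (δ / 8 / 2 ^ (d - 1))) with hκ
  set N : ℤ → ℝ≥0∞ := fun k => entropyNumber (dyadicPiece E k) (2 ^ k * δ) with hN
  -- The height for `k` is `2^(m₀ - k(d-1))`; the map is injective because `d - 1 ≠ 0`.
  set level : ℤ → ℤ := fun k => m₀ - k * ((d - 1 : ℕ) : ℤ) with hlev
  have hd1 : ((d - 1 : ℕ) : ℤ) ≠ 0 := by exact_mod_cast (by omega : d - 1 ≠ 0)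
  have hinj : Function.Injective level := by
    intro k k' hkk
    simp only [hlev] at hkk
    exact mul_right_cancel₀ hd1 (by linarith)
  have hterm : ∀ k : {k : ℤ // (k : ℝ) ∈ Icc a (a + Real.log δ⁻¹)}, κ ^ s * N k ^ s ≤
      (dyadicScale 1 (level k) : ℝ≥0∞) ^ q *
        volume {x | (dyadicScale 1 (level k) : ℝ≥0∞) < M x} ^ s := by
    rintro ⟨k, hk1, hk2⟩
    have hk := two_zpow_pos k
    have hak : (2 : ℝ) ^ (k : ℝ) = 2 ^ k := Real.rpow_intCast 2 k
    have hlevel := entropyNumber_le_volume_level (E := E) hd hp hδ' hδ1 (k := k)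
      (lo := 2 * 2 ^ a * (δ / 8)) (hi := 2 ^ (a + L')) (by positivity) (by
        rw [← hak]
        have := Real.rpow_le_rpow_of_exponent_le one_le_two hk1
        nlinarith) (by
        rw [← hak]; exact Real.rpow_le_rpow_of_exponent_le one_le_two (by linarith))
      (α := dyadicScale 1 (level k)) (β := β) (by
        rw [hβr, dyadicScale]
        push_cast
        rw [one_mul, ← zpow_natCast, ← zpow_mul, ← zpow_add₀ two_ne_zero]
        congr 1
        simp only [hlev]; ring) (by rw [hβr]; exact hm1)
    have h1 : κ * N k ≤ (dyadicScale 1 (level k) : ℝ≥0∞) ^ p *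
        volume {x | (dyadicScale 1 (level k) : ℝ≥0∞) < M x} :=
      (mul_le_mul_right (entropyNumber_anti _
        (show 2 ^ k * (δ / 8) ≤ 2 ^ k * δ by nlinarith)) _).trans hlevel
    have h2 := ENNReal.rpow_le_rpow h1 hs0.le
    rwa [ENNReal.mul_rpow_of_nonneg κ (N k) hs0.le,
      ENNReal.mul_rpow_of_nonneg ((dyadicScale 1 (level k) : ℝ≥0∞) ^ p) _ hs0.le,
      ← ENNReal.rpow_mul (dyadicScale 1 (level k) : ℝ≥0∞), hps] at h2
  set Y : ℝ≥0∞ := ∑' k : {k : ℤ // (k : ℝ) ∈ Icc a (a + Real.log δ⁻¹)}, N k ^ s with hY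
  have hsum : κ ^ s * Y ≤ geomConst q * 2 ^ q * (C * eLpNorm f (ENNReal.ofReal p) volume) ^ q := by
    rw [hY, ← ENNReal.tsum_mul_left]
    calc _ ≤ ∑' k : {k : ℤ // (k : ℝ) ∈ Icc a (a + Real.log δ⁻¹)},
          (dyadicScale 1 (level k) : ℝ≥0∞) ^ q *
            volume {x | (dyadicScale 1 (level k) : ℝ≥0∞) < M x} ^ s := ENNReal.tsum_le_tsum hterm
      _ ≤ ∑' m : ℤ, (dyadicScale 1 m : ℝ≥0∞) ^ q *
            volume {x | (dyadicScale 1 m : ℝ≥0∞) < M x} ^ s :=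
          ENNReal.tsum_comp_le_tsum_of_injective (f := fun k :
            {k : ℤ // (k : ℝ) ∈ Icc a (a + Real.log δ⁻¹)} => level k)
            (hinj.comp Subtype.val_injective) _
      _ ≤ geomConst q * 2 ^ q * lorentzNorm volume p q M ^ q := tsum_levels_le volume M hp0 hq0
      _ ≤ _ := mul_le_mul_right (ENNReal.rpow_le_rpow (hC f (isRadial_testFunction _ _ _)
          (memLp_testFunction hd hp (by positivity) (testRange_le hδ' hδ1 a))) hq0.le) _
  rw [hpq]
  refine le_entropyBound_of_mul_le hd hp hδ hδ2 (β := β)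
    (show ω / 2 ≤ β by rw [hβr]; linarith) ?_
  rw [ENNReal.coe_toNNReal hK₁t]
  have h1s : 0 ≤ 1 / s := by positivity
  have hroot := ENNReal.rpow_le_rpow hsum h1s
  have hqs : q * (1 / s) = p := by rw [← hps]; field_simp
  rw [ENNReal.mul_rpow_of_nonneg _ _ h1s, ← ENNReal.rpow_mul, mul_one_div_cancel hs0.ne',
    ENNReal.rpow_one, ENNReal.mul_rpow_of_nonneg _ _ h1s, ← ENNReal.rpow_mul, hqs,
    ENNReal.mul_rpow_of_nonneg _ _ hp0.le, ← mul_assoc] at hroot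
  exact hroot.trans (mul_le_mul_right (eLpNorm_testFunction_le hd hp hδ' hδ1 a) _)

end SphericalMaximal
end

theorem theorem1p3 (d : ℕ) (hd : 3 ≤ d) (E : Set ℝ) (hE : E ⊆ Set.Ioi 0)
    (p : ℝ) (hp : p = (d : ℝ) / ((d : ℝ) - 1)) :
    (SphericalMaximal.WeakTypeOnRadial d E p ↔ SphericalMaximal.UniformEntropyBound d E) ∧
    (∀ q : ℝ, p < q →
      (SphericalMaximal.BoundedRadialToLorentz d E p q ↔
        SphericalMaximal.SummedEntropyBound d E p q)) :=
  ⟨⟨SphericalMaximal.uniformEntropyBound_of_weakType hd hp,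
    SphericalMaximal.weakType_of_uniformEntropyBound hd hp hE⟩, fun _ hq =>
    ⟨SphericalMaximal.summedEntropyBound_of_boundedToLorentz hd hp hq,
      SphericalMaximal.boundedToLorentz_of_summedEntropyBound hd hp hE hq⟩⟩
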